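/- Let $m\ge 2$ and let $G\le \mathrm{SU}(m-1)$ be a compact connected subgroup with Lie algebra $\mathfrak g$, acting on $\mathbb C^{m-1}$ in the standard way and on $\mathbb C^m=\mathbb C^{m-1}\times\mathbb C$ by acting trivially on the last coordinate. Let $$\mu:\mathbb C^{m-1}\to\mathfrak g,\qquad \mu(z)=-\tfrac12\,\pi_{\mathfrak g}(i z\bar z^{T})$$ be the standard moment map, where $\pi_{\mathfrak g}$ is the orthogonal projection onto $\mathfrak g$ for the $\mathrm{Ad}$-invariant inner product $\mathrm{Re}\,\mathrm{tr}(\bar A^{T}B)$. *Conventions.* $\mathbb C^N$ carries the symplectic form $\omega_0=\sum_i dx_i\wedge dy_i$. Submanifolds are smooth and boundaryless, and need not be closed or connected. An immersed (respectively embedded) submanifold of dimension $d$ is a subset that is the image of a smooth immersion (respectively a smooth immersion that is a homeomorphism onto its image) of a $d$-dimensional second countable Hausdorff smooth manifold; it is Lagrangian in a symplectic vector space $W$ if it lies in $W$, $2d=\dim_{\mathbb R} W$, and $\omega_0$ pulls back to $0$. A $G$-invariant submanifold $L$ of dimension $d$ is of cohomogeneity $k$ if there is a subgroup $H\le G$ such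 that the isotropy group of every point of $L$ is conjugate to $H$ in $G$, and $\dim(G/H)=d-k$. Let $Z$ be a connected component of $\mu^{-1}(0)$ that contains a non-empty $G$-invariant cohomogeneity-one Lagrangian submanifold of $\mathbb C^{m-1}$. Choose $z'\in Z\setminus\{0\}$ and let $P=\mathbb C z'$ be the complex line through $z'$. Let $C_k:=\mathrm{Stab}_G(P)/\mathrm{Stab}_G(z')$, with the action on $P$ induced by that of $\mathrm{Stab}_G(P)$, and let it act trivially on the factor $\mathbb C$ of $P\times\mathbb C$. **Proposition.** The maps $$L\longmapsto \check L:=L\cap(P\times\mathbb C),\qquad \check L\longmapsto L:=G\cdot\check L=\{g\cdot w: g\in G,\ w\in\check L\}$$ are mutually inverse bijections between - the $G$-invariant embedded Lagrangian submanifolds $L\subset Z\times\mathbb C$ of $\mathbb C^m$ of cohomogeneity two (if $m=2$, so that $G$ is trivial, $L$ is moreover required not to meet $\{0\}\times\mathbb C$), and - the $C_k$-invariant embedded $2$-dimensional Lagrangian submanifolds $\check L$ of $P\times\mathbb C$ that are contained in $(P\setminus\{0\})\times\mathbb C$; and the same holds with "embedded" replaced by "immersed" on both sides. -/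

import Mathlib

open scoped Manifold ContDiff Pointwise

namespace CohomTwo

/-- The Hermitian space `ℂⁿ`, on which `SU(n)` acts by matrix-vector multiplication. -/
abbrev Cn (n : ℕ) : Type := EuclideanSpace ℂ (Fin n)

/-- The special unitary group `SU(n)`, with the topology induced from the matrices. -/
abbrev SU (n : ℕ) : Type := Matrix.specialUnitaryGroup (Fin n) ℂ

/-- The action of `SU(n)` on `ℂⁿ⁺¹ = ℂⁿ × ℂ`, trivial on the last coordinate. -/
noncomputable instance extAction (n : ℕ) : MulAction (SU n) (Cn n × ℂ) where
  smul g w := (g • w.1, w.2)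
  one_smul w := Prod.ext (one_smul (SU n) w.1) rfl
  mul_smul g h w := Prod.ext (mul_smul g h w.1) rfl

/-! ### Lie algebra and moment map -/

/-- The Lie algebra of a matrix group `K ≤ SU(n)`: spanned by the generators of the one-parameter
subgroups of `K`. (For closed `K` these generators already form a subspace.) -/
noncomputable def lieAlg {n : ℕ} (K : Subgroup (SU n)) :
    Submodule ℝ (Matrix (Fin n) (Fin n) ℂ) :=
  Submodule.span ℝ {X | ∀ t : ℝ, ∃ g ∈ K, (g : Matrix (Fin n) (Fin n) ℂ) = NormedSpace.exp (t • X)}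

/-- The matrices as a Euclidean space, with the `Ad`-invariant inner product
`⟨A, B⟩ = Re tr(Aᴴ B)`. -/
noncomputable def frob (n : ℕ) :
    Matrix (Fin n) (Fin n) ℂ ≃ₗ[ℝ] EuclideanSpace ℂ (Fin n × Fin n) where
  toFun A := WithLp.toLp 2 fun p => A p.1 p.2
  invFun v := Matrix.of fun i j => v (i, j)
  map_add' _ _ := rfl
  map_smul' _ _ := rfl
  left_inv _ := rfl
  right_inv _ := rfl

/-- The orthogonal projection of the matrices onto the Lie algebra of `G`. -/
noncomputable def projLie {n : ℕ} (G : Subgroup (SU n)) (A : Matrix (Fin n) (Fin n) ℂ) :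
    Matrix (Fin n) (Fin n) ℂ :=
  (frob n).symm (((lieAlg G).map (frob n).toLinearMap).starProjection (frob n A))

/-- The standard moment map `μ(z) = -½ π_𝔤(i z z̄ᵀ)`. -/
noncomputable def momentMap {n : ℕ} (G : Subgroup (SU n)) (z : Cn n) :
    Matrix (Fin n) (Fin n) ℂ :=
  -((1 / 2 : ℝ) • projLie G (Complex.I • Matrix.vecMulVec z.ofLp (star z.ofLp)))

/-! ### Lagrangian submanifolds -/

/-- The standard symplectic form `∑ dxᵢ ∧ dyᵢ` of `ℂⁿ`. -/
noncomputable def symp {n : ℕ} (u v : Cn n) : ℝ :=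
  ∑ i, ((u i).re * (v i).im - (u i).im * (v i).re)

/-- The standard symplectic form of `ℂⁿ⁺¹ = ℂⁿ × ℂ`. -/
noncomputable def sympExt {n : ℕ} (u v : Cn n × ℂ) : ℝ :=
  symp u.1 v.1 + (u.2.re * v.2.im - u.2.im * v.2.re)

/-- `F : M → V` is a smooth immersion of the `d`-dimensional manifold `M` with `F^*σ = 0`.
If it takes values in a `2d`-dimensional symplectic subspace, it is a Lagrangian immersion into that
subspace. -/
structure IsIsotropicImmersion {V : Type} [NormedAddCommGroup V] [NormedSpace ℝ V]
    (σ : V → V → ℝ) (d : ℕ) {M : Type} [TopologicalSpace M]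
    [ChartedSpace (EuclideanSpace ℝ (Fin d)) M] (F : M → V) : Prop where
  smooth : ContMDiff (𝓡 d) 𝓘(ℝ, V) ∞ F
  immersive : ∀ p : M, Function.Injective (mfderiv (𝓡 d) 𝓘(ℝ, V) F p)
  isotropic : ∀ (p : M) (u v : TangentSpace (𝓡 d) p),
    σ (mfderiv (𝓡 d) 𝓘(ℝ, V) F p u) (mfderiv (𝓡 d) 𝓘(ℝ, V) F p v) = 0

/-- `L ⊆ V` is a `d`-dimensional immersed submanifold (the image of an immersion of a smooth
manifold, self-intersections allowed) on which `σ` vanishes. -/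
def IsImmersedIsotropic {V : Type} [NormedAddCommGroup V] [NormedSpace ℝ V]
    (σ : V → V → ℝ) (d : ℕ) (L : Set V) : Prop :=
  ∃ (M : Type) (_ : TopologicalSpace M) (_ : ChartedSpace (EuclideanSpace ℝ (Fin d)) M),
    T2Space M ∧ SecondCountableTopology M ∧ IsManifold (𝓡 d) ∞ M ∧
    ∃ F : M → V, IsIsotropicImmersion σ d F ∧ Set.range F = L

/-- `L ⊆ V` is a `d`-dimensional embedded submanifold (the image of an immersion of a smooth
manifold that is a homeomorphism onto its image) on which `σ` vanishes. -/
def IsEmbeddedIsotropic {V : Type} [NormedAddCommGroup V] [NormedSpace ℝ V]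
    (σ : V → V → ℝ) (d : ℕ) (L : Set V) : Prop :=
  ∃ (M : Type) (_ : TopologicalSpace M) (_ : ChartedSpace (EuclideanSpace ℝ (Fin d)) M),
    T2Space M ∧ SecondCountableTopology M ∧ IsManifold (𝓡 d) ∞ M ∧
    ∃ F : M → V, IsIsotropicImmersion σ d F ∧ Topology.IsEmbedding F ∧ Set.range F = L

/-! ### Invariance and cohomogeneity -/

/-- `L` is `G`-invariant. -/
def IsInvariant {n : ℕ} {V : Type} [MulAction (SU n) V] (G : Subgroup (SU n)) (L : Set V) : Prop :=
  ∀ g : G, ∀ w ∈ L, g • w ∈ L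

/-- `w` has isotropy type `(H)`: its isotropy group in `G` is conjugate to `H`. -/
def HasIsotropyType {n : ℕ} {V : Type} [MulAction (SU n) V] (G : Subgroup (SU n))
    (H : Subgroup G) (w : V) : Prop :=
  ∃ g : G, MulAction.stabilizer G w = H.map (MulAut.conj g).toMonoidHom

/-- A `G`-invariant `d`-dimensional submanifold `L` is of cohomogeneity `k`: all its points have
the same isotropy type `(H)`, and `dim (G/H) = dim G - dim H` equals `d - k`. -/
def IsCohomogeneity {n : ℕ} {V : Type} [MulAction (SU n) V] (G : Subgroup (SU n)) (d k : ℕ)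
    (L : Set V) : Prop :=
  ∃ H : Subgroup G, (∀ w ∈ L, HasIsotropyType G H w) ∧
    Module.finrank ℝ (lieAlg G) + k = Module.finrank ℝ (lieAlg (H.map G.subtype)) + d

/-! ### The complex line `P` and the group `C_k` -/

/-- The complex line through `z`. -/
noncomputable def line {n : ℕ} (z : Cn n) : Submodule ℂ (Cn n) := Submodule.span ℂ {z}

/-- The setwise stabiliser in `G` of the complex line through `z`. -/
noncomputable abbrev lineStab {n : ℕ} (G : Subgroup (SU n)) (z : Cn n) : Subgroup G :=
  MulAction.stabilizer G (line z : Set (Cn n))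

theorem smul_complex_smul {n : ℕ} (G : Subgroup (SU n)) (g : G) (c : ℂ) (v : Cn n) :
    g • (c • v) = c • (g • v) :=
  WithLp.ofLp_injective 2
    (Matrix.mulVec_smul ((g : SU n) : Matrix (Fin n) (Fin n) ℂ) c v.ofLp)

/-- An element of `G` that fixes `z` fixes the complex line through `z` pointwise. -/
theorem smul_eq_of_mem_line {n : ℕ} {G : Subgroup (SU n)} {z : Cn n} {g : G} (hg : g • z = z)
    {v : Cn n} (hv : v ∈ line z) : g • v = v := by
  obtain ⟨c, rfl⟩ := Submodule.mem_span_singleton.1 hv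
  rw [smul_complex_smul, hg]

theorem stabilizer_le_lineStab {n : ℕ} (G : Subgroup (SU n)) (z : Cn n) :
    MulAction.stabilizer G z ≤ lineStab G z := by
  intro g hg
  rw [MulAction.mem_stabilizer_iff] at hg ⊢
  ext v
  constructor
  · rintro ⟨w, hw, rfl⟩
    have h : g • w ∈ (line z : Set (Cn n)) := by
      rw [smul_eq_of_mem_line hg hw]
      exact hw
    exact h
  · intro hv
    exact ⟨v, hv, smul_eq_of_mem_line hg hv⟩

/-- The isotropy group of `z`, as a subgroup of the stabiliser of the complex line through `z`. -/
noncomputable def pointStab {n : ℕ} (G : Subgroup (SU n)) (z : Cn n) : Subgroup (lineStab G z) :=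
  (MulAction.stabilizer G z).subgroupOf (lineStab G z)

theorem smul_line_eq {n : ℕ} {G : Subgroup (SU n)} {z : Cn n} {h : lineStab G z}
    (hh : h ∈ pointStab G z) (v : (line z : Set (Cn n))) : h • v = v :=
  Subtype.ext (smul_eq_of_mem_line (g := (h : G)) hh v.2)

instance pointStab_normal {n : ℕ} (G : Subgroup (SU n)) (z : Cn n) : (pointStab G z).Normal where
  conj_mem h hh g := by
    have hz : z ∈ (line z : Set (Cn n)) := Submodule.mem_span_singleton_self z
    have key : (g * h * g⁻¹) • (⟨z, hz⟩ : (line z : Set (Cn n))) = ⟨z, hz⟩ := by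
      rw [mul_smul, mul_smul, smul_line_eq hh, smul_inv_smul]
    exact congrArg Subtype.val key

/-- The group `C_k = Stab(P) / Stab(z)`, where `P` is the complex line through `z`. -/
abbrev Ck {n : ℕ} (G : Subgroup (SU n)) (z : Cn n) : Type := lineStab G z ⧸ pointStab G z

/-- The natural action of `C_k` on `P`, induced by the action of `Stab(P)`. -/
noncomputable def ckAction {n : ℕ} (G : Subgroup (SU n)) (z : Cn n) :
    Ck G z →* Equiv.Perm (line z : Set (Cn n)) :=
  QuotientGroup.lift (pointStab G z)
    (MulAction.toPermHom (lineStab G z) (line z : Set (Cn n)))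
    fun _ hh => Equiv.ext (smul_line_eq hh)

/-- `S ⊆ P × ℂ` is `C_k`-invariant, where `C_k` acts trivially on the factor `ℂ`. -/
def IsCkInvariant {n : ℕ} (G : Subgroup (SU n)) (z : Cn n) (S : Set (Cn n × ℂ)) : Prop :=
  ∀ (c : Ck G z) (v : (line z : Set (Cn n))) (t : ℂ),
    ((v : Cn n), t) ∈ S → ((ckAction G z c v : Cn n), t) ∈ S

/-! ### The two sides of the correspondence and the two maps -/

/-- The zero level set of the moment map has `Z` as a connected component. -/
def IsZeroLevelComponent {n : ℕ} (G : Subgroup (SU n)) (Z : Set (Cn n)) : Prop :=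
  ∃ x ∈ momentMap G ⁻¹' {0}, Z = connectedComponentIn (momentMap G ⁻¹' {0}) x

/-- `Z` contains a (non-empty) `G`-invariant Lagrangian submanifold of `ℂⁿ` of
cohomogeneity one. -/
def AdmitsCohomOneLagrangian {n : ℕ} (G : Subgroup (SU n)) (Z : Set (Cn n)) : Prop :=
  ∃ L : Set (Cn n), L.Nonempty ∧ L ⊆ Z ∧ IsImmersedIsotropic symp n L ∧
    IsInvariant G L ∧ IsCohomogeneity G n 1 L

/-- `L` is a subset of `Z × ℂ` that is `G`-invariant and, as an `(n + 1)`-dimensional submanifold,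
of cohomogeneity two. For `n = 1`, where the group is trivial and `0` is not a singular orbit,
`L` is also required to avoid `{0} × ℂ`. -/
structure IsInvariantCohomTwo {n : ℕ} (G : Subgroup (SU n)) (Z : Set (Cn n))
    (L : Set (Cn n × ℂ)) : Prop where
  subset : ∀ w ∈ L, w.1 ∈ Z
  invariant : IsInvariant G L
  cohom : IsCohomogeneity G (n + 1) 2 L
  avoids : n = 1 → ∀ w ∈ L, w.1 ≠ 0

/-- `S` is a `C_k`-invariant subset of `(P ∖ {0}) × ℂ`, where `P` is the complex line
through `z`. -/
structure IsInvariantProfile {n : ℕ} (G : Subgroup (SU n)) (z : Cn n)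
    (S : Set (Cn n × ℂ)) : Prop where
  subset : ∀ w ∈ S, w.1 ∈ line z ∧ w.1 ≠ 0
  invariant : IsCkInvariant G z S

/-- The map `L ↦ L ∩ (P × ℂ)`. -/
def profile {n : ℕ} (z : Cn n) (L : Set (Cn n × ℂ)) : Set (Cn n × ℂ) :=
  L ∩ ((line z : Set (Cn n)) ×ˢ Set.univ)

/-- The map `S ↦ G · S = {g · w | g ∈ G, w ∈ S}`. -/
def saturation {n : ℕ} (G : Subgroup (SU n)) (S : Set (Cn n × ℂ)) : Set (Cn n × ℂ) :=
  {x | ∃ g : G, ∃ w ∈ S, x = g • w}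

end CohomTwo

/-! Write n = m − 1. The zero level of μ consists of the v with ⟨v, Xv⟩ = 0 for all X ∈ 𝔤. It is a
cone, hence connected, so Z is all of it. For x in it, 𝔤x is isotropic and Hermitian-orthogonal to
ℂx. Apart from the trivial case n = 1, the cohomogeneity-one Lagrangian supplies a non-zero x with
dim 𝔤x = n − 1, and then ℂⁿ = 𝔤x ⊕ i𝔤x ⊕ ℂx is a real orthogonal decomposition. A vector normal to
𝔤x is therefore cx + iYx with Y ∈ 𝔤 (`exists_decomp_of_perp`), and if it lies in the zero level,
then ⟨Yx, Y²x⟩ = 2i Re(c)|Yx|² (`inner_act_act_of_decomp`).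

This identity is used twice. Globally, a maximum of |⟨gx, v⟩| over the compact group G gives first
and second order conditions which, with the identity, force Yx = 0; hence G is transitive on the
complex lines in the zero level (`exists_smul_smul_eq`). This makes G · (L ∩ (P × ℂ)) equal to L and
gives every non-zero orbit the dimension n − 1. Locally, the right side of the identity is quadratic
in Yz while the left is at most cubic, so near z the zero level meets the normal space of the orbit
only in P (`exists_slice_radius`). This yields slice coordinates (`exists_slice`).

For regularity, a profile is swept out by a local family in G transverse to P. The result is an
isotropic immersion because orbit directions are Hermitian-orthogonal to P and its translates
(`Slice.isIsotropicPatch_sweep`). Conversely, a Lagrangian over the zero level contains all orbit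
directions in its tangent spaces, by maximality of Lagrangian subspaces, so it is transverse to the
slice and P × ℂ cuts it in a surface (`IsIsotropicPatch.exists_profile_patch`). Immersed
submanifolds are handled as countable unions of patches, embedded ones through local patches with
continuous left inverses. -/

namespace CohomTwo

open Filter Topology
section MatrixGroups

open scoped Matrix.Norms.L2Operator

/-! ### Matrices acting on `ℂⁿ` -/

/-- Complex square matrices. -/
abbrev Mat (n : ℕ) : Type := Matrix (Fin n) (Fin n) ℂ

/-- The operator on the Hermitian space `ℂⁿ` given by a matrix. -/
noncomputable def act {n : ℕ} (X : Mat n) : Cn n →L[ℂ] Cn n :=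
  Matrix.toEuclideanCLM (n := Fin n) (𝕜 := ℂ) X

theorem act_ofLp {n : ℕ} (X : Mat n) (v : Cn n) : (act X v).ofLp = X.mulVec v.ofLp := rfl

@[simp] theorem act_one {n : ℕ} (v : Cn n) : act (1 : Mat n) v = v := by
  rw [act, map_one, one_apply_eq_self]

theorem act_mul {n : ℕ} (X Y : Mat n) (v : Cn n) : act (X * Y) v = act X (act Y v) := by
  rw [act, map_mul, mul_apply_eq_comp]; rfl

theorem act_add {n : ℕ} (X Y : Mat n) (v : Cn n) : act (X + Y) v = act X v + act Y v :=
  WithLp.ofLp_injective 2 (Matrix.add_mulVec X Y v.ofLp)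

theorem act_sub {n : ℕ} (X Y : Mat n) (v : Cn n) : act (X - Y) v = act X v - act Y v :=
  WithLp.ofLp_injective 2 (Matrix.sub_mulVec X Y v.ofLp)

theorem act_neg {n : ℕ} (X : Mat n) (v : Cn n) : act (-X) v = -act X v :=
  WithLp.ofLp_injective 2 (Matrix.neg_mulVec v.ofLp X)

theorem act_real_smul {n : ℕ} (t : ℝ) (X : Mat n) (v : Cn n) : act (t • X) v = t • act X v :=
  WithLp.ofLp_injective 2 (Matrix.smul_mulVec t X v.ofLp)

theorem smul_eq_act {n : ℕ} (g : SU n) (v : Cn n) : g • v = act (g : Mat n) v := rfl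

theorem smul_eq_act' {n : ℕ} {G : Subgroup (SU n)} (g : G) (v : Cn n) :
    g • v = act ((g : SU n) : Mat n) v := rfl

theorem ext_smul {n : ℕ} {G : Subgroup (SU n)} (g : G) (w : Cn n × ℂ) :
    g • w = (g • w.1, w.2) := rfl

theorem conjTranspose_mul_coe {n : ℕ} (g : SU n) : (g : Mat n).conjTranspose * (g : Mat n) = 1 :=
  ((Matrix.mem_specialUnitaryGroup_iff.1 g.2).1).1

theorem coe_mul_conjTranspose {n : ℕ} (g : SU n) : (g : Mat n) * (g : Mat n).conjTranspose = 1 :=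
  ((Matrix.mem_specialUnitaryGroup_iff.1 g.2).1).2

theorem inner_act_left {n : ℕ} (X : Mat n) (u v : Cn n) :
    inner ℂ (act X u) v = inner ℂ u (act X.conjTranspose v) := by
  have : act X.conjTranspose = ContinuousLinearMap.adjoint (act X) := by
    rw [← ContinuousLinearMap.star_eq_adjoint, act, ← Matrix.star_eq_conjTranspose]
    exact map_star (Matrix.toEuclideanCLM (n := Fin n) (𝕜 := ℂ)) X
  rw [this, ContinuousLinearMap.adjoint_inner_right]

theorem inner_smul_smul {n : ℕ} (g : SU n) (u v : Cn n) :
    inner ℂ (g • u) (g • v) = inner ℂ u v := by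
  rw [smul_eq_act, smul_eq_act, inner_act_left, ← act_mul,
    conjTranspose_mul_coe, act_one]

theorem norm_coe_le_one {n : ℕ} {A : Mat n} (h : A.conjTranspose * A = 1) : ‖A‖ ≤ 1 := by
  have h1 : ‖A‖ * ‖A‖ ≤ 1 := by
    rw [← Matrix.l2_opNorm_conjTranspose_mul_self, h]
    rw [Matrix.l2_opNorm_def]
    refine ContinuousLinearMap.opNorm_le_bound _ zero_le_one fun v => ?_
    simp
  nlinarith [norm_nonneg A]

/-- Telescoping: for contractions, errors add up linearly. This controls the limit of γ(t/k)ᵏ in the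
closed subgroup theorem. -/
theorem norm_pow_sub_pow_le {n : ℕ} {A B : Mat n} (hA : ‖A‖ ≤ 1) (hB : ‖B‖ ≤ 1) (k : ℕ) :
    ‖A ^ (k + 1) - B ^ (k + 1)‖ ≤ (k + 1) * ‖A - B‖ := by
  induction k with
  | zero => simp
  | succ k ih =>
    have hpow : ‖B ^ (k + 1)‖ ≤ 1 := (norm_pow_le' _ k.succ_pos).trans (pow_le_one₀ (norm_nonneg _) hB)
    have : A ^ (k + 1 + 1) - B ^ (k + 1 + 1) =
        A * (A ^ (k + 1) - B ^ (k + 1)) + (A - B) * B ^ (k + 1) := by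
      rw [pow_succ' A, pow_succ' B]; noncomm_ring
    rw [this]
    calc _ ≤ ‖A‖ * ‖A ^ (k + 1) - B ^ (k + 1)‖ + ‖A - B‖ * ‖B ^ (k + 1)‖ :=
          (norm_add_le _ _).trans (add_le_add (norm_mul_le _ _) (norm_mul_le _ _))
      _ ≤ 1 * ((k + 1) * ‖A - B‖) + ‖A - B‖ * 1 := by gcongr
      _ = _ := by push_cast; ring

/-! ### The closed subgroup theorem -/

/-- `X` generates a one-parameter subgroup of `K`. -/
def IsGenerator {n : ℕ} (K : Subgroup (SU n)) (X : Mat n) : Prop :=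
  ∀ t : ℝ, ∃ g ∈ K, (g : Mat n) = NormedSpace.exp (t • X)

theorem isClosed_coe_image {n : ℕ} {G : Subgroup (SU n)} (hG : IsCompact (G : Set (SU n))) :
    IsClosed ((fun g : SU n => (g : Mat n)) '' (G : Set (SU n))) :=
  (hG.image continuous_subtype_val).isClosed

theorem skew_of_hasDerivAt {n : ℕ} {γ : ℝ → Mat n} {X : Mat n}
    (hγ : ∀ t, (γ t).conjTranspose * γ t = 1) (h0 : γ 0 = 1) (hd : HasDerivAt γ X 0) :
    X.conjTranspose = -X := by
  have h1 : HasDerivAt (fun t => star (γ t)) (star X) 0 := hd.star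
  have h2 := h1.mul hd
  have h3 : (fun t => star (γ t)) * γ = fun _ => (1 : Mat n) := by
    ext1 t; exact hγ t
  rw [h3] at h2
  have h4 := h2.unique (hasDerivAt_const (0 : ℝ) (1 : Mat n))
  rw [h0, star_one, mul_one, one_mul] at h4
  exact eq_neg_of_add_eq_zero_left h4

theorem exp_unitary {n : ℕ} {X : Mat n} (hX : X.conjTranspose = -X) :
    (NormedSpace.exp X).conjTranspose * NormedSpace.exp X = 1 := by
  rw [← Matrix.exp_conjTranspose, hX, ← Matrix.exp_add_of_commute _ _ (Commute.refl X).neg_left,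
    neg_add_cancel, NormedSpace.exp_zero]

theorem hasDerivAt_exp_smul_zero {n : ℕ} (X : Mat n) :
    HasDerivAt (fun t : ℝ => NormedSpace.exp (t • X)) X 0 := by
  simpa using hasDerivAt_exp_smul_const X (0 : ℝ)

/-- The powers γ(t/k)ᵏ lie in G and converge to exp(tX): the k-fold error is at most k |γ(t/k) −
exp(tX/k)|, which tends to 0 since the two curves agree to first order. Compactness makes G closed
among the matrices. Only differentiability of the curve at 0 is needed. -/
theorem isGenerator_of_hasDerivAt {n : ℕ} {G : Subgroup (SU n)}
    (hG : IsCompact (G : Set (SU n))) {γ : ℝ → Mat n} {X : Mat n}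
    (hγ : ∀ t, ∃ g ∈ G, (g : Mat n) = γ t) (h0 : γ 0 = 1) (hd : HasDerivAt γ X 0) :
    IsGenerator G X := by
  have hu : ∀ t, (γ t).conjTranspose * γ t = 1 := fun t => by
    obtain ⟨g, -, hg⟩ := hγ t
    rw [← hg, conjTranspose_mul_coe]
  have hX := skew_of_hasDerivAt hu h0 hd
  have hXt : ∀ t : ℝ, (t • X).conjTranspose = -(t • X) := fun t => by
    rw [Matrix.conjTranspose_smul, hX, star_trivial, smul_neg]
  intro t
  rcases eq_or_ne t 0 with rfl | ht
  · exact ⟨1, G.one_mem, by simp⟩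
  set s : ℕ → ℝ := fun k => t / (k + 1) with hs
  have hs0 : Tendsto s atTop (𝓝[≠] 0) := by
    refine tendsto_nhdsWithin_iff.2 ⟨tendsto_const_div_atTop_nhds_zero_nat t |>.comp
      (tendsto_add_atTop_nat 1) |>.congr fun k => by simp [hs], Eventually.of_forall fun k => ?_⟩
    have : (k : ℝ) + 1 ≠ 0 := by positivity
    exact div_ne_zero ht this
  have hdiff : HasDerivAt (fun r => γ r - NormedSpace.exp (r • X)) 0 0 := by
    exact (hd.sub (hasDerivAt_exp_smul_zero X)).congr_deriv (sub_self X)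
  have hlim := (hasDerivAt_iff_tendsto_slope_zero.1 hdiff).comp hs0
  have hlim' : Tendsto (fun k : ℕ => ((k : ℝ) + 1) * ‖γ (s k) - NormedSpace.exp (s k • X)‖)
      atTop (𝓝 0) := by
    have := (hlim.norm.const_mul |t|)
    simp only [norm_zero, mul_zero] at this
    refine this.congr fun k => ?_
    have hk : (0 : ℝ) < (k : ℝ) + 1 := by positivity
    simp only [Function.comp, zero_add, h0, zero_smul, NormedSpace.exp_zero, sub_self, sub_zero,
      norm_smul, Real.norm_eq_abs, hs, abs_div, abs_of_pos hk, inv_div]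
    rw [← mul_assoc, mul_div_cancel₀ _ (abs_ne_zero.2 ht)]
  have hpow : ∀ k : ℕ, NormedSpace.exp (s k • X) ^ (k + 1) = NormedSpace.exp (t • X) := fun k => by
    rw [← Matrix.exp_nsmul, ← Nat.cast_smul_eq_nsmul ℝ, smul_smul]
    congr 2
    have : (k : ℝ) + 1 ≠ 0 := by positivity
    simp only [hs]; push_cast; field_simp
  have hconv : Tendsto (fun k : ℕ => γ (s k) ^ (k + 1)) atTop (𝓝 (NormedSpace.exp (t • X))) := by
    rw [tendsto_iff_norm_sub_tendsto_zero]
    refine squeeze_zero (fun _ => norm_nonneg _) (fun k => ?_) hlim'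
    rw [← hpow k]
    exact norm_pow_sub_pow_le (norm_coe_le_one (hu _)) (norm_coe_le_one (exp_unitary (hXt _))) k
  obtain ⟨g, hg, hge⟩ := (isClosed_coe_image hG).mem_of_tendsto hconv
    (Eventually.of_forall fun k => by
      obtain ⟨g, hg, hge⟩ := hγ (s k)
      exact ⟨g ^ (k + 1), G.pow_mem hg _, by simp [hge]⟩)
  exact ⟨g, hg, hge⟩

/-- The span in the definition adds nothing for compact G: the sum of two generators is the velocity
at 0 of exp(tX) exp(tY), hence itself a generator. -/
theorem isGenerator_of_mem_lieAlg {n : ℕ} {G : Subgroup (SU n)}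
    (hG : IsCompact (G : Set (SU n))) {X : Mat n} (hX : X ∈ lieAlg G) : IsGenerator G X := by
  refine Submodule.span_induction (fun _ h => h) ?_ ?_ ?_ hX
  · exact fun t => ⟨1, G.one_mem, by simp⟩
  · intro X Y _ _ hX hY
    refine isGenerator_of_hasDerivAt hG
      (γ := fun t : ℝ => NormedSpace.exp (t • X) * NormedSpace.exp (t • Y)) (fun t => ?_)
      (by simp) ?_
    · obtain ⟨g, hg, hge⟩ := hX t
      obtain ⟨h, hh, hhe⟩ := hY t
      exact ⟨g * h, G.mul_mem hg hh, by simp [hge, hhe]⟩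
    · exact ((hasDerivAt_exp_smul_zero X).mul (hasDerivAt_exp_smul_zero Y)).congr_deriv (by simp)
  · intro c X _ hX t
    obtain ⟨g, hg, hge⟩ := hX (t * c)
    exact ⟨g, hg, by rw [hge, smul_smul]⟩

theorem mem_lieAlg_of_isGenerator {n : ℕ} {G : Subgroup (SU n)} {X : Mat n}
    (hX : IsGenerator G X) : X ∈ lieAlg G :=
  Submodule.subset_span hX

theorem conj_mem_lieAlg {n : ℕ} {G : Subgroup (SU n)} {X : Mat n} (hX : X ∈ lieAlg G)
    {g : SU n} (hg : g ∈ G) : (g : Mat n) * X * (g : Mat n).conjTranspose ∈ lieAlg G := by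
  have hinv : (g : Mat n)⁻¹ = (g : Mat n).conjTranspose :=
    Matrix.inv_eq_right_inv (coe_mul_conjTranspose g)
  have hunit : IsUnit (g : Mat n) :=
    ⟨⟨_, _, coe_mul_conjTranspose g, conjTranspose_mul_coe g⟩, rfl⟩
  refine Submodule.span_induction (fun X h => ?_) (by simp) ?_ ?_ hX
  · refine mem_lieAlg_of_isGenerator fun t => ?_
    obtain ⟨h, hh, hhe⟩ := h t
    refine ⟨g * h * g⁻¹, G.mul_mem (G.mul_mem hg hh) (G.inv_mem hg), ?_⟩
    have h1 : ((g⁻¹ : SU n) : Mat n) = (g : Mat n).conjTranspose := rfl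
    have h2 : t • ((g : Mat n) * X * (g : Mat n).conjTranspose) =
        (g : Mat n) * (t • X) * (g : Mat n)⁻¹ := by
      rw [hinv, Matrix.mul_smul, Matrix.smul_mul]
    rw [h2, Matrix.exp_conj _ _ hunit, ← hhe, hinv, ← h1]
    rfl
  · intro X Y _ _ hX hY
    rw [mul_add, add_mul]
    exact add_mem hX hY
  · intro c X _ hX
    rw [Matrix.mul_smul, Matrix.smul_mul]
    exact Submodule.smul_mem _ _ hX

theorem skew_of_mem_lieAlg {n : ℕ} {G : Subgroup (SU n)} {X : Mat n} (hX : X ∈ lieAlg G) :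
    X.conjTranspose = -X := by
  refine Submodule.span_induction (fun X h => ?_) (by simp) ?_ ?_ hX
  · refine skew_of_hasDerivAt (γ := fun t : ℝ => NormedSpace.exp (t • X)) (fun t => ?_) (by simp)
      (hasDerivAt_exp_smul_zero X)
    obtain ⟨g, -, hg⟩ := h t
    rw [← hg, conjTranspose_mul_coe]
  · intro X Y _ _ hX hY
    rw [Matrix.conjTranspose_add, hX, hY, neg_add]
  · intro c X _ hX
    rw [Matrix.conjTranspose_smul, hX, star_trivial, smul_neg]

/-- The bracket is the derivative at 0 of exp(tX) Y exp(tX)ᴴ, a curve in a closed subspace. -/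
theorem bracket_mem_lieAlg {n : ℕ} {G : Subgroup (SU n)} (hG : IsCompact (G : Set (SU n)))
    {X Y : Mat n} (hX : X ∈ lieAlg G) (hY : Y ∈ lieAlg G) : X * Y - Y * X ∈ lieAlg G := by
  have h1 := hasDerivAt_exp_smul_zero X
  have h2 : HasDerivAt (fun t : ℝ => star (NormedSpace.exp (t • X))) (star X) 0 := h1.star
  have h3 := (h1.mul_const Y).mul h2
  have hmem : ∀ t : ℝ, NormedSpace.exp (t • X) * Y * star (NormedSpace.exp (t • X)) ∈ lieAlg G := by
    intro t
    obtain ⟨g, hg, hge⟩ := isGenerator_of_mem_lieAlg hG hX t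
    rw [← hge]
    exact conj_mem_lieAlg hY hg
  have hsk : star X = -X := skew_of_mem_lieAlg hX
  have hlim := hasDerivAt_iff_tendsto_slope_zero.1 h3
  have : X * Y - Y * X =
      X * Y * star (NormedSpace.exp ((0 : ℝ) • X)) +
        NormedSpace.exp ((0 : ℝ) • X) * Y * star X := by
    simp [hsk, sub_eq_add_neg]
  rw [this]
  refine (Submodule.closed_of_finiteDimensional (lieAlg G)).mem_of_tendsto hlim
    (Eventually.of_forall fun t => ?_)
  exact Submodule.smul_mem _ _ (sub_mem (hmem _) (hmem _))

/-- The derivative of a curve in `G`, translated back to the identity, lies in the Lie algebra. -/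
theorem exists_mem_lieAlg_of_hasDerivAt {n : ℕ} {G : Subgroup (SU n)}
    (hG : IsCompact (G : Set (SU n))) {γ : ℝ → Mat n} {D : Mat n}
    (hγ : ∀ t, ∃ g ∈ G, (g : Mat n) = γ t) (hd : HasDerivAt γ D 0) :
    ∃ X ∈ lieAlg G, D = X * γ 0 := by
  obtain ⟨g, hg, hge⟩ := hγ 0
  refine ⟨D * (g : Mat n).conjTranspose, ?_, ?_⟩
  · refine mem_lieAlg_of_isGenerator (isGenerator_of_hasDerivAt hG
      (γ := fun t => γ t * (g : Mat n).conjTranspose) (fun t => ?_) ?_ (hd.mul_const _))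
    · obtain ⟨h, hh, hhe⟩ := hγ t
      exact ⟨h * g⁻¹, G.mul_mem hh (G.inv_mem hg), by rw [← hhe]; rfl⟩
    · rw [← hge, coe_mul_conjTranspose]
  · rw [← hge, mul_assoc, conjTranspose_mul_coe, mul_one]

end MatrixGroups

/-! ### The zero level set of the moment map -/

/-- Evaluation `X ↦ X v` of matrices at a vector. -/
noncomputable def evalAt {n : ℕ} (v : Cn n) : Mat n →ₗ[ℝ] Cn n where
  toFun X := act X v
  map_add' X Y := act_add X Y v
  map_smul' c X := act_real_smul c X v

/-- The tangent space `𝔤 v` of the orbit through `v`. -/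
noncomputable def orbitTangent {n : ℕ} (G : Subgroup (SU n)) (v : Cn n) : Submodule ℝ (Cn n) :=
  (lieAlg G).map (evalAt v)

theorem mem_orbitTangent {n : ℕ} {G : Subgroup (SU n)} {v a : Cn n} :
    a ∈ orbitTangent G v ↔ ∃ X ∈ lieAlg G, act X v = a := by
  rw [orbitTangent, Submodule.mem_map]
  rfl

theorem act_mem_orbitTangent {n : ℕ} {G : Subgroup (SU n)} (v : Cn n) {X : Mat n}
    (hX : X ∈ lieAlg G) : act X v ∈ orbitTangent G v :=
  mem_orbitTangent.2 ⟨X, hX, rfl⟩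

theorem real_inner_eq {n : ℕ} (u v : Cn n) : inner ℝ u v = (inner ℂ u v).re := by
  simp [PiLp.inner_apply]

theorem inner_act_of_mem_lieAlg {n : ℕ} {G : Subgroup (SU n)} {X : Mat n} (hX : X ∈ lieAlg G)
    (u v : Cn n) : inner ℂ (act X u) v = -inner ℂ u (act X v) := by
  rw [inner_act_left, skew_of_mem_lieAlg hX, act_neg, inner_neg_right]

theorem inner_frob {n : ℕ} (X : Mat n) (v : Cn n) :
    inner ℝ (frob n X) (frob n (Complex.I • Matrix.vecMulVec v.ofLp (star v.ofLp))) =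
      (inner ℂ v (act X v)).im := by
  have h1 : inner ℂ v (act X v) = ∑ i, ∑ j, X i j * v j * star (v i) := by
    simp [PiLp.inner_apply, act_ofLp, Matrix.mulVec, dotProduct, Finset.sum_mul]
  rw [h1, PiLp.inner_apply, Fintype.sum_prod_type, Complex.im_sum]
  refine Finset.sum_congr rfl fun i _ => ?_
  rw [Complex.im_sum]
  refine Finset.sum_congr rfl fun j _ => ?_
  have h2 : ∀ A : Mat n, (frob n A).ofLp (i, j) = A i j := fun A => rfl
  simp only [h2, Complex.inner, Matrix.smul_apply, Matrix.vecMulVec_apply, Pi.star_apply,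
    smul_eq_mul, Complex.mul_re, Complex.mul_im, Complex.conj_re, Complex.conj_im, Complex.I_re,
    Complex.I_im, RCLike.star_def]
  ring

/-- The zero level set of the moment map, in terms of the infinitesimal action. -/
theorem momentMap_eq_zero_iff {n : ℕ} {G : Subgroup (SU n)} {v : Cn n} :
    momentMap G v = 0 ↔ ∀ X ∈ lieAlg G, inner ℂ v (act X v) = 0 := by
  have h1 : momentMap G v = 0 ↔ ∀ X ∈ lieAlg G, (inner ℂ v (act X v)).im = 0 := by
    rw [momentMap, neg_eq_zero, smul_eq_zero_iff_right (by norm_num), projLie,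
      LinearEquiv.map_eq_zero_iff, Submodule.starProjection_apply_eq_zero_iff,
      Submodule.mem_orthogonal]
    constructor
    · intro h X hX
      rw [← inner_frob]
      exact h _ (Submodule.mem_map_of_mem hX)
    · rintro h _ ⟨X, hX, rfl⟩
      exact (inner_frob X v).trans (h X hX)
  rw [h1]
  refine forall₂_congr fun X hX => ⟨fun h => ?_, fun h => by rw [h]; rfl⟩
  -- The projection controls only the imaginary part; the real part vanishes because X is
  -- skew-Hermitian.
  have h2 := inner_act_of_mem_lieAlg hX v v
  rw [← inner_conj_symm] at h2
  have h3 := congrArg Complex.re h2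
  simp only [Complex.conj_re, Complex.neg_re] at h3
  exact Complex.ext (by simp only [Complex.zero_re]; linarith) h

theorem smul_mem_zeroLevel {n : ℕ} {G : Subgroup (SU n)} {v : Cn n} (hv : momentMap G v = 0)
    (c : ℂ) : momentMap G (c • v) = 0 := by
  rw [momentMap_eq_zero_iff] at hv ⊢
  intro X hX
  rw [map_smul, inner_smul_left, inner_smul_right, hv X hX, mul_zero, mul_zero]

theorem conj_act {n : ℕ} (X : Mat n) (g : SU n) (v : Cn n) :
    act ((g : Mat n) * X * (g : Mat n).conjTranspose) (g • v) = g • act X v := by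
  rw [smul_eq_act, smul_eq_act, ← act_mul, ← act_mul, mul_assoc, conjTranspose_mul_coe, mul_one]

theorem conj_act' {n : ℕ} (X : Mat n) (g : SU n) (v : Cn n) :
    act X (g • v) = g • act ((g : Mat n).conjTranspose * X * (g : Mat n)) v := by
  rw [smul_eq_act, smul_eq_act, ← act_mul, ← act_mul, ← mul_assoc, ← mul_assoc, coe_mul_conjTranspose,
    one_mul]

theorem conj_mem_lieAlg' {n : ℕ} {G : Subgroup (SU n)} {X : Mat n} (hX : X ∈ lieAlg G)
    {g : SU n} (hg : g ∈ G) : (g : Mat n).conjTranspose * X * (g : Mat n) ∈ lieAlg G := by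
  have h := conj_mem_lieAlg hX (G.inv_mem hg)
  have h1 : ((g⁻¹ : SU n) : Mat n) = (g : Mat n).conjTranspose := rfl
  rwa [h1, Matrix.conjTranspose_conjTranspose] at h

theorem group_smul_mem_zeroLevel {n : ℕ} {G : Subgroup (SU n)} {v : Cn n}
    (hv : momentMap G v = 0) (g : G) : momentMap G (g • v) = 0 := by
  rw [momentMap_eq_zero_iff] at hv ⊢
  intro X hX
  have : act X (g • v) = _ := conj_act' X (g : SU n) v
  rw [this]
  exact (inner_smul_smul (g : SU n) _ _).trans (hv _ (conj_mem_lieAlg' hX g.2))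

/-- The zero level is closed under scaling, hence star-shaped about 0 and connected, so it is its
only component. -/
theorem isZeroLevelComponent_eq {n : ℕ} {G : Subgroup (SU n)} {Z : Set (Cn n)}
    (hZ : IsZeroLevelComponent G Z) : Z = momentMap G ⁻¹' {0} := by
  obtain ⟨x, hx, rfl⟩ := hZ
  have h0 : (0 : Cn n) ∈ momentMap G ⁻¹' {0} := momentMap_eq_zero_iff.2 fun X _ => by simp
  have hstar : StarConvex ℝ (0 : Cn n) (momentMap G ⁻¹' {0}) := by
    rw [starConvex_zero_iff]
    intro v hv a _ _
    have := smul_mem_zeroLevel hv (a : ℂ)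
    rwa [Complex.coe_smul] at this
  exact (hstar.isPathConnected h0).isConnected.isPreconnected.connectedComponentIn hx

/-- Orbits in the zero level set are isotropic. -/
theorem inner_act_act_comm {n : ℕ} {G : Subgroup (SU n)} (hG : IsCompact (G : Set (SU n)))
    {v : Cn n} (hv : momentMap G v = 0) {X Y : Mat n} (hX : X ∈ lieAlg G) (hY : Y ∈ lieAlg G) :
    inner ℂ (act X v) (act Y v) = inner ℂ (act Y v) (act X v) := by
  have h := momentMap_eq_zero_iff.1 hv _ (bracket_mem_lieAlg hG hX hY)
  rw [act_sub, inner_sub_right] at h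
  rw [inner_act_of_mem_lieAlg hX, inner_act_of_mem_lieAlg hY, ← act_mul, ← act_mul]
  linear_combination -h

theorem inner_act_act_im {n : ℕ} {G : Subgroup (SU n)} (hG : IsCompact (G : Set (SU n)))
    {v : Cn n} (hv : momentMap G v = 0) {X Y : Mat n} (hX : X ∈ lieAlg G) (hY : Y ∈ lieAlg G) :
    (inner ℂ (act X v) (act Y v)).im = 0 := by
  have h := inner_act_act_comm hG hv hX hY
  rw [← inner_conj_symm] at h
  have h1 := congrArg Complex.im h
  have h2 := congrArg Complex.im (inner_act_act_comm hG hv hX hY)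
  rw [Complex.conj_im] at h1
  linarith

/-! ### Dimension of orbits -/

theorem lieAlg_mono {n : ℕ} {K L : Subgroup (SU n)} (h : K ≤ L) : lieAlg K ≤ lieAlg L :=
  Submodule.span_mono fun _ hX t => (hX t).imp fun _ hg => ⟨h hg.1, hg.2⟩

open scoped Matrix.Norms.L2Operator in
theorem norm_act_le {n : ℕ} (X : Mat n) (v : Cn n) : ‖act X v‖ ≤ ‖v‖ * ‖X‖ := by
  rw [mul_comm]
  exact Matrix.l2_opNorm_mulVec X v

open scoped Matrix.Norms.L2Operator in
/-- Evaluation of matrices at a vector, as a continuous linear map. -/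
noncomputable def evalCLM {n : ℕ} (v : Cn n) : Mat n →L[ℝ] Cn n :=
  (evalAt v).mkContinuous ‖v‖ fun X => norm_act_le X v

theorem evalCLM_apply {n : ℕ} (v : Cn n) (X : Mat n) : evalCLM v X = act X v := rfl

open scoped Matrix.Norms.L2Operator in
theorem hasDerivAt_exp_act {n : ℕ} (X : Mat n) (v : Cn n) (t : ℝ) :
    HasDerivAt (fun t : ℝ => act (NormedSpace.exp (t • X)) v)
      (act (NormedSpace.exp (t • X)) (act X v)) t := by
  have h1 : HasDerivAt (fun t : ℝ => NormedSpace.exp (t • X)) (NormedSpace.exp (t • X) * X) t :=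
    hasDerivAt_exp_smul_const X t
  have h2 : HasDerivAt (fun t : ℝ => evalCLM v (NormedSpace.exp (t • X)))
      (evalCLM v (NormedSpace.exp (t • X) * X)) t :=
    (evalCLM v).hasFDerivAt.comp_hasDerivAt t h1
  simpa only [evalCLM_apply, act_mul] using h2

/-- The curve exp(tX)v has velocity exp(tX)Xv, so it is constant exactly when Xv = 0. -/
theorem lieAlg_stabilizer {n : ℕ} {G : Subgroup (SU n)} (hG : IsCompact (G : Set (SU n)))
    (v : Cn n) : lieAlg ((MulAction.stabilizer G v).map G.subtype) =
      lieAlg G ⊓ LinearMap.ker (evalAt v) := by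
  apply le_antisymm
  · refine le_inf (lieAlg_mono (Subgroup.map_subtype_le _)) (Submodule.span_le.2 fun X hX => ?_)
    have h1 := hasDerivAt_exp_act X v 0
    have h2 : (fun t : ℝ => act (NormedSpace.exp (t • X)) v) = fun _ => v := by
      funext t
      obtain ⟨_, ⟨g, hg, rfl⟩, hge⟩ := hX t
      rw [← hge]
      exact hg
    rw [h2, zero_smul, NormedSpace.exp_zero, act_one] at h1
    exact (h1.unique (hasDerivAt_const (0 : ℝ) v))
  · rintro X ⟨hX, hXv⟩
    refine mem_lieAlg_of_isGenerator fun t => ?_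
    obtain ⟨g, hg, hge⟩ := isGenerator_of_mem_lieAlg hG hX t
    refine ⟨g, ⟨⟨g, hg⟩, ?_, rfl⟩, hge⟩
    have hXv' : act X v = 0 := hXv
    have h1 : ∀ t : ℝ, HasDerivAt (fun t : ℝ => act (NormedSpace.exp (t • X)) v) 0 t := fun t => by
      simpa [hXv'] using hasDerivAt_exp_act X v t
    have h2 := is_const_of_deriv_eq_zero (fun t => (h1 t).differentiableAt)
      (fun t => (h1 t).deriv) t 0
    simp only [zero_smul, NormedSpace.exp_zero, act_one] at h2
    rw [← hge] at h2
    exact h2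

/-- Rank-nullity for X ↦ Xv on 𝔤. It turns the cohomogeneity conditions, stated through isotropy
groups, into conditions on dim 𝔤v. -/
theorem finrank_orbitTangent_add {n : ℕ} {G : Subgroup (SU n)} (hG : IsCompact (G : Set (SU n)))
    (v : Cn n) : Module.finrank ℝ (orbitTangent G v) +
      Module.finrank ℝ (lieAlg ((MulAction.stabilizer G v).map G.subtype)) =
      Module.finrank ℝ (lieAlg G) := by
  rw [← LinearMap.finrank_range_add_finrank_ker ((evalAt v).domRestrict (lieAlg G)),
    LinearMap.range_domRestrict, LinearMap.ker_domRestrict, lieAlg_stabilizer hG, orbitTangent]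
  congr 1
  rw [← (Submodule.comapSubtypeEquivOfLe (inf_le_left :
    lieAlg G ⊓ LinearMap.ker (evalAt v) ≤ lieAlg G)).finrank_eq,
    Submodule.comap_inf, Submodule.comap_subtype_self, top_inf_eq]

theorem orbitTangent_smul {n : ℕ} {G : Subgroup (SU n)} (g : G) (c : ℂ) (hc : c ≠ 0) (v : Cn n) :
    Module.finrank ℝ (orbitTangent G (c • g • v)) = Module.finrank ℝ (orbitTangent G v) := by
  let e : Cn n →ₗ[ℝ] Cn n :=
    (c • act ((g : SU n) : Mat n)).toLinearMap.restrictScalars ℝ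
  have he : ∀ u, e u = c • g • u := fun u => rfl
  have hinj : Function.Injective e := fun u w h => by
    rw [he, he] at h
    exact MulAction.injective g (smul_right_injective _ hc h)
  have : orbitTangent G (c • g • v) = (orbitTangent G v).map e := by
    ext a
    simp only [Submodule.mem_map, mem_orbitTangent]
    constructor
    · rintro ⟨X, hX, rfl⟩
      refine ⟨_, ⟨_, conj_mem_lieAlg' hX g.2, rfl⟩, ?_⟩
      rw [he, map_smul]
      exact congrArg _ (conj_act' X (g : SU n) v).symm
    · rintro ⟨_, ⟨X, hX, rfl⟩, rfl⟩
      refine ⟨_, conj_mem_lieAlg hX g.2, ?_⟩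
      rw [he, map_smul]
      exact congrArg _ (conj_act X (g : SU n) v)
  rw [this]
  exact (Submodule.equivMapOfInjective e hinj _).finrank_eq.symm

/-! ### Orbits of codimension one more than Lagrangian -/

theorem finrank_real_Cn (n : ℕ) : Module.finrank ℝ (Cn n) = 2 * n := by
  rw [finrank_real_of_complex, finrank_euclideanSpace_fin]

theorem finrank_real_line {n : ℕ} {x : Cn n} (hx : x ≠ 0) :
    Module.finrank ℝ ((line x).restrictScalars ℝ) = 2 := by
  have h : Module.finrank ℝ (line x) = 2 * Module.finrank ℂ (line x) := finrank_real_of_complex _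
  rw [line, finrank_span_singleton hx] at h
  exact h

/-- Multiplication by a complex number as a real linear map. -/
noncomputable def cmul {n : ℕ} (c : ℂ) : Cn n →ₗ[ℝ] Cn n :=
  (LinearMap.lsmul ℂ (Cn n) c).restrictScalars ℝ

theorem cmul_apply {n : ℕ} (c : ℂ) (v : Cn n) : cmul c v = c • v := rfl

theorem finrank_map_cmul {n : ℕ} {c : ℂ} (hc : c ≠ 0) (S : Submodule ℝ (Cn n)) :
    Module.finrank ℝ (S.map (cmul c)) = Module.finrank ℝ S :=
  (Submodule.equivMapOfInjective (cmul c) (smul_right_injective _ hc) S).finrank_eq.symm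

theorem mem_line {n : ℕ} {z v : Cn n} : v ∈ line z ↔ ∃ c : ℂ, v = c • z := by
  rw [line, Submodule.mem_span_singleton]
  exact exists_congr fun c => eq_comm

/-- The three spaces 𝔤x, i𝔤x and ℂx are pairwise orthogonal over ℝ: the first two because orbits are
isotropic, the others by the moment map equation. Their dimensions (n − 1) + (n − 1) + 2 exhaust ℂⁿ,
and the 𝔤x-component of v vanishes by assumption. -/
theorem exists_decomp_of_perp {n : ℕ} {G : Subgroup (SU n)} (hG : IsCompact (G : Set (SU n)))
    {x : Cn n} (hx : momentMap G x = 0) (hx0 : x ≠ 0)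
    (hdim : Module.finrank ℝ (orbitTangent G x) + 1 = n) {v : Cn n}
    (hv : ∀ X ∈ lieAlg G, (inner ℂ v (act X x)).re = 0) :
    ∃ c : ℂ, ∃ Y ∈ lieAlg G, v = c • x + Complex.I • act Y x := by
  set A := orbitTangent G x with hA
  set B := A.map (cmul Complex.I) with hB
  set C := (line x).restrictScalars ℝ with hC
  have hAB : A ⟂ B := by
    rw [Submodule.isOrtho_iff_inner_eq]
    rintro a ha _ ⟨b, hb, rfl⟩
    obtain ⟨X, hX, rfl⟩ := mem_orbitTangent.1 ha
    obtain ⟨Y, hY, rfl⟩ := mem_orbitTangent.1 hb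
    rw [real_inner_eq, cmul_apply, inner_smul_right, Complex.mul_re, Complex.I_re, Complex.I_im,
      inner_act_act_im hG hx hX hY]
    simp
  have hinner : ∀ X ∈ lieAlg G, ∀ c : ℂ, inner ℂ (act X x) (c • x) = 0 := fun X hX c => by
    rw [inner_smul_right, inner_act_of_mem_lieAlg hX, momentMap_eq_zero_iff.1 hx X hX, neg_zero,
      mul_zero]
  have hAC : A ⟂ C := by
    rw [Submodule.isOrtho_iff_inner_eq]
    intro a ha b hb
    obtain ⟨X, hX, rfl⟩ := mem_orbitTangent.1 ha
    obtain ⟨c, rfl⟩ := mem_line.1 hb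
    rw [real_inner_eq, hinner X hX c, Complex.zero_re]
  have hBC : B ⟂ C := by
    rw [Submodule.isOrtho_iff_inner_eq]
    rintro _ ⟨a, ha, rfl⟩ b hb
    obtain ⟨X, hX, rfl⟩ := mem_orbitTangent.1 ha
    obtain ⟨c, rfl⟩ := mem_line.1 hb
    rw [real_inner_eq, cmul_apply, inner_smul_left, hinner X hX c, mul_zero, Complex.zero_re]
  have h1 := Submodule.finrank_sup_add_finrank_inf_eq B C
  rw [hBC.disjoint.eq_bot, finrank_bot, finrank_map_cmul Complex.I_ne_zero,
    finrank_real_line hx0] at h1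
  have hABC : A ⟂ B ⊔ C := Submodule.isOrtho_sup_right.2 ⟨hAB, hAC⟩
  have h2 := Submodule.finrank_sup_add_finrank_inf_eq A (B ⊔ C)
  rw [hABC.disjoint.eq_bot, finrank_bot] at h2
  have htop : A ⊔ (B ⊔ C) = ⊤ := by
    apply Submodule.eq_top_of_finrank_eq
    rw [finrank_real_Cn]
    omega
  obtain ⟨a, ha, w, hw, hawv⟩ := Submodule.mem_sup.1 (htop ▸ Submodule.mem_top : v ∈ A ⊔ (B ⊔ C))
  have ha0 : a = 0 := by
    have h3 : inner ℝ v a = 0 := by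
      obtain ⟨X, hX, rfl⟩ := mem_orbitTangent.1 ha
      rw [real_inner_eq, hv X hX]
    rw [← hawv, inner_add_left, real_inner_comm a w, Submodule.isOrtho_iff_inner_eq.1 hABC a ha w hw,
      add_zero] at h3
    exact inner_self_eq_zero.1 h3
  obtain ⟨_, ⟨b, hb, rfl⟩, e, he, hbe⟩ := Submodule.mem_sup.1 hw
  obtain ⟨Y, hY, rfl⟩ := mem_orbitTangent.1 hb
  obtain ⟨c, rfl⟩ := mem_line.1 he
  exact ⟨c, Y, hY, by rw [← hawv, ha0, zero_add, ← hbe, add_comm]; rfl⟩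

/-- The moment map equation for `c x + i Y x`, in the direction `Y`. -/
theorem inner_act_act_of_decomp {n : ℕ} {G : Subgroup (SU n)} {x : Cn n}
    (hx : momentMap G x = 0) {c : ℂ} {Y : Mat n} (hY : Y ∈ lieAlg G)
    (hv : momentMap G (c • x + Complex.I • act Y x) = 0) :
    inner ℂ (act Y x) (act Y (act Y x)) =
      2 * Complex.I * (c.re : ℂ) * inner ℂ (act Y x) (act Y x) := by
  have h := momentMap_eq_zero_iff.1 hv Y hY
  have h1 := momentMap_eq_zero_iff.1 hx Y hY
  have h2 : inner ℂ x (act Y (act Y x)) = -inner ℂ (act Y x) (act Y x) := by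
    rw [inner_act_of_mem_lieAlg hY x, neg_neg]
  simp only [map_add, map_smul, inner_add_left, inner_add_right, inner_smul_left, inner_smul_right,
    h1, h2, Complex.conj_I] at h
  have h3 : (starRingEnd ℂ) c = 2 * (c.re : ℂ) - c := by
    have := Complex.add_conj c
    push_cast at this
    linear_combination this
  rw [h3] at h
  linear_combination h + inner ℂ (act Y x) (act Y (act Y x)) * Complex.I_sq

/-- A positive second derivative would make the point a local minimum as well, so f would be locally
constant and its second derivative zero. -/
theorem deriv_deriv_nonpos_of_isLocalMax {f : ℝ → ℝ} (hf : IsLocalMax f 0)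
    (hf' : ContinuousAt f 0) : deriv (deriv f) 0 ≤ 0 := by
  by_contra! h
  have hmin := isLocalMin_of_deriv_deriv_pos h hf.deriv_eq_zero hf'
  have hc : f =ᶠ[𝓝 0] fun _ => f 0 := by
    filter_upwards [hf, hmin] with t h1 h2 using le_antisymm h1 h2
  have h1 : deriv f =ᶠ[𝓝 0] fun _ => 0 := by
    have := hc.deriv
    simpa using this
  have h2 := h1.deriv_eq
  simp only [deriv_const] at h2
  exact h.ne' h2

/-- The group acts transitively on the complex lines in the zero level set. -/
theorem exists_smul_smul_eq {n : ℕ} {G : Subgroup (SU n)} (hG : IsCompact (G : Set (SU n)))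
    {x : Cn n} (hx : momentMap G x = 0) (hx0 : x ≠ 0)
    (hdim : Module.finrank ℝ (orbitTangent G x) + 1 = n) {v : Cn n} (hv : momentMap G v = 0) :
    ∃ g : G, ∃ c : ℂ, v = c • g • x := by
  have hcont : Continuous fun g : SU n => ‖inner ℂ (g • x) v‖ := by
    have h1 : Continuous fun g : SU n => g • x :=
      (evalCLM x).continuous.comp continuous_subtype_val
    exact (h1.inner continuous_const).norm
  -- The orbit point whose complex line is closest to that of v; it will turn out to be proportional
  -- to v.
  obtain ⟨g₀, hg₀, hmax⟩ := hG.exists_isMaxOn ⟨1, G.one_mem⟩ hcont.continuousOn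
  have hmax' : ∀ g ∈ G, ‖inner ℂ (g • x) v‖ ≤ ‖inner ℂ (g₀ • x) v‖ := fun g hg => hmax hg
  set M := ‖inner ℂ (g₀ • x) v‖ with hM
  have hx2 : (inner ℂ x x : ℂ) ≠ 0 := fun h => hx0 (inner_self_eq_zero.1 h)
  rcases (norm_nonneg (inner ℂ (g₀ • x) v : ℂ)).eq_or_lt with h0 | hpos
  · -- every inner product with the orbit vanishes, hence `v = 0`
    have hzero : ∀ g ∈ G, inner ℂ (g • x) v = (0 : ℂ) := fun g hg =>
      norm_le_zero_iff.1 ((hmax' g hg).trans (by rw [hM, ← h0]))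
    have hX : ∀ X ∈ lieAlg G, inner ℂ v (act X x) = (0 : ℂ) := by
      intro X hX
      have h1 := (hasDerivAt_exp_act X x 0)
      have h2 := ((innerSL ℂ v).restrictScalars ℝ).hasFDerivAt.comp_hasDerivAt (0 : ℝ) h1
      have h3 : (((innerSL ℂ v).restrictScalars ℝ) ∘ fun t : ℝ => act (NormedSpace.exp (t • X)) x) =
          fun _ => (0 : ℂ) := by
        funext t
        obtain ⟨g, hg, hge⟩ := isGenerator_of_mem_lieAlg hG hX t
        have := hzero g hg
        rw [smul_eq_act, hge, ← inner_conj_symm, map_eq_zero] at this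
        exact this
      rw [h3] at h2
      have h4 := h2.unique (hasDerivAt_const (0 : ℝ) (0 : ℂ))
      simpa using h4
    obtain ⟨c, Y, hY, hvc⟩ := exists_decomp_of_perp hG hx hx0 hdim
      (fun X hXm => by rw [hX X hXm, Complex.zero_re] : ∀ X ∈ lieAlg G, _)
    have h1 := hzero 1 G.one_mem
    have hYx : inner ℂ x (act Y x) = (0 : ℂ) := momentMap_eq_zero_iff.1 hx Y hY
    rw [one_smul, hvc, inner_add_right, inner_smul_right, inner_smul_right, hYx, mul_zero, add_zero,
      mul_eq_zero, or_iff_left hx2] at h1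
    have h2 := hX Y hY
    rw [hvc, h1, zero_smul, zero_add, inner_smul_left, mul_eq_zero,
      or_iff_right (by simp), inner_self_eq_zero] at h2
    exact ⟨1, 0, by rw [hvc, h1, h2]; simp⟩
  · have hM0 : (M : ℂ) ≠ 0 := Complex.ofReal_ne_zero.2 hpos.ne'
    -- The phase u and the translation by g₀⁻¹ move the maximum to the identity and make ⟨x, w⟩ the
    -- positive real number M.
    set u : ℂ := (starRingEnd ℂ) (inner ℂ (g₀ • x) v) / M with hu
    have hun : ‖u‖ = 1 := by
      rw [hu, norm_div, RCLike.norm_conj, Complex.norm_real, Real.norm_of_nonneg hpos.le,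
        ← hM, div_self hpos.ne']
    have hu0 : u ≠ 0 := fun h => by rw [h, norm_zero] at hun; exact zero_ne_one hun
    let h₀ : G := ⟨g₀, hg₀⟩
    set w : Cn n := u • h₀⁻¹ • v with hw
    have hwZ : momentMap G w = 0 := smul_mem_zeroLevel (group_smul_mem_zeroLevel hv _) u
    have hinner : ∀ g : SU n, inner ℂ (g • x) w = u * inner ℂ ((g₀ * g) • x) v := fun g => by
      have h2 : h₀⁻¹ • v = g₀⁻¹ • v := rfl
      rw [hw, h2, inner_smul_right, ← inner_smul_smul g₀, smul_inv_smul, mul_smul]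
    have hone : inner ℂ x w = (M : ℂ) := by
      have h1 := hinner 1
      rw [one_smul, mul_one] at h1
      rw [h1, hu, div_mul_eq_mul_div, ← Complex.normSq_eq_conj_mul_self, Complex.normSq_eq_norm_sq,
        ← hM]
      push_cast
      field_simp
    have hle : ∀ g ∈ G, (inner ℂ w (g • x)).re ≤ (inner ℂ w x).re := by
      intro g hg
      rw [← inner_conj_symm w x, hone, Complex.conj_re, Complex.ofReal_re, ← inner_conj_symm,
        Complex.conj_re, hinner]
      refine (Complex.re_le_norm _).trans ?_
      rw [norm_mul, hun, one_mul]
      exact hmax' _ (G.mul_mem hg₀ hg)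
    have hder : ∀ (X : Mat n) (y : Cn n) (t : ℝ),
        HasDerivAt (fun t : ℝ => (inner ℂ w (act (NormedSpace.exp (t • X)) y)).re)
          (inner ℂ w (act (NormedSpace.exp (t • X)) (act X y))).re t := fun X y t =>
      (Complex.reCLM.comp ((innerSL ℂ w).restrictScalars ℝ)).hasFDerivAt.comp_hasDerivAt t
        (hasDerivAt_exp_act X y t)
    have hlocmax : ∀ X ∈ lieAlg G, IsLocalMax
        (fun t : ℝ => (inner ℂ w (act (NormedSpace.exp (t • X)) x)).re) 0 := by
      intro X hX
      refine Eventually.of_forall fun t => ?_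
      obtain ⟨g, hg, hge⟩ := isGenerator_of_mem_lieAlg hG hX t
      have := hle g hg
      rw [smul_eq_act, hge] at this
      simpa using this
    have hfirst : ∀ X ∈ lieAlg G, (inner ℂ w (act X x)).re = 0 := fun X hX => by
      simpa using (hlocmax X hX).hasDerivAt_eq_zero (hder X x 0)
    obtain ⟨c, Y, hY, hwc⟩ := exists_decomp_of_perp hG hx hx0 hdim hfirst
    have hsecond : (inner ℂ w (act Y (act Y x))).re ≤ 0 := by
      have h1 := deriv_deriv_nonpos_of_isLocalMax (hlocmax Y hY) (hder Y x 0).continuousAt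
      have h2 : deriv (fun t : ℝ => (inner ℂ w (act (NormedSpace.exp (t • Y)) x)).re) =
          fun t : ℝ => (inner ℂ w (act (NormedSpace.exp (t • Y)) (act Y x))).re :=
        funext fun t => (hder Y x t).deriv
      rw [h2, (hder Y (act Y x) 0).deriv] at h1
      simpa using h1
    have hYx : inner ℂ x (act Y x) = (0 : ℂ) := momentMap_eq_zero_iff.1 hx Y hY
    have hc : c * inner ℂ x x = (M : ℂ) := by
      rw [← hone, hwc, inner_add_right, inner_smul_right, inner_smul_right, hYx, mul_zero, add_zero]
    have hcre : 0 < c.re := by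
      have h1 := congrArg Complex.re hc
      rw [inner_self_eq_norm_sq_to_K] at h1
      have h2 : (c * (‖x‖ : ℂ) ^ 2).re = c.re * ‖x‖ ^ 2 := by
        rw [← Complex.ofReal_pow, Complex.re_mul_ofReal]
      rw [Complex.ofReal_re] at h1
      have h3 : 0 < c.re * ‖x‖ ^ 2 := by
        rw [← h2]; exact lt_of_lt_of_eq hpos h1.symm
      exact pos_of_mul_pos_left h3 (by positivity)
    have hid := inner_act_act_of_decomp hx hY (hwc ▸ hwZ)
    -- By the moment map identity, Re⟨w, Y²x⟩ = −Re(c)|Yx|² + 2 Re(c)|Yx|² = Re(c)|Yx|². The second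
    -- order condition makes this non-positive although Re c > 0.
    have hy0 : act Y x = 0 := by
      have h2 : inner ℂ x (act Y (act Y x)) = -inner ℂ (act Y x) (act Y x) := by
        rw [inner_act_of_mem_lieAlg hY x, neg_neg]
      rw [hwc, inner_add_left, inner_smul_left, inner_smul_left, h2, hid,
        inner_self_eq_norm_sq_to_K] at hsecond
      by_contra hne
      have hn : 0 < ‖act Y x‖ := norm_pos_iff.2 hne
      have h4 : ((starRingEnd ℂ) c * -((‖act Y x‖ : ℂ) ^ 2) +
          (starRingEnd ℂ) Complex.I * (2 * Complex.I * (c.re : ℂ) * (‖act Y x‖ : ℂ) ^ 2)).re =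
          c.re * ‖act Y x‖ ^ 2 := by
        rw [← Complex.ofReal_pow]
        generalize ‖act Y x‖ ^ 2 = r
        simp
        ring
      have h5 : c.re * ‖act Y x‖ ^ 2 ≤ 0 := h4 ▸ hsecond
      have : 0 < c.re * ‖act Y x‖ ^ 2 := by positivity
      linarith
    refine ⟨h₀, u⁻¹ * c, ?_⟩
    have h1 : h₀ • w = u • v := by
      rw [hw, smul_complex_smul, smul_inv_smul]
    rw [hwc, hy0, smul_zero, add_zero, smul_complex_smul] at h1
    rw [mul_smul, h1, inv_smul_smul₀ hu0]

/-- Near `z`, the points of the zero level set normal to the orbit of `z` lie on the complex line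
through `z`. -/
theorem exists_slice_radius {n : ℕ} {G : Subgroup (SU n)} (hG : IsCompact (G : Set (SU n)))
    {z : Cn n} (hz : momentMap G z = 0) (hz0 : z ≠ 0)
    (hdim : Module.finrank ℝ (orbitTangent G z) + 1 = n) :
    ∃ ε > 0, ∀ v : Cn n, ‖v - z‖ < ε → momentMap G v = 0 →
      (∀ X ∈ lieAlg G, (inner ℂ v (act X z)).re = 0) → v ∈ line z := by
  -- The Y with a given value Yz is determined only modulo the stabiliser algebra. A linear section
  -- s makes a choice with ‖Y‖ ≤ K‖Yz‖.
  obtain ⟨s, hs⟩ := ((evalAt z).submoduleMap (lieAlg G)).exists_rightInverse_of_surjective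
    (LinearMap.range_eq_top.2 ((evalAt z).submoduleMap_surjective (lieAlg G)))
  open scoped Matrix.Norms.L2Operator in
  obtain ⟨K, hK, hsK⟩ : ∃ K > 0, ∀ a, ‖((s a : lieAlg G) : Mat n)‖ ≤ K * ‖a‖ := by
    let L := ((lieAlg G).subtype.comp s).toContinuousLinearMap
    refine ⟨‖L‖ + 1, by positivity, fun a => (L.le_opNorm a).trans ?_⟩
    gcongr
    linarith
  have hzn : 0 < ‖z‖ := norm_pos_iff.2 hz0
  -- The bound ‖z‖/2 will force Re c > 1/2, and K⁻¹ will force K‖Yz‖ < 1.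
  refine ⟨min (‖z‖ / 2) K⁻¹, by positivity, fun v hvε hv hperp => ?_⟩
  obtain ⟨c, Y₀, hY₀, hvc⟩ := exists_decomp_of_perp hG hz hz0 hdim hperp
  let a : (lieAlg G).map (evalAt z) := ⟨act Y₀ z, mem_orbitTangent.2 ⟨Y₀, hY₀, rfl⟩⟩
  set Y : Mat n := (s a : Mat n) with hYdef
  have hY : Y ∈ lieAlg G := (s a).2
  have hYz : act Y z = act Y₀ z := congrArg Subtype.val (LinearMap.congr_fun hs a)
  rw [← hYz] at hvc
  have hbound : ‖act Y (act Y z)‖ ≤ K * ‖act Y z‖ * ‖act Y z‖ := by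
    refine (norm_act_le Y _).trans ?_
    rw [mul_comm]
    refine mul_le_mul_of_nonneg_right ((hsK a).trans_eq ?_) (norm_nonneg _)
    rw [hYz]; rfl
  have hid := inner_act_act_of_decomp hz hY (hvc ▸ hv)
  have hzY : inner ℂ z (act Y z) = (0 : ℂ) := momentMap_eq_zero_iff.1 hz Y hY
  have hYn : ‖act Y z‖ ≤ ‖v - z‖ := by
    have h1 : inner ℂ (act Y z) (v - z) = Complex.I * (‖act Y z‖ : ℂ) ^ 2 := by
      rw [hvc, inner_sub_right, inner_add_right, inner_smul_right, inner_smul_right,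
        inner_act_of_mem_lieAlg hY z, hzY, inner_self_eq_norm_sq_to_K]
      simp
    have h2 := norm_inner_le_norm (𝕜 := ℂ) (act Y z) (v - z)
    rw [h1, norm_mul, Complex.norm_I, one_mul, norm_pow, Complex.norm_real, norm_norm] at h2
    by_contra! h3
    nlinarith [norm_nonneg (v - z)]
  have hc : 1 / 2 < c.re := by
    have h1 : inner ℂ z (v - z) = (c - 1) * (‖z‖ : ℂ) ^ 2 := by
      rw [hvc, inner_sub_right, inner_add_right, inner_smul_right, inner_smul_right,
        hzY, inner_self_eq_norm_sq_to_K]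
      simp
      ring
    have h2 := norm_inner_le_norm (𝕜 := ℂ) z (v - z)
    rw [h1, norm_mul, norm_pow, Complex.norm_real, norm_norm] at h2
    have h3 : ‖c - 1‖ * ‖z‖ ≤ ‖v - z‖ := by
      by_contra! h3
      nlinarith
    have h4 : ‖v - z‖ < ‖z‖ / 2 := hvε.trans_le (min_le_left _ _)
    have h5 : ‖c - 1‖ < 1 / 2 := by
      by_contra! h5
      nlinarith
    have h6 := (Complex.abs_re_le_norm (c - 1)).trans_lt h5
    rw [Complex.sub_re, Complex.one_re, abs_lt] at h6
    linarith [h6.1]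
  -- The identity gives 2 Re(c)|Yz|² ≤ K|Yz|³ < |Yz|² unless Yz = 0, contradicting Re c > 1/2.
  have hy0 : act Y z = 0 := by
    by_contra hne
    have hn : 0 < ‖act Y z‖ := norm_pos_iff.2 hne
    have h1 := norm_inner_le_norm (𝕜 := ℂ) (act Y z) (act Y (act Y z))
    rw [hid, inner_self_eq_norm_sq_to_K] at h1
    have h2 : ‖2 * Complex.I * (c.re : ℂ) * (‖act Y z‖ : ℂ) ^ 2‖ = 2 * c.re * ‖act Y z‖ ^ 2 := by
      simp [abs_of_pos (show 0 < c.re by linarith)]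
    have h3 : 2 * c.re * ‖act Y z‖ ^ 2 ≤ ‖act Y z‖ * ‖act Y (act Y z)‖ := h2 ▸ h1
    have h4 : ‖act Y z‖ < K⁻¹ := hYn.trans_lt (hvε.trans_le (min_le_right _ _))
    have h5 : K * ‖act Y z‖ < 1 := by
      calc K * ‖act Y z‖ < K * K⁻¹ := by gcongr
        _ = 1 := mul_inv_cancel₀ hK.ne'
    have h6 : ‖act Y z‖ * ‖act Y (act Y z)‖ ≤ ‖act Y z‖ * (K * ‖act Y z‖ * ‖act Y z‖) := by gcongr
    have h7 : 0 < ‖act Y z‖ ^ 2 := by positivity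
    nlinarith
  rw [hvc, hy0, smul_zero, add_zero]
  exact mem_line.2 ⟨c, rfl⟩

/-! ### Isotropic patches -/

section Patches

variable {E E' V : Type} [NormedAddCommGroup E] [NormedSpace ℝ E]
  [NormedAddCommGroup E'] [NormedSpace ℝ E'] [NormedAddCommGroup V] [NormedSpace ℝ V]
  {σ : V → V → ℝ}

/-- `φ` is a smooth isotropic immersion of the open subset `U` of a vector space. -/
structure IsIsotropicPatch (σ : V → V → ℝ) (U : Set E) (φ : E → V) : Prop where
  isOpen : IsOpen U
  smooth : ContDiffOn ℝ ∞ φ U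
  immersive : ∀ x ∈ U, Function.Injective (fderiv ℝ φ x)
  isotropic : ∀ x ∈ U, ∀ u v : E, σ (fderiv ℝ φ x u) (fderiv ℝ φ x v) = 0

theorem IsIsotropicPatch.differentiableAt {U : Set E} {φ : E → V} (h : IsIsotropicPatch σ U φ)
    {x : E} (hx : x ∈ U) : DifferentiableAt ℝ φ x :=
  (h.smooth.contDiffAt (h.isOpen.mem_nhds hx)).differentiableAt (by simp)

theorem IsIsotropicPatch.mono {U U' : Set E} {φ : E → V} (h : IsIsotropicPatch σ U φ)
    (hU' : IsOpen U') (hsub : U' ⊆ U) : IsIsotropicPatch σ U' φ where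
  isOpen := hU'
  smooth := h.smooth.mono hsub
  immersive x hx := h.immersive x (hsub hx)
  isotropic x hx := h.isotropic x (hsub hx)

theorem IsIsotropicPatch.congr {U : Set E} {φ φ' : E → V} (h : IsIsotropicPatch σ U φ)
    (heq : Set.EqOn φ' φ U) : IsIsotropicPatch σ U φ' := by
  have hd : ∀ x ∈ U, fderiv ℝ φ' x = fderiv ℝ φ x := fun x hx =>
    (heq.eventuallyEq_of_mem (h.isOpen.mem_nhds hx)).fderiv_eq
  refine ⟨h.isOpen, h.smooth.congr heq, fun x hx => ?_, fun x hx u v => ?_⟩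
  · rw [hd x hx]; exact h.immersive x hx
  · rw [hd x hx]; exact h.isotropic x hx u v

theorem IsIsotropicPatch.comp {U : Set E} {φ : E → V} (h : IsIsotropicPatch σ U φ) {U' : Set E'}
    {j : E' → E} (hU' : IsOpen U') (hj : ContDiffOn ℝ ∞ j U') (hmaps : Set.MapsTo j U' U)
    (hinj : ∀ x ∈ U', Function.Injective (fderiv ℝ j x)) : IsIsotropicPatch σ U' (φ ∘ j) := by
  have hd : ∀ x ∈ U', fderiv ℝ (φ ∘ j) x = (fderiv ℝ φ (j x)).comp (fderiv ℝ j x) := fun x hx =>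
    fderiv_comp x (h.differentiableAt (hmaps hx))
      ((hj.contDiffAt (hU'.mem_nhds hx)).differentiableAt (by simp))
  refine ⟨hU', h.smooth.comp hj hmaps, fun x hx => ?_, fun x hx u v => ?_⟩
  · rw [hd x hx]
    exact (h.immersive _ (hmaps hx)).comp (hinj x hx)
  · rw [hd x hx]
    exact h.isotropic _ (hmaps hx) _ _

theorem IsIsotropicPatch.comp_equiv {U : Set E} {φ : E → V} (h : IsIsotropicPatch σ U φ)
    (e : E' ≃L[ℝ] E) : IsIsotropicPatch σ (e ⁻¹' U) (φ ∘ e) :=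
  h.comp (h.isOpen.preimage e.continuous) e.contDiff.contDiffOn (Set.mapsTo_preimage _ _)
    fun x _ => by rw [e.fderiv]; exact e.injective

theorem IsIsotropicPatch.postcomp {U : Set E} {φ : E → V} (h : IsIsotropicPatch σ U φ)
    (A : V →L[ℝ] V) (hA : Function.Injective A) (hσ : ∀ u v, σ (A u) (A v) = σ u v) :
    IsIsotropicPatch σ U (A ∘ φ) := by
  have hd : ∀ x ∈ U, fderiv ℝ (A ∘ φ) x = A.comp (fderiv ℝ φ x) := fun x hx => by
    rw [fderiv_comp x A.differentiableAt (h.differentiableAt hx), A.fderiv]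
  refine ⟨h.isOpen, A.contDiff.comp_contDiffOn h.smooth, fun x hx => ?_, fun x hx u v => ?_⟩
  · rw [hd x hx]
    exact hA.comp (h.immersive x hx)
  · rw [hd x hx]
    exact (hσ _ _).trans (h.isotropic x hx u v)

/-- The inverse function theorem on an open set, with a smooth inverse. -/
theorem exists_openPartialHomeomorph [CompleteSpace E] {f : E → E'} {U : Set E} (hU : IsOpen U)
    (hf : ContDiffOn ℝ ∞ f U) {x₀ : E} (hx₀ : x₀ ∈ U) (f' : E ≃L[ℝ] E')
    (hf' : HasFDerivAt f (f' : E →L[ℝ] E') x₀) :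
    ∃ e : OpenPartialHomeomorph E E', x₀ ∈ e.source ∧ e.source ⊆ U ∧ ⇑e = f ∧
      ContDiffOn ℝ ∞ e.symm e.target ∧ ∀ x ∈ e.source, Function.Injective (fderiv ℝ f x) := by
  have hne : (∞ : WithTop ℕ∞) ≠ 0 := by simp
  have hca : ContDiffAt ℝ ∞ f x₀ := hf.contDiffAt (hU.mem_nhds hx₀)
  let e₀ := hca.toOpenPartialHomeomorph f hf' hne
  -- Restricting to the open set where the derivative is invertible makes the inverse smooth on the
  -- whole target, not only at the image of x₀.
  let S : Set E := U ∩ fderiv ℝ f ⁻¹' Set.range ((↑) : (E ≃L[ℝ] E') → E →L[ℝ] E')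
  have hS : IsOpen S :=
    (hf.continuousOn_fderiv_of_isOpen hU (by simp)).isOpen_inter_preimage hU
      ContinuousLinearEquiv.isOpen
  have hx₀S : x₀ ∈ S := ⟨hx₀, f', hf'.fderiv.symm⟩
  have hsrc : (e₀.restr S).source = e₀.source ∩ S := e₀.restr_source' S hS
  refine ⟨e₀.restr S, ?_, ?_, rfl, ?_, ?_⟩
  · rw [hsrc]
    exact ⟨hca.mem_toOpenPartialHomeomorph_source hf' hne, hx₀S⟩
  · rw [hsrc]
    exact fun x hx => hx.2.1
  · intro y hy
    have hys := (e₀.restr S).map_target hy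
    rw [hsrc] at hys
    obtain ⟨-, hyU, g, hg⟩ := hys
    refine ContDiffAt.contDiffWithinAt ?_
    refine (e₀.restr S).contDiffAt_symm (f₀' := g) hy ?_ (hf.contDiffAt (hU.mem_nhds hyU))
    rw [hg]
    exact ((hf.contDiffAt (hU.mem_nhds hyU)).differentiableAt (by simp)).hasFDerivAt
  · intro x hx
    rw [hsrc] at hx
    obtain ⟨-, -, g, hg⟩ := hx
    rw [← hg]
    exact g.injective

/-- An immersion has a smooth local left inverse. -/
theorem IsIsotropicPatch.exists_leftInverse [FiniteDimensional ℝ E] [FiniteDimensional ℝ V]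
    {U : Set E} {φ : E → V}
    (h : IsIsotropicPatch σ U φ) {x₀ : E} (hx₀ : x₀ ∈ U) :
    ∃ l : V → E, ContDiffAt ℝ ∞ l (φ x₀) ∧ ∀ᶠ x in 𝓝 x₀, l (φ x) = x := by
  have := FiniteDimensional.complete ℝ E
  -- Composing φ with a linear left inverse of its derivative gives a map with derivative the
  -- identity, to which the inverse function theorem applies.
  obtain ⟨p, hp⟩ := (fderiv ℝ φ x₀ : E →ₗ[ℝ] V).exists_leftInverse_of_injective
    (LinearMap.ker_eq_bot.2 (h.immersive x₀ hx₀))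
  let p' : V →L[ℝ] E := p.toContinuousLinearMap
  have hd : HasFDerivAt (p' ∘ φ) (ContinuousLinearEquiv.refl ℝ E : E →L[ℝ] E) x₀ := by
    have h1 := p'.hasFDerivAt.comp x₀ (h.differentiableAt hx₀).hasFDerivAt
    convert h1 using 1
    ext u
    exact (LinearMap.congr_fun hp u).symm
  obtain ⟨e, he0, -, hef, hsymm, -⟩ := exists_openPartialHomeomorph h.isOpen
    (p'.contDiff.comp_contDiffOn h.smooth) hx₀ _ hd
  have he : ∀ x, e x = p' (φ x) := fun x => congrFun hef x
  refine ⟨e.symm ∘ p', ?_, ?_⟩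
  · refine ContDiffAt.comp _ ?_ p'.contDiff.contDiffAt
    rw [← he]
    exact hsymm.contDiffAt (e.open_target.mem_nhds (e.map_source he0))
  · filter_upwards [e.open_source.mem_nhds he0] with x hx
    rw [Function.comp_apply, ← he, e.left_inv hx]

end Patches

/-! ### Patches and manifolds -/

section Manifolds

variable {V : Type} [NormedAddCommGroup V] [NormedSpace ℝ V] {σ : V → V → ℝ} {d : ℕ}

theorem IsIsotropicImmersion.isIsotropicPatch {M : Type} [TopologicalSpace M]
    [ChartedSpace (EuclideanSpace ℝ (Fin d)) M] [IsManifold (𝓡 d) ∞ M] {F : M → V}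
    (h : IsIsotropicImmersion σ d F) (p : M) :
    IsIsotropicPatch σ (chartAt (EuclideanSpace ℝ (Fin d)) p).target
      (F ∘ (chartAt (EuclideanSpace ℝ (Fin d)) p).symm) := by
  set e := chartAt (EuclideanSpace ℝ (Fin d)) p with he
  have : IsManifold (𝓡 d) 1 M := IsManifold.of_le (n := ∞) (by simp)
  have hmd : e.MDifferentiable (𝓡 d) (𝓡 d) := mdifferentiable_chart p
  have hd : ∀ x ∈ e.target, fderiv ℝ (F ∘ e.symm) x =
      (mfderiv (𝓡 d) 𝓘(ℝ, V) F (e.symm x)).comp (mfderiv (𝓡 d) (𝓡 d) e.symm x) := fun x hx => by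
    rw [← mfderiv_eq_fderiv]
    exact mfderiv_comp x (h.smooth.mdifferentiable (by simp) _) (hmd.symm.mdifferentiableAt hx)
  refine ⟨e.open_target, ?_, fun x hx => ?_, fun x hx u v => ?_⟩
  · rw [← contMDiffOn_iff_contDiffOn]
    exact h.smooth.comp_contMDiffOn (contMDiffOn_chart_symm (I := 𝓡 d))
  · rw [hd x hx]
    exact (h.immersive _).comp (hmd.symm.mfderiv_injective hx)
  · rw [hd x hx]
    exact h.isotropic _ _ _

theorem isIsotropicImmersion_of_patch {M : Type} [TopologicalSpace M]
    [ChartedSpace (EuclideanSpace ℝ (Fin d)) M] [IsManifold (𝓡 d) ∞ M] {F : M → V}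
    (h : ∀ p : M, IsIsotropicPatch σ (chartAt (EuclideanSpace ℝ (Fin d)) p).target
      (F ∘ (chartAt (EuclideanSpace ℝ (Fin d)) p).symm)) : IsIsotropicImmersion σ d F := by
  have hsmooth : ContMDiff (𝓡 d) 𝓘(ℝ, V) ∞ F := by
    intro p
    set e := chartAt (EuclideanSpace ℝ (Fin d)) p with he
    have h1 : ContMDiffAt (𝓡 d) 𝓘(ℝ, V) ∞ ((F ∘ e.symm) ∘ e) p := by
      refine ContMDiffAt.comp p (ContDiffAt.contMDiffAt ?_)
        ((contMDiffOn_chart (I := 𝓡 d)).contMDiffAt (e.open_source.mem_nhds (mem_chart_source _ p)))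
      exact (h p).smooth.contDiffAt (e.open_target.mem_nhds (mem_chart_target _ p))
    refine h1.congr_of_eventuallyEq ?_
    filter_upwards [e.open_source.mem_nhds (mem_chart_source _ p)] with q hq
    simp [e.left_inv hq]
  have hd : ∀ p : M, mfderiv (𝓡 d) 𝓘(ℝ, V) F p =
      fderiv ℝ (F ∘ (chartAt (EuclideanSpace ℝ (Fin d)) p).symm)
        (chartAt (EuclideanSpace ℝ (Fin d)) p p) := fun p => by
    refine (hsmooth.mdifferentiable (by simp) p).mfderiv.trans ?_
    have h1 : Set.range (𝓡 d) = Set.univ := by simp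
    rw [h1, fderivWithin_univ]
    rfl
  refine ⟨hsmooth, fun p => ?_, fun p u v => ?_⟩
  · rw [hd]
    exact (h p).immersive _ (mem_chart_target _ p)
  · rw [hd]
    exact (h p).isotropic _ (mem_chart_target _ p) _ _

/-- Second countability leaves countably many charts. Together with `isImmersedIsotropic_iUnion`,
this reduces immersed submanifolds of positive dimension to countable unions of parametrised
patches. -/
theorem IsImmersedIsotropic.exists_patches {L : Set V} (h : IsImmersedIsotropic σ d L) :
    ∃ (ι : Type) (_ : Countable ι) (U : ι → Set (EuclideanSpace ℝ (Fin d)))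
      (φ : ι → EuclideanSpace ℝ (Fin d) → V),
      (∀ i, IsIsotropicPatch σ (U i) (φ i)) ∧ L = ⋃ i, φ i '' U i := by
  obtain ⟨M, _, _, _, _, _, F, hF, rfl⟩ := h
  obtain ⟨s, hs, hcov⟩ := TopologicalSpace.countable_cover_nhds
    fun p : M => (chartAt (EuclideanSpace ℝ (Fin d)) p).open_source.mem_nhds (mem_chart_source _ p)
  refine ⟨s, hs.to_subtype, fun p => (chartAt (EuclideanSpace ℝ (Fin d)) (p : M)).target,
    fun p => F ∘ (chartAt (EuclideanSpace ℝ (Fin d)) (p : M)).symm,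
    fun p => hF.isIsotropicPatch p, ?_⟩
  ext w
  simp only [Set.mem_range, Set.mem_iUnion, Set.mem_image]
  constructor
  · rintro ⟨q, rfl⟩
    have hq : q ∈ ⋃ x ∈ s, (chartAt (EuclideanSpace ℝ (Fin d)) x).source := hcov ▸ Set.mem_univ q
    obtain ⟨p, hp, hqp⟩ := Set.mem_iUnion₂.1 hq
    exact ⟨⟨p, hp⟩, _, (chartAt _ p).map_source hqp, by simp [(chartAt _ p).left_inv hqp]⟩
  · rintro ⟨p, x, -, rfl⟩
    exact ⟨_, rfl⟩

theorem isImmersedIsotropic_of_patch {U : Set (EuclideanSpace ℝ (Fin d))}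
    {φ : EuclideanSpace ℝ (Fin d) → V} (h : IsIsotropicPatch σ U φ) :
    IsImmersedIsotropic σ d (φ '' U) := by
  let O : TopologicalSpace.Opens (EuclideanSpace ℝ (Fin d)) := ⟨U, h.isOpen⟩
  refine ⟨O, inferInstance, inferInstance, inferInstance, inferInstance, inferInstance,
    fun p => φ p, ?_, ?_⟩
  · refine isIsotropicImmersion_of_patch fun p => ?_
    set e := chartAt (EuclideanSpace ℝ (Fin d)) p with he
    have hval : ∀ y ∈ e.target, ((e.symm y : O) : EuclideanSpace ℝ (Fin d)) = y := fun y hy =>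
      e.right_inv hy
    refine (h.mono e.open_target fun y hy => ?_).congr fun y hy => ?_
    · rw [← hval y hy]
      exact (e.symm y).2
    · exact congrArg φ (hval y hy)
  · ext w
    constructor
    · rintro ⟨p, rfl⟩
      exact ⟨p, p.2, rfl⟩
    · rintro ⟨x, hx, rfl⟩
      exact ⟨⟨x, hx⟩, rfl⟩

end Manifolds

/-! ### Unions of patches and local embedded patches -/

section PatchUnion

variable {E E' V : Type} [NormedAddCommGroup E] [NormedSpace ℝ E]
  [NormedAddCommGroup E'] [NormedSpace ℝ E'] [NormedAddCommGroup V] [NormedSpace ℝ V]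
  {σ : V → V → ℝ}

theorem injective_fderiv_of_leftInverse {f : E → E'} {g : E' → E} {x : E}
    (hf : DifferentiableAt ℝ f x) (hg : DifferentiableAt ℝ g (f x))
    (hgf : ∀ᶠ y in 𝓝 x, g (f y) = y) : Function.Injective (fderiv ℝ f x) := by
  have h1 : fderiv ℝ (g ∘ f) x = (fderiv ℝ g (f x)).comp (fderiv ℝ f x) := fderiv_comp x hg hf
  have h2 : (g ∘ f) =ᶠ[𝓝 x] id := hgf
  rw [h2.fderiv_eq, fderiv_id] at h1
  exact Function.LeftInverse.injective (g := fderiv ℝ g (f x)) fun u =>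
    (DFunLike.congr_fun h1 u).symm

theorem isIsotropicPatch_iUnion {ι : Type} {U : ι → Set E} {φ : E → V}
    (h : ∀ i, IsIsotropicPatch σ (U i) φ) : IsIsotropicPatch σ (⋃ i, U i) φ where
  isOpen := isOpen_iUnion fun i => (h i).isOpen
  smooth x hx := by
    obtain ⟨i, hi⟩ := Set.mem_iUnion.1 hx
    exact ((h i).smooth.contDiffAt ((h i).isOpen.mem_nhds hi)).contDiffWithinAt
  immersive x hx := by
    obtain ⟨i, hi⟩ := Set.mem_iUnion.1 hx
    exact (h i).immersive x hi
  isotropic x hx := by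
    obtain ⟨i, hi⟩ := Set.mem_iUnion.1 hx
    exact (h i).isotropic x hi

/-- A set is locally, near its point `w`, the image of an embedded patch; the embedding is
witnessed by a continuous left inverse `ψ`. -/
def HasEmbeddedPatch (E : Type) [NormedAddCommGroup E] [NormedSpace ℝ E] (σ : V → V → ℝ)
    (L : Set V) (w : V) : Prop :=
  ∃ (W : Set V) (U : Set E) (φ : E → V) (ψ : V → E), IsOpen W ∧ w ∈ W ∧
    IsIsotropicPatch σ U φ ∧ φ '' U = L ∩ W ∧ ContinuousOn ψ (L ∩ W) ∧ ∀ x ∈ U, ψ (φ x) = x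

theorem HasEmbeddedPatch.of_equiv {L : Set V} {w : V} (h : HasEmbeddedPatch E σ L w)
    (e : E' ≃L[ℝ] E) : HasEmbeddedPatch E' σ L w := by
  obtain ⟨W, U, φ, ψ, hW, hw, hφ, him, hψ, hinv⟩ := h
  refine ⟨W, e ⁻¹' U, φ ∘ e, e.symm ∘ ψ, hW, hw, hφ.comp_equiv e, ?_,
    e.symm.continuous.comp_continuousOn hψ, fun x hx => ?_⟩
  · rw [Set.image_comp, Set.image_preimage_eq _ e.surjective, him]
  · simp [hinv _ hx]

end PatchUnion

/-! ### Assembling patches into immersed and embedded submanifolds -/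

section Manifolds

variable {V : Type} [NormedAddCommGroup V] [NormedSpace ℝ V] {σ : V → V → ℝ} {d : ℕ}

/-- Self-intersections are allowed, so no compatibility is needed: a disjoint union of the domains
suffices. It is realised inside ℝᵈ by shrinking the i-th domain into the ball of radius 1/2 about
the integer point k(i) on the first axis, which is where d > 0 enters. -/
theorem isImmersedIsotropic_iUnion (hd : 0 < d) {ι : Type} [Countable ι]
    {U : ι → Set (EuclideanSpace ℝ (Fin d))} {φ : ι → EuclideanSpace ℝ (Fin d) → V}
    (h : ∀ i, IsIsotropicPatch σ (U i) (φ i)) : IsImmersedIsotropic σ d (⋃ i, φ i '' U i) := by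
  classical
  obtain ⟨k, hk⟩ := exists_injective_nat ι
  let c : ι → EuclideanSpace ℝ (Fin d) := fun i => EuclideanSpace.single ⟨0, hd⟩ (k i : ℝ)
  have hr : (0 : ℝ) < 1 / 2 := by norm_num
  let b : ι → OpenPartialHomeomorph (EuclideanSpace ℝ (Fin d)) (EuclideanSpace ℝ (Fin d)) :=
    fun i => OpenPartialHomeomorph.univBall (c i) (1 / 2)
  have hbs : ∀ i, (b i).source = Set.univ := fun i => OpenPartialHomeomorph.univBall_source _ _
  have hbt : ∀ i, (b i).target = Metric.ball (c i) (1 / 2) := fun i =>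
    OpenPartialHomeomorph.univBall_target _ hr
  have hbl : ∀ i x, (b i).symm (b i x) = x := fun i x => (b i).left_inv (hbs i ▸ Set.mem_univ x)
  let U' : ι → Set (EuclideanSpace ℝ (Fin d)) := fun i => b i '' U i
  have hU'ball : ∀ i, U' i ⊆ Metric.ball (c i) (1 / 2) := by
    rintro i _ ⟨x, -, rfl⟩
    rw [← hbt]
    exact (b i).map_source (hbs i ▸ Set.mem_univ x)
  have hdisj : ∀ i j y, y ∈ U' i → y ∈ U' j → i = j := by
    intro i j y hi hj
    have h1 := hU'ball i hi
    have h2 := hU'ball j hj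
    rw [Metric.mem_ball] at h1 h2
    have h3 : dist (c i) (c j) < 1 :=
      (dist_triangle_left _ _ y).trans_lt (by linarith)
    rw [PiLp.dist_single_same, Nat.dist_cast_real, Nat.dist_eq] at h3
    have h4 : |(k i : ℤ) - k j| < 1 := by exact_mod_cast h3
    rw [Int.abs_lt_one_iff] at h4
    exact hk (by omega)
  have hU'open : ∀ i, IsOpen (U' i) := fun i =>
    (b i).isOpen_image_of_subset_source (h i).isOpen (by rw [hbs]; exact Set.subset_univ _)
  have hpatch : ∀ i, IsIsotropicPatch σ (U' i) (φ i ∘ (b i).symm) := fun i => by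
    have hs : ContDiffOn ℝ ∞ (b i).symm (Metric.ball (c i) (1 / 2)) :=
      OpenPartialHomeomorph.contDiffOn_univBall_symm
    refine (h i).comp (hU'open i) (hs.mono (hU'ball i)) ?_ fun y hy => ?_
    · rintro _ ⟨x, hx, rfl⟩
      rw [hbl]
      exact hx
    · have hball := Metric.isOpen_ball.mem_nhds (hU'ball i hy)
      refine injective_fderiv_of_leftInverse (g := b i)
        ((hs.contDiffAt hball).differentiableAt (by simp))
        (OpenPartialHomeomorph.contDiff_univBall (n := 1).differentiable (by simp)).differentiableAt ?_
      filter_upwards [hball] with u hu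
      exact (b i).right_inv (by rw [hbt]; exact hu)
  -- The value 0 off the union of the balls' subdomains is irrelevant: only the restriction to the
  -- open set ⋃ U' i matters.
  let Φ : EuclideanSpace ℝ (Fin d) → V := fun y =>
    if hy : ∃ i, y ∈ U' i then (φ hy.choose ∘ (b hy.choose).symm) y else 0
  have hΦ : ∀ i, Set.EqOn Φ (φ i ∘ (b i).symm) (U' i) := fun i y hy => by
    have hex : ∃ i, y ∈ U' i := ⟨i, hy⟩
    have : hex.choose = i := hdisj _ _ y hex.choose_spec hy
    simp only [Φ, dif_pos hex, this]
  have hfin := isImmersedIsotropic_of_patch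
    (isIsotropicPatch_iUnion fun i => (hpatch i).congr (hΦ i))
  convert hfin using 1
  rw [Set.image_iUnion]
  refine Set.iUnion_congr fun i => ?_
  rw [(hΦ i).image_eq, Set.image_comp, ← Set.image_comp (b i).symm (b i)]
  congr 1
  exact (Set.image_congr fun x _ => hbl i x).trans (Set.image_id _) |>.symm

theorem IsEmbeddedIsotropic.hasEmbeddedPatch {L : Set V} (h : IsEmbeddedIsotropic σ d L) {w : V}
    (hw : w ∈ L) : HasEmbeddedPatch (EuclideanSpace ℝ (Fin d)) σ L w := by
  obtain ⟨M, _, _, _, _, _, F, hF, hemb, rfl⟩ := h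
  obtain ⟨p, rfl⟩ := hw
  set e := chartAt (EuclideanSpace ℝ (Fin d)) p with he
  obtain ⟨W, hW, hWe⟩ := hemb.isInducing.isOpen_iff.1 e.open_source
  have : Nonempty M := ⟨p⟩
  have hinvF : ∀ q, Function.invFun F (F q) = q := Function.leftInverse_invFun hemb.injective
  refine ⟨W, e.target, F ∘ e.symm, e ∘ Function.invFun F, hW, ?_, hF.isIsotropicPatch p, ?_, ?_, ?_⟩
  · have : p ∈ F ⁻¹' W := hWe ▸ mem_chart_source _ p
    exact this
  · rw [Set.image_comp, e.symm_image_target_eq_source, ← hWe, Set.image_preimage_eq_range_inter]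
  · rw [← Set.image_preimage_eq_range_inter, hWe]
    rintro _ ⟨q, hq, rfl⟩
    have hc : ContinuousOn (Function.invFun F) (Set.range F) := by
      rw [continuousOn_iff_continuous_domRestrict]
      have h2 : (Set.range F).domRestrict (Function.invFun F) = hemb.toHomeomorph.symm := by
        funext y
        obtain ⟨_, q, rfl⟩ := y
        exact (hinvF q).trans (hemb.toHomeomorph.symm_apply_apply q).symm
      rw [h2]
      exact hemb.toHomeomorph.symm.continuous
    refine ContinuousAt.comp_continuousWithinAt ?_
      ((hc _ ⟨q, rfl⟩).mono (Set.image_subset_range _ _))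
    rw [hinvF]
    exact e.continuousAt hq
  · intro x hx
    simp [hinvF, e.right_inv hx]

/-- L carries the subspace topology, with the continuous left inverses ψ as charts. The transition
maps are smooth although ψ is only continuous, because each immersion φ has a smooth local left
inverse on the ambient space. -/
theorem isEmbeddedIsotropic_of_hasEmbeddedPatch [FiniteDimensional ℝ V] {L : Set V}
    (h : ∀ w ∈ L, HasEmbeddedPatch (EuclideanSpace ℝ (Fin d)) σ L w) :
    IsEmbeddedIsotropic σ d L := by
  classical
  choose W U φ ψ hW hwW hφ him hψ hinv using fun w : L => h w w.2
  have hmem : ∀ (w : L), ∀ x ∈ U w, φ w x ∈ L ∩ W w := fun w x hx =>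
    him w ▸ Set.mem_image_of_mem _ hx
  have hpre : ∀ (w : L) (p : V), p ∈ L → p ∈ W w → ψ w p ∈ U w ∧ φ w (ψ w p) = p := by
    intro w p hp hpW
    have : p ∈ φ w '' U w := him w ▸ ⟨hp, hpW⟩
    obtain ⟨x, hx, rfl⟩ := this
    rw [hinv w x hx]
    exact ⟨hx, rfl⟩
  let e : L → OpenPartialHomeomorph L (EuclideanSpace ℝ (Fin d)) := fun w =>
    { toFun := fun p => ψ w p
      invFun := fun x => if hx : x ∈ U w then ⟨φ w x, (hmem w x hx).1⟩ else w
      source := Subtype.val ⁻¹' W w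
      target := U w
      map_source' := fun p hp => (hpre w p p.2 hp).1
      map_target' := fun x hx => by
        simp only [dif_pos hx]
        exact (hmem w x hx).2
      left_inv' := fun p hp => by
        have h1 := hpre w p p.2 hp
        simp only [dif_pos h1.1]
        exact Subtype.ext h1.2
      right_inv' := fun x hx => by
        simp only [dif_pos hx]
        exact hinv w x hx
      open_source := (hW w).preimage continuous_subtype_val
      open_target := (hφ w).isOpen
      continuousOn_toFun := (hψ w).comp continuous_subtype_val.continuousOn fun p hp => ⟨p.2, hp⟩
      continuousOn_invFun := by
        rw [Topology.IsInducing.subtypeVal.continuousOn_iff]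
        refine (hφ w).smooth.continuousOn.congr fun x hx => ?_
        simp only [Function.comp_apply, dif_pos hx] }
  have hsymm : ∀ w, ∀ x ∈ U w, ((e w).symm x : V) = φ w x := fun w x hx => by
    change ((if hx : x ∈ U w then (⟨φ w x, (hmem w x hx).1⟩ : L) else w : L) : V) = _
    rw [dif_pos hx]
  let cs : ChartedSpace (EuclideanSpace ℝ (Fin d)) L :=
    { atlas := Set.range e
      chartAt := e
      mem_chart_source := hwW
      chart_mem_atlas := fun w => ⟨w, rfl⟩ }
  have hman : IsManifold (𝓡 d) ∞ L := by
    refine isManifold_of_contDiffOn (𝓡 d) ∞ L ?_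
    rintro _ _ ⟨w₁, rfl⟩ ⟨w₂, rfl⟩
    have hsub : ∀ x ∈ ((e w₁).symm ≫ₕ e w₂).source, x ∈ U w₁ ∧ φ w₁ x ∈ W w₂ := by
      intro x hx
      rw [OpenPartialHomeomorph.trans_source] at hx
      have hxU : x ∈ U w₁ := hx.1
      refine ⟨hxU, ?_⟩
      rw [← hsymm w₁ x hxU]
      exact hx.2
    have key : ContDiffOn ℝ ∞ ((e w₁).symm ≫ₕ e w₂) ((e w₁).symm ≫ₕ e w₂).source := by
      intro x hx
      obtain ⟨hxU, hxW⟩ := hsub x hx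
      have hfun : ∀ y ∈ ((e w₁).symm ≫ₕ e w₂).source,
          ((e w₁).symm ≫ₕ e w₂) y = ψ w₂ (φ w₁ y) := fun y hy => by
        change ψ w₂ ((e w₁).symm y : V) = _
        rw [hsymm w₁ y (hsub y hy).1]
      have hback : ∀ y ∈ ((e w₁).symm ≫ₕ e w₂).source,
          φ w₂ (((e w₁).symm ≫ₕ e w₂) y) = φ w₁ y := fun y hy => by
        rw [hfun y hy]
        exact (hpre w₂ _ (hmem w₁ y (hsub y hy).1).1 (hsub y hy).2).2
      have hxt : ((e w₁).symm ≫ₕ e w₂) x ∈ U w₂ := by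
        rw [hfun x hx]
        exact (hpre w₂ _ (hmem w₁ x hxU).1 hxW).1
      obtain ⟨l, hl, hlinv⟩ := (hφ w₂).exists_leftInverse hxt
      rw [hback x hx] at hl
      have hopen := ((e w₁).symm ≫ₕ e w₂).open_source.mem_nhds hx
      have hcont := ((e w₁).symm ≫ₕ e w₂).continuousAt hx
      -- Continuity of the transition map keeps its values where l inverts φ w₂, so it coincides
      -- locally with the smooth map l ∘ φ w₁.
      have heq : ((e w₁).symm ≫ₕ e w₂) =ᶠ[𝓝 x] l ∘ φ w₁ := by
        filter_upwards [hopen, hcont.eventually hlinv] with y hy hy2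
        rw [Function.comp_apply, ← hback y hy, hy2]
      exact ((hl.comp x ((hφ w₁).smooth.contDiffAt
        ((hφ w₁).isOpen.mem_nhds hxU))).congr_of_eventuallyEq heq).contDiffWithinAt
    simpa using key
  refine ⟨L, inferInstance, cs, inferInstance, ?_, hman, Subtype.val, ?_,
    Topology.IsEmbedding.subtypeVal, Subtype.range_coe⟩
  · have : SecondCountableTopology V := by
      have := FiniteDimensional.proper_real V
      infer_instance
    infer_instance
  · exact isIsotropicImmersion_of_patch fun p => (hφ p).congr fun x hx => hsymm p x hx

end Manifolds

/-! ### A slice for the action near a point of the zero level set -/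

open scoped Matrix.Norms.L2Operator in
/-- The action of matrices on vectors as a continuous bilinear map. -/
noncomputable def actBilin (n : ℕ) : Mat n →L[ℝ] Cn n →L[ℝ] Cn n :=
  LinearMap.mkContinuous₂
    (LinearMap.mk₂ ℝ (fun (X : Mat n) (v : Cn n) => act X v) act_add act_real_smul
      (fun X u v => map_add (act X) u v) fun c X v => ((act X).restrictScalars ℝ).map_smul c v)
    1 fun X v => by
      rw [one_mul, mul_comm]
      exact norm_act_le X v

open scoped Matrix.Norms.L2Operator in
theorem actBilin_apply {n : ℕ} (X : Mat n) (v : Cn n) : actBilin n X v = act X v := rfl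

/-- The orthogonal projection of `ℂⁿ` onto the tangent space of the orbit through `z`. -/
noncomputable abbrev orbitProj {n : ℕ} (G : Subgroup (SU n)) (z : Cn n) : Cn n →L[ℝ] Cn n :=
  (orbitTangent G z).starProjection

theorem orbitProj_mem {n : ℕ} (G : Subgroup (SU n)) (z v : Cn n) :
    orbitProj G z v ∈ orbitTangent G z :=
  Submodule.starProjection_apply_mem _ v

theorem orbitProj_of_mem {n : ℕ} {G : Subgroup (SU n)} {z a : Cn n} (ha : a ∈ orbitTangent G z) :
    orbitProj G z a = a :=
  Submodule.starProjection_eq_self_iff.2 ha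

theorem orbitProj_eq_zero_iff {n : ℕ} {G : Subgroup (SU n)} {z v : Cn n} :
    orbitProj G z v = 0 ↔ ∀ X ∈ lieAlg G, (inner ℂ v (act X z)).re = 0 := by
  rw [orbitProj, Submodule.starProjection_apply_eq_zero_iff, Submodule.mem_orthogonal']
  constructor
  · intro h X hX
    rw [← real_inner_eq]
    exact h _ (act_mem_orbitTangent z hX)
  · intro h a ha
    obtain ⟨X, hX, rfl⟩ := mem_orbitTangent.1 ha
    rw [real_inner_eq, h X hX]

theorem orbitProj_of_mem_line {n : ℕ} {G : Subgroup (SU n)} {z v : Cn n}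
    (hz : momentMap G z = 0) (hv : v ∈ line z) : orbitProj G z v = 0 := by
  rw [orbitProj_eq_zero_iff]
  intro X hX
  obtain ⟨c, rfl⟩ := mem_line.1 hv
  rw [inner_smul_left, momentMap_eq_zero_iff.1 hz X hX, mul_zero, Complex.zero_re]

open scoped Matrix.Norms.L2Operator in
/-- A slice at `z`: a smooth family `ξ` of elements of `G` that sweeps out the orbit of `z`, and the
local coordinates of `ℂⁿ` near `z` in which `v` stands for `ξ v (v - π v)`, where `π` is the
projection onto the tangent space of the orbit. -/
structure Slice {n : ℕ} (G : Subgroup (SU n)) (z : Cn n) where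
  ξ : Cn n → Mat n
  contDiff_ξ : ContDiff ℝ ∞ ξ
  ξ_mem : ∀ v, ∃ g : G, ((g : SU n) : Mat n) = ξ v
  B : Set (Cn n)
  isOpen_B : IsOpen B
  immersive : ∀ a ∈ B, ∀ a' ∈ orbitTangent G z, act (fderiv ℝ ξ a a') z = 0 → a' = 0
  ξ_congr : ∀ v w, orbitProj G z v = orbitProj G z w → ξ v = ξ w
  mem_B_congr : ∀ v w, orbitProj G z v = orbitProj G z w → v ∈ B → w ∈ B
  e : OpenPartialHomeomorph (Cn n) (Cn n)
  mem_source : z ∈ e.source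
  e_self : e z = z
  e_apply : ∀ v, e v = act (ξ v) (v - orbitProj G z v)
  source_subset : e.source ⊆ B
  sub_proj_mem : ∀ v ∈ e.source, momentMap G (e v) = 0 → v - orbitProj G z v ∈ line z

open scoped Matrix.Norms.L2Operator in
theorem contDiff_matrix_exp (n : ℕ) : ContDiff ℝ ∞ (NormedSpace.exp : Mat n → Mat n) :=
  contDiff_iff_contDiffAt.2 fun X => (NormedSpace.exp_analytic (𝕂 := ℝ) X).contDiffAt

open scoped Matrix.Norms.L2Operator in
-- With a linear section τ of X ↦ Xz composed with the projection π onto 𝔤z, take ξ = exp ∘ τ. The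
-- map v ↦ ξ(v)(v − πv) has identity derivative at z, since τ(v)z restores the component πv that was
-- removed. The source is then shrunk so that v − πv falls within the radius of
-- `exists_slice_radius`.
theorem exists_slice {n : ℕ} {G : Subgroup (SU n)} (hG : IsCompact (G : Set (SU n)))
    {z : Cn n} (hz : momentMap G z = 0) (hz0 : z ≠ 0)
    (hdim : Module.finrank ℝ (orbitTangent G z) + 1 = n) : Nonempty (Slice G z) := by
  set A := orbitTangent G z with hA
  set π := orbitProj G z with hπ
  obtain ⟨s, hs⟩ := ((evalAt z).submoduleMap (lieAlg G)).exists_rightInverse_of_surjective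
    (LinearMap.range_eq_top.2 ((evalAt z).submoduleMap_surjective (lieAlg G)))
  let sA : A →ₗ[ℝ] Mat n := (lieAlg G).subtype.comp s
  let τ : Cn n →L[ℝ] Mat n := sA.toContinuousLinearMap.comp A.orthogonalProjectionOnto
  have hτmem : ∀ v, τ v ∈ lieAlg G := fun v => (s (A.orthogonalProjectionOnto v)).2
  have hτz : ∀ v, act (τ v) z = π v := fun v =>
    congrArg Subtype.val (LinearMap.congr_fun hs (A.orthogonalProjectionOnto v))
  have hτcongr : ∀ v w, π v = π w → τ v = τ w := fun v w h => by
    have h1 : A.orthogonalProjectionOnto v = A.orthogonalProjectionOnto w := Subtype.ext h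
    change sA.toContinuousLinearMap (A.orthogonalProjectionOnto v) = _
    rw [h1]; rfl
  have hππ : ∀ v, π (π v) = π v := fun v => orbitProj_of_mem (orbitProj_mem G z v)
  have hπz : π z = 0 := orbitProj_of_mem_line hz (mem_line.2 ⟨1, (one_smul _ _).symm⟩)
  have hτz0 : τ z = 0 := by
    rw [hτcongr z 0 (by rw [hπz, map_zero]), map_zero]
  let ξ : Cn n → Mat n := fun v => NormedSpace.exp (τ v)
  have hξ : ContDiff ℝ ∞ ξ := (contDiff_matrix_exp n).comp τ.contDiff
  have hξcongr : ∀ v w, π v = π w → ξ v = ξ w := fun v w h => by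
    simp only [ξ, hτcongr v w h]
  have hξd : ∀ v, HasFDerivAt ξ (fderiv ℝ ξ v) v := fun v =>
    (hξ.differentiable (by simp) v).hasFDerivAt
  have hξz : HasFDerivAt ξ τ z := by
    have h1 : HasFDerivAt (NormedSpace.exp : Mat n → Mat n) (1 : Mat n →L[ℝ] Mat n) (τ z) := by
      rw [hτz0]
      exact hasStrictFDerivAt_exp_zero.hasFDerivAt
    exact h1.comp z τ.hasFDerivAt
  let q : Cn n →L[ℝ] Cn n := ContinuousLinearMap.id ℝ (Cn n) - π
  let θ : Cn n → Cn n := fun v => actBilin n (ξ v) (q v)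
  have hθsmooth : ContDiff ℝ ∞ θ :=
    ((actBilin n).contDiff.comp hξ).clm_apply q.contDiff
  have hθd : ∀ v (ξ' : Cn n →L[ℝ] Mat n), HasFDerivAt ξ ξ' v → ∀ u,
      fderiv ℝ θ v u = act (ξ' u) (q v) + act (ξ v) (q u) := fun v ξ' h u => by
    have h1 := ((actBilin n).hasFDerivAt.comp v h).clm_apply q.hasFDerivAt
    have h2 : fderiv ℝ θ v = _ := h1.fderiv
    rw [h2]
    change actBilin n (ξ v) (q u) + actBilin n (ξ' u) (q v) = _
    rw [add_comm, actBilin_apply, actBilin_apply]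
  have hq : ∀ v, q v = v - π v := fun v => rfl
  have hθz : θ z = z := by
    change act (NormedSpace.exp (τ z)) (q z) = z
    rw [hτz0, NormedSpace.exp_zero, act_one, hq, hπz, sub_zero]
  have hid : HasFDerivAt θ (ContinuousLinearEquiv.refl ℝ (Cn n) : Cn n →L[ℝ] Cn n) z := by
    have h1 := (hθsmooth.differentiable (by simp) z).hasFDerivAt
    have h2 : fderiv ℝ θ z =
        ((ContinuousLinearEquiv.refl ℝ (Cn n) : Cn n ≃L[ℝ] Cn n) : Cn n →L[ℝ] Cn n) := by
      apply ContinuousLinearMap.ext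
      intro u
      rw [hθd z τ hξz u, hq z, hπz, sub_zero, hτz]
      change π u + act (NormedSpace.exp (τ z)) (q u) = u
      rw [hτz0, NormedSpace.exp_zero, act_one, hq, add_sub_cancel]
    rw [← h2]
    exact h1
  obtain ⟨e₀, hz₀, -, he₀, -, hinj⟩ := exists_openPartialHomeomorph isOpen_univ
    hθsmooth.contDiffOn (Set.mem_univ z) _ hid
  obtain ⟨ε, hε, hslice⟩ := exists_slice_radius hG hz hz0 hdim
  -- Membership depends only on πv, and πv + z is a point where θ has injective derivative.
  let B : Set (Cn n) := (fun v => π v + z) ⁻¹' e₀.source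
  have hBopen : IsOpen B := e₀.open_source.preimage (by fun_prop)
  let N : Set (Cn n) := B ∩ q ⁻¹' Metric.ball z ε
  have hNopen : IsOpen N := hBopen.inter (Metric.isOpen_ball.preimage q.continuous)
  have hsrc : (e₀.restr N).source = e₀.source ∩ N := e₀.restr_source' N hNopen
  have hξG : ∀ v, ∃ g : G, ((g : SU n) : Mat n) = ξ v := fun v => by
    obtain ⟨g, hg, hge⟩ := isGenerator_of_mem_lieAlg hG (hτmem v) 1
    rw [one_smul] at hge
    exact ⟨⟨g, hg⟩, hge⟩
  refine ⟨{ ξ := ξ, contDiff_ξ := hξ, ξ_mem := hξG, B := B, isOpen_B := hBopen, ξ_congr := hξcongr,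
            immersive := ?_, mem_B_congr := ?_, e := e₀.restr N, mem_source := ?_, e_self := ?_,
            e_apply := ?_, source_subset := ?_, sub_proj_mem := ?_ }⟩
  · intro a ha a' ha' h0
    -- At πa + z the normal part of the argument is z, and it does not change in the tangential
    -- direction a'. So the derivative of θ there is ξ'(a')z.
    refine (hinj _ ha).eq_iff.1 ?_ |>.trans rfl
    rw [map_zero, hθd _ _ (hξd _), hq a', orbitProj_of_mem ha', sub_self, map_zero, add_zero, hq,
      map_add, hππ, hπz, add_zero, add_sub_cancel_left]
    -- `ξ` only depends on the projection, so its derivatives at `a` and at `π a + z` agree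
    have h1 : fderiv ℝ ξ (π a + z) = fderiv ℝ ξ a := by
      have h2 : (fun v => ξ (v + (a - (π a + z)))) = ξ := funext fun v => hξcongr _ _ (by
        simp [hππ, hπz])
      have h3 := fderiv_comp_add_right (𝕜 := ℝ) (f := ξ) (x := π a + z) (a - (π a + z))
      rwa [h2, add_sub_cancel] at h3
    rw [h1, h0]
  · intro v w h hv
    change π w + z ∈ e₀.source
    rw [← h]
    exact hv
  · rw [hsrc]
    refine ⟨hz₀, ?_, ?_⟩
    · change π z + z ∈ e₀.source
      rw [hπz, zero_add]
      exact hz₀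
    · change q z ∈ Metric.ball z ε
      rw [hq, hπz, sub_zero]
      exact Metric.mem_ball_self hε
  · exact (congrFun he₀ z).trans hθz
  · intro v
    exact congrFun he₀ v
  · rw [hsrc]
    exact fun v hv => hv.2.1
  · intro v hv hev
    rw [hsrc] at hv
    have h1 : e₀ v = act (ξ v) (q v) := congrFun he₀ v
    obtain ⟨g, hg⟩ := hξG v
    have h2 : momentMap G (q v) = 0 := by
      have h3 : momentMap G (e₀ v) = 0 := hev
      rw [h1, ← hg, ← smul_eq_act'] at h3
      have := group_smul_mem_zeroLevel h3 g⁻¹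
      rwa [inv_smul_smul] at this
    refine hslice (q v) (mem_ball_iff_norm.1 hv.2.2) h2 (orbitProj_eq_zero_iff.1 ?_)
    change π (q v) = 0
    rw [hq, map_sub, hππ, sub_self]

/-! ### The symplectic forms -/

theorem symp_eq_im_inner {n : ℕ} (u v : Cn n) : symp u v = (inner ℂ u v).im := by
  rw [symp, PiLp.inner_apply, Complex.im_sum]
  refine Finset.sum_congr rfl fun i _ => ?_
  simp
  ring

theorem symp_smul_smul {n : ℕ} (g : SU n) (u v : Cn n) : symp (g • u) (g • v) = symp u v := by
  rw [symp_eq_im_inner, symp_eq_im_inner, inner_smul_smul]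

theorem sympExt_eq {n : ℕ} (u v : Cn n × ℂ) :
    sympExt u v = (inner ℂ u.1 v.1 + (starRingEnd ℂ) u.2 * v.2).im := by
  rw [sympExt, symp_eq_im_inner, Complex.add_im, Complex.mul_im, Complex.conj_re, Complex.conj_im]
  ring

theorem sympExt_smul_smul {n : ℕ} {G : Subgroup (SU n)} (g : G) (u v : Cn n × ℂ) :
    sympExt (g • u) (g • v) = sympExt u v := by
  rw [sympExt, sympExt]
  exact congrArg (· + _) (symp_smul_smul (g : SU n) u.1 v.1)

theorem sympExt_add_left {n : ℕ} (u u' v : Cn n × ℂ) :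
    sympExt (u + u') v = sympExt u v + sympExt u' v := by
  simp only [sympExt_eq, Prod.fst_add, Prod.snd_add, inner_add_left, map_add, Complex.add_im,
    add_mul]
  ring

theorem sympExt_add_right {n : ℕ} (u v v' : Cn n × ℂ) :
    sympExt u (v + v') = sympExt u v + sympExt u v' := by
  simp only [sympExt_eq, Prod.fst_add, Prod.snd_add, inner_add_right, Complex.add_im,
    mul_add]
  ring

theorem sympExt_smul_left {n : ℕ} (r : ℝ) (u v : Cn n × ℂ) :
    sympExt (r • u) v = r * sympExt u v := by
  have h1 : (r • u).1 = (r : ℂ) • u.1 := rfl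
  have h2 : (r • u).2 = (r : ℂ) * u.2 := rfl
  rw [sympExt_eq, sympExt_eq, h1, h2, inner_smul_left, map_mul, Complex.conj_ofReal, mul_assoc,
    ← mul_add, Complex.im_ofReal_mul]

theorem sympExt_comm {n : ℕ} (u v : Cn n × ℂ) : sympExt u v = -sympExt v u := by
  rw [sympExt_eq, sympExt_eq, ← inner_conj_symm u.1]
  simp only [Complex.add_im, Complex.conj_im, Complex.mul_im, Complex.conj_re]
  ring

theorem sympExt_self {n : ℕ} (u : Cn n × ℂ) : sympExt u u = 0 := by
  have := sympExt_comm u u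
  linarith

theorem sympExt_smul_right {n : ℕ} (r : ℝ) (u v : Cn n × ℂ) :
    sympExt u (r • v) = r * sympExt u v := by
  rw [sympExt_comm, sympExt_smul_left, sympExt_comm u v, mul_neg]

theorem sympExt_I_smul {n : ℕ} (u : Cn n × ℂ) :
    sympExt u (Complex.I • u) = ‖u.1‖ ^ 2 + ‖u.2‖ ^ 2 := by
  rw [sympExt_eq, Prod.smul_fst, Prod.smul_snd, inner_smul_right, smul_eq_mul, mul_left_comm,
    ← mul_add, inner_self_eq_norm_sq_to_K, ← Complex.normSq_eq_conj_mul_self,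
    Complex.normSq_eq_norm_sq, Complex.I_mul_im, Complex.add_re, Complex.ofReal_re]
  congr 1
  have : ((‖u.1‖ : ℂ) ^ 2) = ((‖u.1‖ ^ 2 : ℝ) : ℂ) := by push_cast; rfl
  exact (congrArg Complex.re this).trans (Complex.ofReal_re _)

/-- Isotropic subspaces have at most half the dimension. -/
theorem two_mul_finrank_le_of_isotropic {n : ℕ} {T : Submodule ℝ (Cn n × ℂ)}
    (hT : ∀ u ∈ T, ∀ v ∈ T, sympExt u v = 0) : 2 * Module.finrank ℝ T ≤ 2 * (n + 1) := by
  let J : (Cn n × ℂ) →ₗ[ℝ] (Cn n × ℂ) :=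
    (LinearMap.lsmul ℂ (Cn n × ℂ) Complex.I).restrictScalars ℝ
  have hJ : Function.Injective J := smul_right_injective _ Complex.I_ne_zero
  have h1 := Submodule.finrank_sup_add_finrank_inf_eq T (T.map J)
  have h2 : T ⊓ T.map J = ⊥ := by
    rw [eq_bot_iff]
    rintro _ ⟨hu, v, hv, rfl⟩
    have h3 : sympExt v (Complex.I • v) = 0 := hT v hv _ hu
    rw [sympExt_I_smul] at h3
    have h4 : ‖v.1‖ = 0 := by nlinarith [norm_nonneg v.1, sq_nonneg ‖v.1‖, sq_nonneg ‖v.2‖]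
    have h5 : ‖v.2‖ = 0 := by nlinarith [norm_nonneg v.2, sq_nonneg ‖v.1‖, sq_nonneg ‖v.2‖]
    have h6 : v = 0 := Prod.ext (norm_eq_zero.1 h4) (norm_eq_zero.1 h5)
    rw [h6, map_zero]
    exact Submodule.zero_mem _
  have h3 : Module.finrank ℝ (T.map J) = Module.finrank ℝ T :=
    (Submodule.equivMapOfInjective J hJ T).finrank_eq.symm
  have h4 := Submodule.finrank_le (T ⊔ T.map J)
  rw [Module.finrank_prod, finrank_real_Cn, Complex.finrank_real_complex] at h4
  rw [h2, finrank_bot, h3] at h1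
  omega

/-- A Lagrangian subspace contains every vector that is symplectically orthogonal to it. -/
theorem mem_of_sympExt_eq_zero {n : ℕ} {T : Submodule ℝ (Cn n × ℂ)}
    (hT : ∀ u ∈ T, ∀ v ∈ T, sympExt u v = 0) (hdim : Module.finrank ℝ T = n + 1)
    {y : Cn n × ℂ} (hy : ∀ u ∈ T, sympExt y u = 0) : y ∈ T := by
  by_contra hyT
  have hiso : ∀ u ∈ T ⊔ Submodule.span ℝ {y}, ∀ v ∈ T ⊔ Submodule.span ℝ {y},
      sympExt u v = 0 := by
    intro u hu v hv
    obtain ⟨u₀, hu₀, _, hu', rfl⟩ := Submodule.mem_sup.1 hu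
    obtain ⟨v₀, hv₀, _, hv', rfl⟩ := Submodule.mem_sup.1 hv
    obtain ⟨a, rfl⟩ := Submodule.mem_span_singleton.1 hu'
    obtain ⟨b, rfl⟩ := Submodule.mem_span_singleton.1 hv'
    rw [sympExt_add_left, sympExt_add_right, sympExt_add_right, sympExt_smul_left,
      sympExt_smul_left, sympExt_smul_right, sympExt_smul_right, hT u₀ hu₀ v₀ hv₀, hy v₀ hv₀,
      sympExt_comm u₀ y, hy u₀ hu₀, sympExt_self]
    simp
  have h1 := two_mul_finrank_le_of_isotropic hiso
  have h2 : T < T ⊔ Submodule.span ℝ {y} :=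
    left_lt_sup.2 fun h => hyT (h (Submodule.mem_span_singleton_self y))
  have h3 := Submodule.finrank_lt_finrank_of_lt h2
  omega

/-! ### Sweeping out a profile by the slice -/

theorem fderiv_mem_of_mapsTo {E V : Type} [NormedAddCommGroup E] [NormedSpace ℝ E]
    [NormedAddCommGroup V] [NormedSpace ℝ V] {U : Set E} (hU : IsOpen U) {f : E → V}
    {S : Submodule ℝ V} (hS : IsClosed (S : Set V)) (hf : Set.MapsTo f U S) {x : E} (hx : x ∈ U)
    (hd : DifferentiableAt ℝ f x) (u : E) : fderiv ℝ f x u ∈ S := by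
  have h1 : HasDerivAt (fun t : ℝ => f (x + t • u)) (fderiv ℝ f x u) 0 := by
    have h2 : HasDerivAt (fun t : ℝ => x + t • u) u 0 := by
      simpa using ((hasDerivAt_id (0 : ℝ)).smul_const u).const_add x
    have h3 : HasFDerivAt f (fderiv ℝ f x) (x + (0 : ℝ) • u) := by simpa using hd.hasFDerivAt
    exact h3.comp_hasDerivAt (0 : ℝ) h2
  have h4 := hasDerivAt_iff_tendsto_slope_zero.1 h1
  refine hS.mem_of_tendsto h4 ?_
  have hc : Tendsto (fun t : ℝ => x + t • u) (𝓝[≠] 0) (𝓝 x) := by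
    have : Continuous fun t : ℝ => x + t • u := by fun_prop
    simpa using (this.tendsto 0).mono_left nhdsWithin_le_nhds
  filter_upwards [hc.eventually (hU.mem_nhds hx)] with t ht
  simp only [zero_add, zero_smul, add_zero]
  exact S.smul_mem _ (S.sub_mem (hf ht) (hf hx))

section Sweep

variable {n : ℕ} {G : Subgroup (SU n)} {z : Cn n} {E : Type} [NormedAddCommGroup E]
  [NormedSpace ℝ E]

/-- The map `(a, x) ↦ ξ(a) · φ(x)`. -/
noncomputable def Slice.sweep (s : Slice G z) (φ : E → Cn n × ℂ) :
    orbitTangent G z × E → Cn n × ℂ :=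
  fun p => (act (s.ξ p.1) (φ p.2).1, (φ p.2).2)

open scoped Matrix.Norms.L2Operator in
theorem Slice.hasFDerivAt_sweep (s : Slice G z) {φ : E → Cn n × ℂ} {x : E}
    (hφ : DifferentiableAt ℝ φ x) (a : orbitTangent G z) (a' : orbitTangent G z) (x' : E) :
    DifferentiableAt ℝ (s.sweep φ) (a, x) ∧ fderiv ℝ (s.sweep φ) (a, x) (a', x') =
      (act (fderiv ℝ s.ξ a a') (φ x).1 + act (s.ξ a) (fderiv ℝ φ x x').1,
        (fderiv ℝ φ x x').2) := by
  have h1 : HasFDerivAt (fun p : orbitTangent G z × E => s.ξ p.1)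
      ((fderiv ℝ s.ξ a).comp ((orbitTangent G z).subtypeL.comp
        (ContinuousLinearMap.fst ℝ (orbitTangent G z) E))) (a, x) := by
    have h0 : HasFDerivAt s.ξ (fderiv ℝ s.ξ a) (a : Cn n) :=
      (s.contDiff_ξ.differentiable (by simp) _).hasFDerivAt
    exact h0.comp (a, x) ((orbitTangent G z).subtypeL.comp
        (ContinuousLinearMap.fst ℝ (orbitTangent G z) E)).hasFDerivAt
  have h2 : HasFDerivAt (fun p : orbitTangent G z × E => φ p.2)
      ((fderiv ℝ φ x).comp (ContinuousLinearMap.snd ℝ (orbitTangent G z) E)) (a, x) :=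
    hφ.hasFDerivAt.comp (a, x) (ContinuousLinearMap.snd ℝ (orbitTangent G z) E).hasFDerivAt
  have h3 := (((actBilin n).hasFDerivAt.comp (a, x) h1).clm_apply h2.fst).prodMk h2.snd
  have h4 : s.sweep φ = fun p : orbitTangent G z × E =>
    (actBilin n (s.ξ p.1) (φ p.2).1, (φ p.2).2) := rfl
  rw [h4]
  refine ⟨h3.differentiableAt, ?_⟩
  have h5 := h3.fderiv
  refine (DFunLike.congr_fun h5 (a', x')).trans ?_
  refine Prod.ext ?_ rfl
  rw [add_comm]
  rfl

open scoped Matrix.Norms.L2Operator in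
-- A curve in G, translated back to the identity on the right, has velocity in 𝔤.
theorem Slice.exists_fderiv_eq (s : Slice G z) (hG : IsCompact (G : Set (SU n))) (a a' : Cn n) :
    ∃ X ∈ lieAlg G, fderiv ℝ s.ξ a a' = X * s.ξ a := by
  have h1 : HasDerivAt (fun t : ℝ => a + t • a') a' 0 := by
    simpa using ((hasDerivAt_id (0 : ℝ)).smul_const a').const_add a
  have h2 : HasFDerivAt s.ξ (fderiv ℝ s.ξ a) (a + (0 : ℝ) • a') := by
    simpa using (s.contDiff_ξ.differentiable (by simp) a).hasFDerivAt
  have h3 := h2.comp_hasDerivAt (0 : ℝ) h1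
  obtain ⟨X, hX, hXe⟩ := exists_mem_lieAlg_of_hasDerivAt hG (γ := s.ξ ∘ fun t : ℝ => a + t • a')
    (fun t => by
      obtain ⟨g, hg⟩ := s.ξ_mem (a + t • a')
      exact ⟨g, g.2, hg⟩) h3
  refine ⟨X, hX, hXe.trans ?_⟩
  simp

/-- Points of the product of the complex line through `z` and `ℂ`, as a real subspace. -/
noncomputable def lineProd (z : Cn n) : Submodule ℝ (Cn n × ℂ) :=
  ((line z).restrictScalars ℝ).prod ⊤

theorem mem_lineProd {w : Cn n × ℂ} : w ∈ lineProd z ↔ w.1 ∈ line z := by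
  simp [lineProd]

open scoped Matrix.Norms.L2Operator in
-- With g = ξ(a) and w = gφ(x), each derivative is an orbit vector Xw plus the g-translate of a
-- profile vector, whose ℂⁿ-part is a multiple of w. These are Hermitian-orthogonal in ℂⁿ by the
-- moment map equation, so each vanishes if the sum does and the mixed symplectic terms are zero.
-- Orbit directions pair to zero by isotropy of orbits, profile directions by isotropy of φ.
theorem Slice.isIsotropicPatch_sweep (s : Slice G z) (hG : IsCompact (G : Set (SU n)))
    (hz : momentMap G z = 0) {U : Set E}
    {φ : E → Cn n × ℂ} (hφ : IsIsotropicPatch sympExt U φ)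
    (hmem : ∀ x ∈ U, (φ x).1 ∈ line z ∧ (φ x).1 ≠ 0) :
    IsIsotropicPatch sympExt {p : orbitTangent G z × E | (p.1 : Cn n) ∈ s.B ∧ p.2 ∈ U}
      (s.sweep φ) := by
  have hopen : IsOpen {p : orbitTangent G z × E | (p.1 : Cn n) ∈ s.B ∧ p.2 ∈ U} :=
    (s.isOpen_B.preimage (continuous_subtype_val.comp continuous_fst)).inter
      (hφ.isOpen.preimage continuous_snd)
  -- description of the derivative
  have key : ∀ (a : orbitTangent G z) (x : E), x ∈ U → ∀ (a' : orbitTangent G z) (x' : E),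
      ∃ g : G, ((g : SU n) : Mat n) = s.ξ a ∧ ∃ X ∈ lieAlg G,
        act (fderiv ℝ s.ξ a a') (φ x).1 = act X (g • (φ x).1) ∧
        fderiv ℝ (s.sweep φ) (a, x) (a', x') =
          (act X (g • (φ x).1), 0) + g • fderiv ℝ φ x x' ∧
        ∃ c : ℂ, g • (fderiv ℝ φ x x').1 = c • g • (φ x).1 := by
    intro a x hx a' x'
    obtain ⟨g, hg⟩ := s.ξ_mem a
    obtain ⟨X, hX, hXe⟩ := s.exists_fderiv_eq hG a a'
    have h1 : act (fderiv ℝ s.ξ a a') (φ x).1 = act X (g • (φ x).1) := by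
      rw [hXe, act_mul, smul_eq_act', hg]
    refine ⟨g, hg, X, hX, h1, ?_, ?_⟩
    · rw [(s.hasFDerivAt_sweep (hφ.differentiableAt hx) a a' x').2, h1, ext_smul, Prod.mk_add_mk,
        zero_add, smul_eq_act', smul_eq_act', hg]
    · have h2 : fderiv ℝ φ x x' ∈ lineProd z :=
        fderiv_mem_of_mapsTo hφ.isOpen (Submodule.closed_of_finiteDimensional _)
          (fun y hy => mem_lineProd.2 (hmem y hy).1) hx (hφ.differentiableAt hx) x'
      obtain ⟨c, hc⟩ := mem_line.1 (mem_lineProd.1 h2)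
      obtain ⟨b, hb⟩ := mem_line.1 (hmem x hx).1
      have hb0 : b ≠ 0 := by
        rintro rfl
        exact (hmem x hx).2 (by rw [hb, zero_smul])
      refine ⟨c * b⁻¹, ?_⟩
      rw [hc, hb, smul_complex_smul, smul_complex_smul, smul_smul, mul_assoc, inv_mul_cancel₀ hb0,
        mul_one]
  have hzero : ∀ x ∈ U, ∀ g : G, momentMap G (g • (φ x).1) = 0 := fun x hx g => by
    obtain ⟨b, hb⟩ := mem_line.1 (hmem x hx).1
    rw [hb]
    exact group_smul_mem_zeroLevel (smul_mem_zeroLevel hz b) g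
  have hperp : ∀ w : Cn n, momentMap G w = 0 → ∀ X ∈ lieAlg G, ∀ c : ℂ,
      inner ℂ (act X w) (c • w) = 0 := fun w hw X hX c => by
    rw [inner_smul_right, inner_act_of_mem_lieAlg hX, momentMap_eq_zero_iff.1 hw X hX, neg_zero,
      mul_zero]
  refine ⟨hopen, ?_, ?_, ?_⟩
  · have h1 : ContDiff ℝ ∞ fun p : orbitTangent G z × E => s.ξ p.1 :=
      s.contDiff_ξ.comp ((orbitTangent G z).subtypeL.contDiff.comp contDiff_fst)
    have h2 : ContDiffOn ℝ ∞ (fun p : orbitTangent G z × E => φ p.2)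
        {p : orbitTangent G z × E | (p.1 : Cn n) ∈ s.B ∧ p.2 ∈ U} :=
      hφ.smooth.comp contDiff_snd.contDiffOn fun p hp => hp.2
    exact ((((actBilin n).contDiff.comp h1).contDiffOn).clm_apply
      (contDiff_fst.comp_contDiffOn h2)).prodMk (contDiff_snd.comp_contDiffOn h2)
  · rintro ⟨a, x⟩ ⟨ha, hx⟩
    rw [injective_iff_map_eq_zero]
    rintro ⟨a', x'⟩ h0
    obtain ⟨g, hg, X, hX, hXe, hD, c, hc⟩ := key a x hx a' x'
    rw [hD] at h0
    have h1 : act X (g • (φ x).1) + g • (fderiv ℝ φ x x').1 = 0 := congrArg Prod.fst h0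
    have h2 : (fderiv ℝ φ x x').2 = 0 := by
      have : 0 + (fderiv ℝ φ x x').2 = 0 := congrArg Prod.snd h0
      rwa [zero_add] at this
    have h3 : act X (g • (φ x).1) = 0 := by
      have h4 := hperp _ (hzero x hx g) X hX c
      rw [← hc, ← neg_eq_of_add_eq_zero_right h1, inner_neg_right, neg_eq_zero] at h4
      exact inner_self_eq_zero.1 h4
    rw [h3, zero_add, smul_eq_zero_iff_eq] at h1
    have hx' : x' = 0 := hφ.immersive x hx (by rw [map_zero]; exact Prod.ext h1 h2)
    have ha' : (a' : Cn n) = 0 := by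
      refine s.immersive a ha a' a'.2 ?_
      rw [h3] at hXe
      obtain ⟨b, hb⟩ := mem_line.1 (hmem x hx).1
      have hb0 : b ≠ 0 := by
        rintro rfl
        exact (hmem x hx).2 (by rw [hb, zero_smul])
      rw [hb, map_smul] at hXe
      exact (smul_eq_zero_iff_right hb0).1 hXe
    exact Prod.ext (Subtype.ext ha') hx'
  · rintro ⟨a, x⟩ ⟨ha, hx⟩ ⟨a', x'⟩ ⟨a'', x''⟩
    obtain ⟨g, hg, X, hX, -, hD, c, hc⟩ := key a x hx a' x'
    obtain ⟨g', hg', Y, hY, -, hD', c', hc'⟩ := key a x hx a'' x''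
    obtain rfl : g = g' := Subtype.ext (Subtype.ext (hg.trans hg'.symm))
    rw [hD, hD', sympExt_add_left, sympExt_add_right, sympExt_add_right, sympExt_smul_smul,
      hφ.isotropic x hx, sympExt_comm (g • _) (_, 0)]
    have hw := hzero x hx g
    have h1 : ∀ X ∈ lieAlg G, ∀ c : ℂ, ∀ f : Cn n × ℂ, g • f.1 = c • g • (φ x).1 →
        sympExt (act X (g • (φ x).1), 0) (g • f) = 0 := by
      intro X hX c f hf
      have h2 : (g • f).1 = g • f.1 := rfl
      rw [sympExt_eq, h2, hf, hperp _ hw X hX c]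
      simp
    rw [h1 X hX c' _ hc', h1 Y hY c _ hc, sympExt_eq]
    simp [inner_act_act_im hG hw hX hY]

end Sweep

/-! ### Saturations of invariant profiles as Lagrangian submanifolds -/

section Saturation

variable {n : ℕ} {G : Subgroup (SU n)} {z : Cn n}

/-- The action of a group element on `ℂⁿ × ℂ` as a continuous linear map. -/
noncomputable def extCLM (g : SU n) : (Cn n × ℂ) →L[ℝ] (Cn n × ℂ) :=
  ((act (g : Mat n)).restrictScalars ℝ).prodMap (ContinuousLinearMap.id ℝ ℂ)

theorem continuous_ext_smul (g : G) : Continuous fun w : Cn n × ℂ => g • w :=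
  (extCLM (g : SU n)).continuous

theorem IsIsotropicPatch.group_smul {E : Type} [NormedAddCommGroup E] [NormedSpace ℝ E]
    {U : Set E} {φ : E → Cn n × ℂ} (h : IsIsotropicPatch sympExt U φ) (g : G) :
    IsIsotropicPatch sympExt U fun x => g • φ x :=
  h.postcomp (extCLM (g : SU n)) (MulAction.injective g) (sympExt_smul_smul g)

theorem HasEmbeddedPatch.group_smul {E : Type} [NormedAddCommGroup E] [NormedSpace ℝ E]
    {L : Set (Cn n × ℂ)} {w : Cn n × ℂ} (h : HasEmbeddedPatch E sympExt L w)
    (hL : IsInvariant G L) (g : G) : HasEmbeddedPatch E sympExt L (g • w) := by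
  obtain ⟨W, U, φ, ψ, hW, hw, hφ, him, hψ, hinv⟩ := h
  refine ⟨(fun v => g⁻¹ • v) ⁻¹' W, U, fun x => g • φ x, fun v => ψ (g⁻¹ • v),
    hW.preimage (continuous_ext_smul g⁻¹), ?_, hφ.group_smul g, ?_, ?_, ?_⟩
  · rw [Set.mem_preimage, inv_smul_smul]
    exact hw
  · ext v
    constructor
    · rintro ⟨x, hx, rfl⟩
      have h1 : φ x ∈ L ∩ W := him ▸ Set.mem_image_of_mem φ hx
      refine ⟨hL g _ h1.1, ?_⟩
      rw [Set.mem_preimage, inv_smul_smul]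
      exact h1.2
    · rintro ⟨hvL, hvW⟩
      have h1 : g⁻¹ • v ∈ φ '' U := him ▸ ⟨hL g⁻¹ v hvL, hvW⟩
      obtain ⟨x, hx, hxv⟩ := h1
      exact ⟨x, hx, by simp only [hxv, smul_inv_smul]⟩
  · exact hψ.comp (continuous_ext_smul g⁻¹).continuousOn fun v hv => ⟨hL g⁻¹ v hv.1, hv.2⟩
  · intro x hx
    simp only [inv_smul_smul, hinv x hx]

theorem isInvariant_saturation (S : Set (Cn n × ℂ)) : IsInvariant G (saturation G S) := by
  rintro g _ ⟨h, w, hw, rfl⟩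
  exact ⟨g * h, w, hw, (mul_smul _ _ _).symm⟩

theorem mem_lineStab {g : G} {c : ℂ} (hc : c ≠ 0) (hg : g • z = c • z) : g ∈ lineStab G z := by
  rw [MulAction.mem_stabilizer_iff]
  ext v
  rw [Set.mem_smul_set_iff_inv_smul_mem]
  have hg' : g⁻¹ • z = c⁻¹ • z := by
    rw [inv_smul_eq_iff, smul_complex_smul, hg, smul_smul, inv_mul_cancel₀ hc, one_smul]
  constructor
  · intro hv
    obtain ⟨b, hb⟩ := mem_line.1 hv
    refine mem_line.2 ⟨b * c, ?_⟩
    rw [inv_smul_eq_iff] at hb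
    rw [hb, smul_complex_smul, hg, smul_smul]
  · intro hv
    obtain ⟨b, rfl⟩ := mem_line.1 hv
    refine mem_line.2 ⟨b * c⁻¹, ?_⟩
    rw [smul_complex_smul, hg', smul_smul]

theorem IsInvariantProfile.smul_mem {S : Set (Cn n × ℂ)} (hS : IsInvariantProfile G z S) {g : G}
    (hg : g ∈ lineStab G z) {w : Cn n × ℂ} (hw : w ∈ S) : g • w ∈ S :=
  hS.invariant (QuotientGroup.mk (⟨g, hg⟩ : lineStab G z)) ⟨w.1, (hS.subset w hw).1⟩ w.2 hw

theorem exists_eq_smul_of_mem_line {v : Cn n} (hv : v ∈ line z) (hv0 : v ≠ 0) :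
    ∃ c : ℂ, c ≠ 0 ∧ v = c • z := by
  obtain ⟨c, rfl⟩ := mem_line.1 hv
  exact ⟨c, fun h => hv0 (by rw [h, zero_smul]), rfl⟩

theorem mem_lineStab_of_smul_mem {g : G} {v : Cn n} (hv : v ∈ line z) (hv0 : v ≠ 0)
    (hg : g • v ∈ line z) : g ∈ lineStab G z := by
  obtain ⟨b, hb0, rfl⟩ := exists_eq_smul_of_mem_line hv hv0
  obtain ⟨c, hc0, hc⟩ := exists_eq_smul_of_mem_line hg fun h =>
    hv0 ((smul_eq_zero_iff_eq g).1 h)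
  rw [smul_complex_smul] at hc
  refine mem_lineStab (c := b⁻¹ * c) (mul_ne_zero (inv_ne_zero hb0) hc0) ?_
  rw [mul_smul, ← hc, inv_smul_smul₀ hb0]

/-- The saturation of an invariant profile does not add points over the complex line. -/
theorem IsInvariantProfile.mem_of_mem_saturation {S : Set (Cn n × ℂ)}
    (hS : IsInvariantProfile G z S) {w : Cn n × ℂ} (hw : w ∈ saturation G S)
    (hwz : w.1 ∈ line z) : w ∈ S := by
  obtain ⟨g, w, hw, rfl⟩ := hw
  obtain ⟨h1, h2⟩ := hS.subset w hw
  exact hS.smul_mem (mem_lineStab_of_smul_mem h1 h2 hwz) hw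

theorem finrank_tangent_prod {E : Type} [NormedAddCommGroup E] [NormedSpace ℝ E]
    [FiniteDimensional ℝ E] (hdim : Module.finrank ℝ (orbitTangent G z) + 1 = n)
    (hE : Module.finrank ℝ E = 2) :
    Module.finrank ℝ (EuclideanSpace ℝ (Fin (n + 1))) =
      Module.finrank ℝ (orbitTangent G z × E) := by
  rw [Module.finrank_prod, finrank_euclideanSpace_fin, hE]
  omega

theorem Slice.sweep_proj {E : Type} [NormedAddCommGroup E] [NormedSpace ℝ E] (s : Slice G z)
    (φ : E → Cn n × ℂ) (v : Cn n) (x : E) :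
    s.sweep φ (⟨orbitProj G z v, orbitProj_mem G z v⟩, x) =
      (act (s.ξ v) (φ x).1, (φ x).2) := by
  rw [Slice.sweep, s.ξ_congr (orbitProj G z v) v (orbitProj_of_mem (orbitProj_mem G z v))]

/-- One sweep covers only group elements near those fixing z. By compactness, finitely many
translates of it cover all of G · S, and countably many patches result. -/
theorem isImmersedIsotropic_saturation (hG : IsCompact (G : Set (SU n)))
    (hz : momentMap G z = 0) (hz0 : z ≠ 0)
    (hdim : Module.finrank ℝ (orbitTangent G z) + 1 = n) {S : Set (Cn n × ℂ)}
    (hS : IsInvariantProfile G z S) (himm : IsImmersedIsotropic sympExt 2 S) :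
    IsImmersedIsotropic sympExt (n + 1) (saturation G S) := by
  obtain ⟨s⟩ := exists_slice hG hz hz0 hdim
  obtain ⟨ι, _, U, φ, hφ, rfl⟩ := himm.exists_patches
  let T : Set (Cn n) := s.e.target
  have hzT : z ∈ T := by
    have := s.e.map_source s.mem_source
    rwa [s.e_self] at this
  obtain ⟨t, htG, hcov⟩ := hG.elim_nhds_subcover
    (fun g => {k : SU n | g⁻¹ • k • z ∈ T}) (fun g _ => by
      have hc : Continuous fun k : SU n => g⁻¹ • k • z :=
        (act ((g⁻¹ : SU n) : Mat n)).continuous.comp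
          ((evalCLM z).continuous.comp continuous_subtype_val)
      refine (s.e.open_target.preimage hc).mem_nhds ?_
      rw [Set.mem_preimage, inv_smul_smul]
      exact hzT)
  have hmem : ∀ i, ∀ x ∈ U i, (φ i x).1 ∈ line z ∧ (φ i x).1 ≠ 0 := fun i x hx =>
    hS.subset _ (Set.mem_iUnion.2 ⟨i, x, hx, rfl⟩)
  let e : EuclideanSpace ℝ (Fin (n + 1)) ≃L[ℝ] orbitTangent G z × EuclideanSpace ℝ (Fin 2) :=
    ContinuousLinearEquiv.ofFinrankEq (finrank_tangent_prod hdim finrank_euclideanSpace_fin)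
  let D : ι → Set (orbitTangent G z × EuclideanSpace ℝ (Fin 2)) :=
    fun i => {p | (p.1 : Cn n) ∈ s.B ∧ p.2 ∈ U i}
  let Φ : t × ι → EuclideanSpace ℝ (Fin (n + 1)) → Cn n × ℂ := fun p x =>
    (⟨p.1, htG p.1 p.1.2⟩ : G) • s.sweep (φ p.2) (e x)
  have hpatch : ∀ p : t × ι, IsIsotropicPatch sympExt (e ⁻¹' D p.2) (Φ p) := fun p =>
    ((s.isIsotropicPatch_sweep hG hz (hφ p.2) (hmem p.2)).comp_equiv e).group_smul _
  convert isImmersedIsotropic_iUnion n.succ_pos hpatch using 1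
  ext w
  rw [Set.mem_iUnion]
  constructor
  · rintro ⟨g, w, hw, rfl⟩
    obtain ⟨g₀, hg₀, hgT⟩ := Set.mem_iUnion₂.1 (hcov g.2)
    let g₁ : G := ⟨g₀, htG g₀ hg₀⟩
    have hgT' : (g₁⁻¹ * g) • z ∈ T := by rw [mul_smul]; exact hgT
    set k : G := g₁⁻¹ * g with hk
    set v := s.e.symm (k • z) with hv
    have hvs : v ∈ s.e.source := s.e.map_target hgT'
    have hev : s.e v = k • z := s.e.right_inv hgT'
    have hline := s.sub_proj_mem v hvs (by rw [hev]; exact group_smul_mem_zeroLevel hz k)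
    obtain ⟨h, hh⟩ := s.ξ_mem v
    rw [s.e_apply, ← hh, ← smul_eq_act'] at hev
    -- Here kz = h(v − πv) with v − πv on the line, so h⁻¹k stabilises the line and the invariant
    -- profile absorbs it. This leaves gw as g₁h applied to a point of S.
    have hkz : (h⁻¹ * k) • z ∈ line z := by
      rw [mul_smul, ← hev, inv_smul_smul]
      exact hline
    have hstab := mem_lineStab_of_smul_mem (mem_line.2 ⟨1, (one_smul _ _).symm⟩) hz0 hkz
    obtain ⟨i, x, hx, hxw⟩ := Set.mem_iUnion.1 (hS.smul_mem hstab hw)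
    refine ⟨(⟨g₀, hg₀⟩, i), e.symm (⟨orbitProj G z v, orbitProj_mem G z v⟩, x), ?_, ?_⟩
    · rw [Set.mem_preimage, e.apply_symm_apply]
      exact ⟨s.mem_B_congr v _ (orbitProj_of_mem (orbitProj_mem G z v)).symm
        (s.source_subset hvs), hx⟩
    · change g₁ • s.sweep (φ i) (e (e.symm _)) = _
      rw [e.apply_symm_apply, s.sweep_proj, hxw, ← hh]
      change g₁ • h • (h⁻¹ * k) • w = _
      rw [mul_smul, smul_inv_smul, hk, mul_smul, smul_inv_smul]
  · rintro ⟨⟨g₀, i⟩, y, hy, rfl⟩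
    obtain ⟨h, hh⟩ := s.ξ_mem (e y).1
    refine ⟨(⟨g₀, htG g₀ g₀.2⟩ : G) * h, φ i (e y).2, Set.mem_iUnion.2 ⟨i, _, hy.2, rfl⟩, ?_⟩
    rw [mul_smul]
    change _ • (act (s.ξ (e y).1) _, _) = _
    rw [← hh]
    rfl

/-- Since w lies over cz, scaling by c⁻¹ carries the slice at z to w. The slice coordinates recover
the orbit parameter π(κ w) and the profile point R w continuously, and invariance of S ensures that
R sends nearby points of the saturation back into S. -/
theorem hasEmbeddedPatch_saturation (hG : IsCompact (G : Set (SU n)))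
    (hz : momentMap G z = 0) (hz0 : z ≠ 0)
    (hdim : Module.finrank ℝ (orbitTangent G z) + 1 = n) {S : Set (Cn n × ℂ)}
    (hS : IsInvariantProfile G z S) {E : Type} [NormedAddCommGroup E] [NormedSpace ℝ E]
    {w : Cn n × ℂ} (hw : w ∈ S) (h : HasEmbeddedPatch E sympExt S w) :
    HasEmbeddedPatch (orbitTangent G z × E) sympExt (saturation G S) w := by
  obtain ⟨s⟩ := exists_slice hG hz hz0 hdim
  obtain ⟨W, U, φ, ψ, hW, hwW, hφ, him, hψ, hinv⟩ := h
  obtain ⟨c, hc, hwc⟩ := exists_eq_smul_of_mem_line (hS.subset w hw).1 (hS.subset w hw).2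
  have hφS : ∀ x ∈ U, φ x ∈ S ∩ W := fun x hx => him ▸ Set.mem_image_of_mem φ hx
  have hmem : ∀ x ∈ U, (φ x).1 ∈ line z ∧ (φ x).1 ≠ 0 := fun x hx => hS.subset _ (hφS x hx).1
  have hpatch := s.isIsotropicPatch_sweep hG hz hφ hmem
  let π := orbitProj G z
  -- the coordinate map `w ↦ v`, and the profile part of `w`
  let κ : Cn n × ℂ → Cn n := fun w => s.e.symm (c⁻¹ • w.1)
  let R : Cn n × ℂ → Cn n × ℂ := fun w => (c • (κ w - π (κ w)), w.2)
  let W₀ : Set (Cn n × ℂ) := (fun w : Cn n × ℂ => c⁻¹ • w.1) ⁻¹' s.e.target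
  have hscal : Continuous fun w : Cn n × ℂ => c⁻¹ • w.1 := by fun_prop
  have hW₀ : IsOpen W₀ := s.e.open_target.preimage hscal
  have hκ : ContinuousOn κ W₀ :=
    s.e.continuousOn_symm.comp hscal.continuousOn (Set.mapsTo_preimage _ _)
  have hR : ContinuousOn R W₀ :=
    ((hκ.sub (π.continuous.comp_continuousOn hκ)).const_smul c).prodMk continuous_snd.continuousOn
  let W' : Set (Cn n × ℂ) := W₀ ∩ R ⁻¹' W
  have hW' : IsOpen W' := hR.isOpen_inter_preimage hW₀ hW
  -- points of the saturation in `W'`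
  have hpt : ∀ w ∈ saturation G S ∩ W', R w ∈ S ∩ W ∧ (act (s.ξ (κ w)) (R w).1, (R w).2) = w := by
    rintro w ⟨hwL, hw₀, hwR⟩
    have hev : s.e (κ w) = c⁻¹ • w.1 := s.e.right_inv hw₀
    have hzero : momentMap G (c⁻¹ • w.1) = 0 := by
      obtain ⟨g, w, hw, rfl⟩ := hwL
      obtain ⟨b, hb⟩ := mem_line.1 (hS.subset w hw).1
      refine smul_mem_zeroLevel ?_ _
      change momentMap G (g • w.1) = 0
      rw [hb]
      exact group_smul_mem_zeroLevel (smul_mem_zeroLevel hz b) g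
    have hline := s.sub_proj_mem (κ w) (s.e.map_target hw₀) (by rw [hev]; exact hzero)
    have hrec : (act (s.ξ (κ w)) (R w).1, (R w).2) = w := by
      refine Prod.ext ?_ rfl
      change act (s.ξ (κ w)) (c • (κ w - π (κ w))) = w.1
      rw [map_smul, ← s.e_apply, hev, smul_inv_smul₀ hc]
    refine ⟨⟨hS.mem_of_mem_saturation ?_ ((line z).smul_mem c hline), hwR⟩, hrec⟩
    obtain ⟨g, hg⟩ := s.ξ_mem (κ w)
    have hgR : g • R w = w := by
      rw [ext_smul, smul_eq_act', hg]
      exact hrec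
    have : R w = g⁻¹ • w := eq_inv_smul_iff.2 hgR
    rw [this]
    exact isInvariant_saturation S g⁻¹ w hwL
  -- the domain of the patch
  let D : Set (orbitTangent G z × E) := {p | (p.1 : Cn n) ∈ s.B ∧ p.2 ∈ U}
  -- The slice coordinate of the swept point: its projection to the orbit tangent is p.1 and its
  -- remainder is c⁻¹ times the profile point.
  let lam : orbitTangent G z × E → Cn n := fun p => (p.1 : Cn n) + c⁻¹ • (φ p.2).1
  have hφD : ContinuousOn (fun p : orbitTangent G z × E => (φ p.2).1) D :=
    continuous_fst.comp_continuousOn (hφ.smooth.continuousOn.comp continuous_snd.continuousOn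
      fun p hp => hp.2)
  have hlam : ContinuousOn lam D :=
    ContinuousOn.add (continuous_subtype_val.comp continuous_fst).continuousOn
      (hφD.const_smul c⁻¹)
  let D' : Set (orbitTangent G z × E) := D ∩ lam ⁻¹' s.e.source
  have hD' : IsOpen D' := hlam.isOpen_inter_preimage hpatch.isOpen s.e.open_source
  have hπlam : ∀ p ∈ D, π (lam p) = p.1 := fun p hp => by
    change π ((p.1 : Cn n) + c⁻¹ • (φ p.2).1) = _
    rw [map_add, orbitProj_of_mem p.1.2,
      orbitProj_of_mem_line hz ((line z).smul_mem _ (hmem _ hp.2).1), add_zero]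
  have hξlam : ∀ p ∈ D, s.ξ (lam p) = s.ξ p.1 := fun p hp =>
    s.ξ_congr _ _ ((hπlam p hp).trans (orbitProj_of_mem p.1.2).symm)
  have hsub : ∀ p ∈ D, lam p - π (lam p) = c⁻¹ • (φ p.2).1 := fun p hp => by
    rw [hπlam p hp, add_sub_cancel_left]
  have helam : ∀ p ∈ D, s.e (lam p) = c⁻¹ • (s.sweep φ p).1 := fun p hp => by
    rw [s.e_apply, hξlam p hp, hsub p hp, map_smul]
    rfl
  have hκs : ∀ p ∈ D', κ (s.sweep φ p) = lam p := fun p hp => by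
    change s.e.symm (c⁻¹ • (s.sweep φ p).1) = _
    rw [← helam p hp.1, s.e.left_inv hp.2]
  have hRs : ∀ p ∈ D', R (s.sweep φ p) = φ p.2 := fun p hp => by
    refine Prod.ext ?_ rfl
    change c • (κ (s.sweep φ p) - π (κ (s.sweep φ p))) = _
    rw [hκs p hp, hsub p hp.1, smul_inv_smul₀ hc]
  refine ⟨W', D', s.sweep φ, fun w => (⟨π (κ w), orbitProj_mem G z _⟩, ψ (R w)), hW', ?_,
    hpatch.mono hD' Set.inter_subset_left, ?_, ?_, ?_⟩
  · have h1 : c⁻¹ • w.1 = z := by rw [hwc, inv_smul_smul₀ hc]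
    have h2 : κ w = z := by
      change s.e.symm (c⁻¹ • w.1) = z
      rw [h1]
      exact (congrArg s.e.symm s.e_self).symm.trans (s.e.left_inv s.mem_source)
    have h3 : R w = w := by
      refine Prod.ext ?_ rfl
      change c • (κ w - π (κ w)) = w.1
      rw [h2, orbitProj_of_mem_line hz (mem_line.2 ⟨1, (one_smul _ _).symm⟩), sub_zero, hwc]
    refine ⟨?_, ?_⟩
    · change c⁻¹ • w.1 ∈ s.e.target
      rw [h1]
      have := s.e.map_source s.mem_source
      rwa [s.e_self] at this
    · rw [Set.mem_preimage, h3]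
      exact hwW
  · ext v
    constructor
    · rintro ⟨p, hp, rfl⟩
      refine ⟨?_, ?_, ?_⟩
      · obtain ⟨g, hg⟩ := s.ξ_mem p.1
        refine ⟨g, φ p.2, (hφS _ hp.1.2).1, ?_⟩
        rw [ext_smul, smul_eq_act', hg]
        rfl
      · change c⁻¹ • (s.sweep φ p).1 ∈ s.e.target
        rw [← helam p hp.1]
        exact s.e.map_source hp.2
      · rw [Set.mem_preimage, hRs p hp]
        exact (hφS _ hp.1.2).2
    · intro hv
      obtain ⟨hRv, hrec⟩ := hpt v hv
      rw [← him] at hRv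
      obtain ⟨x, hx, hxR⟩ := hRv
      have hκsrc : κ v ∈ s.e.source := s.e.map_target hv.2.1
      have hDmem : ((⟨π (κ v), orbitProj_mem G z _⟩, x) : orbitTangent G z × E) ∈ D :=
        ⟨s.mem_B_congr (κ v) _ (orbitProj_of_mem (orbitProj_mem G z _)).symm
          (s.source_subset hκsrc), hx⟩
      refine ⟨(⟨π (κ v), orbitProj_mem G z _⟩, x), ⟨hDmem, ?_⟩, ?_⟩
      · change π (κ v) + c⁻¹ • (φ x).1 ∈ s.e.source
        rw [hxR]
        change π (κ v) + c⁻¹ • (c • (κ v - π (κ v))) ∈ s.e.source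
        rw [inv_smul_smul₀ hc, add_sub_cancel]
        exact hκsrc
      · rw [s.sweep_proj, hxR]
        exact hrec
  · have hsubW : saturation G S ∩ W' ⊆ W₀ := fun v hv => hv.2.1
    refine ContinuousOn.prodMk ?_ (hψ.comp (hR.mono hsubW) fun v hv => (hpt v hv).1)
    exact Topology.IsInducing.subtypeVal.continuousOn_iff.2
      (π.continuous.comp_continuousOn (hκ.mono hsubW))
  · intro p hp
    refine Prod.ext (Subtype.ext ?_) ?_
    · change π (κ (s.sweep φ p)) = p.1
      rw [hκs p hp, hπlam p hp.1]
    · change ψ (R (s.sweep φ p)) = p.2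
      rw [hRs p hp, hinv _ hp.1.2]

theorem isEmbeddedIsotropic_saturation (hG : IsCompact (G : Set (SU n)))
    (hz : momentMap G z = 0) (hz0 : z ≠ 0)
    (hdim : Module.finrank ℝ (orbitTangent G z) + 1 = n) {S : Set (Cn n × ℂ)}
    (hS : IsInvariantProfile G z S) (hemb : IsEmbeddedIsotropic sympExt 2 S) :
    IsEmbeddedIsotropic sympExt (n + 1) (saturation G S) := by
  refine isEmbeddedIsotropic_of_hasEmbeddedPatch ?_
  rintro _ ⟨g, w, hw, rfl⟩
  refine HasEmbeddedPatch.group_smul ?_ (isInvariant_saturation S) g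
  exact (hasEmbeddedPatch_saturation hG hz hz0 hdim hS hw (hemb.hasEmbeddedPatch hw)).of_equiv
    (ContinuousLinearEquiv.ofFinrankEq (finrank_tangent_prod hdim finrank_euclideanSpace_fin))

end Saturation

/-! ### Profiles of Lagrangians over the zero level set -/

section Profile

variable {n : ℕ} {G : Subgroup (SU n)} {z : Cn n}

/-- Tangent spaces of Lagrangian submanifolds over the zero level set contain the directions of the
orbits. -/
theorem IsIsotropicPatch.exists_fderiv_eq_act {E : Type} [NormedAddCommGroup E] [NormedSpace ℝ E]
    (hE : Module.finrank ℝ E = n + 1) {U : Set E} {F : E → Cn n × ℂ}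
    (hF : IsIsotropicPatch sympExt U F) (hFZ : ∀ x ∈ U, momentMap G (F x).1 = 0) {x : E}
    (hx : x ∈ U) {X : Mat n} (hX : X ∈ lieAlg G) :
    ∃ u, fderiv ℝ F x u = (act X (F x).1, 0) := by
  let T := LinearMap.range (fderiv ℝ F x : E →ₗ[ℝ] Cn n × ℂ)
  have hT : ∀ u ∈ T, ∀ v ∈ T, sympExt u v = 0 := by
    rintro _ ⟨u, rfl⟩ _ ⟨v, rfl⟩
    exact hF.isotropic x hx u v
  have hdim : Module.finrank ℝ T = n + 1 := by
    rw [← hE]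
    exact LinearMap.finrank_range_of_inj (hF.immersive x hx)
  have hmem : (act X (F x).1, (0 : ℂ)) ∈ T := by
    refine mem_of_sympExt_eq_zero hT hdim ?_
    rintro _ ⟨u, rfl⟩
    have hf : HasFDerivAt (fun y => (F y).1)
        ((ContinuousLinearMap.fst ℝ (Cn n) ℂ).comp (fderiv ℝ F x)) x :=
      (hF.differentiableAt hx).hasFDerivAt.fst
    have hXf := ((act X).restrictScalars ℝ).hasFDerivAt.comp x hf
    -- Differentiating ⟨F, XF⟩ = 0 shows that (XF, 0) is symplectically orthogonal to the tangent
    -- space, hence in it by maximality.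
    have h1 := hf.inner ℂ hXf
    have h2 : (fun y => inner ℂ (F y).1 (act X (F y).1)) =ᶠ[𝓝 x] fun _ => (0 : ℂ) := by
      filter_upwards [hF.isOpen.mem_nhds hx] with y hy
      exact momentMap_eq_zero_iff.1 (hFZ y hy) X hX
    have h3 := h1.unique ((hasFDerivAt_const (0 : ℂ) x).congr_of_eventuallyEq h2)
    have h4 := DFunLike.congr_fun h3 u
    have h5 : inner ℂ (F x).1 (act X (fderiv ℝ F x u).1) +
        inner ℂ (fderiv ℝ F x u).1 (act X (F x).1) = 0 := h4
    have h6 := inner_act_of_mem_lieAlg hX (F x).1 (fderiv ℝ F x u).1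
    rw [← neg_eq_iff_eq_neg] at h6
    rw [← h6, ← inner_conj_symm (fderiv ℝ F x u).1] at h5
    have h7 := congrArg Complex.im h5
    simp only [Complex.add_im, Complex.neg_im, Complex.conj_im, Complex.zero_im] at h7
    rw [sympExt_eq]
    simp only [map_zero, zero_mul, add_zero]
    exact show (inner ℂ (act X (F x).1) (fderiv ℝ F x u).1).im = 0 by linarith
  exact hmem

/-- The complex line through `z` cuts a Lagrangian patch over the zero level set in a
two-dimensional patch. -/
theorem IsIsotropicPatch.exists_profile_patch (hG : IsCompact (G : Set (SU n)))
    (hz : momentMap G z = 0) (hz0 : z ≠ 0)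
    (hdim : Module.finrank ℝ (orbitTangent G z) + 1 = n) {E : Type} [NormedAddCommGroup E]
    [NormedSpace ℝ E] (hE : Module.finrank ℝ E = n + 1) {U : Set E} {F : E → Cn n × ℂ}
    (hF : IsIsotropicPatch sympExt U F) (hFZ : ∀ x ∈ U, momentMap G (F x).1 = 0) {x₀ : E}
    (hx₀ : x₀ ∈ U) (hline : (F x₀).1 ∈ line z) (hne : (F x₀).1 ≠ 0) :
    ∃ O : Set E, IsOpen O ∧ x₀ ∈ O ∧ O ⊆ U ∧
      ∃ (U' : Set (EuclideanSpace ℝ (Fin 2))) (j : EuclideanSpace ℝ (Fin 2) → E)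
        (r : E → EuclideanSpace ℝ (Fin 2)), Continuous r ∧ IsIsotropicPatch sympExt U' (F ∘ j) ∧
        j '' U' = {x ∈ O | (F x).1 ∈ line z} ∧ ∀ y ∈ U', r (j y) = y := by
  have : FiniteDimensional ℝ E := Module.finite_of_finrank_eq_succ hE
  have := FiniteDimensional.complete ℝ E
  obtain ⟨c, hc, hxc⟩ := exists_eq_smul_of_mem_line hline hne
  let A := orbitTangent G z
  let m : (Cn n × ℂ) →L[ℝ] Cn n := (c⁻¹ • ContinuousLinearMap.id ℂ (Cn n)).restrictScalars ℝ ∘L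
    ContinuousLinearMap.fst ℝ (Cn n) ℂ
  have hm : ∀ w, m w = c⁻¹ • w.1 := fun w => rfl
  let l : (Cn n × ℂ) →L[ℝ] A := A.orthogonalProjectionOnto ∘L m
  have hl : ∀ w, (l w : Cn n) = orbitProj G z (c⁻¹ • w.1) := fun w => rfl
  let D : E →L[ℝ] A := l ∘L fderiv ℝ F x₀
  -- Orbit directions are tangent to the patch, and at x₀ the scaled projection sends that of X to
  -- Xz.
  have hDsurj : LinearMap.range (D : E →ₗ[ℝ] A) = ⊤ := by
    rw [LinearMap.range_eq_top]
    rintro ⟨a, ha⟩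
    obtain ⟨X, hX, rfl⟩ := mem_orbitTangent.1 ha
    obtain ⟨u, hu⟩ := hF.exists_fderiv_eq_act hE hFZ hx₀ hX
    refine ⟨u, Subtype.ext ?_⟩
    change (l (fderiv ℝ F x₀ u) : Cn n) = act X z
    rw [hl, hu]
    change orbitProj G z (c⁻¹ • act X (F x₀).1) = act X z
    rw [hxc, map_smul (act X), inv_smul_smul₀ hc, orbitProj_of_mem ha]
  let K := LinearMap.ker (D : E →ₗ[ℝ] A)
  have hK : Module.finrank ℝ K = Module.finrank ℝ (EuclideanSpace ℝ (Fin 2)) := by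
    have h1 := LinearMap.finrank_range_add_finrank_ker (D : E →ₗ[ℝ] A)
    rw [hDsurj, finrank_top, hE] at h1
    have h2 : Module.finrank ℝ A + 1 = n := hdim
    rw [finrank_euclideanSpace_fin]
    change Module.finrank ℝ (LinearMap.ker (D : E →ₗ[ℝ] A)) = 2
    omega
  -- A projection onto the two-dimensional kernel completes D to an isomorphism. The resulting ρ is
  -- also the continuous left inverse of the parametrisation j.
  obtain ⟨ρ₀, hρ₀⟩ := K.subtype.exists_leftInverse_of_injective K.ker_subtype
  let k : K ≃L[ℝ] EuclideanSpace ℝ (Fin 2) := ContinuousLinearEquiv.ofFinrankEq hK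
  let ρ : E →L[ℝ] EuclideanSpace ℝ (Fin 2) := (k : K →L[ℝ] _) ∘L ρ₀.toContinuousLinearMap
  let f : E →L[ℝ] A × EuclideanSpace ℝ (Fin 2) := D.prod ρ
  have hfinj : Function.Injective (f : E →ₗ[ℝ] A × EuclideanSpace ℝ (Fin 2)) := by
    rw [injective_iff_map_eq_zero]
    intro u hu
    have h1 : D u = 0 := congrArg Prod.fst hu
    have h2 : k (ρ₀ u) = 0 := congrArg Prod.snd hu
    have h3 : ρ₀ u = 0 := by rwa [map_eq_zero_iff k k.injective] at h2
    have h4 : ρ₀ u = ⟨u, h1⟩ := LinearMap.congr_fun hρ₀ (⟨u, h1⟩ : K)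
    rw [h4] at h3
    exact congrArg Subtype.val h3
  have hfdim : Module.finrank ℝ E = Module.finrank ℝ (A × EuclideanSpace ℝ (Fin 2)) := by
    rw [hE, Module.finrank_prod, finrank_euclideanSpace_fin]
    have h2 : Module.finrank ℝ A + 1 = n := hdim
    omega
  let f' : E ≃L[ℝ] A × EuclideanSpace ℝ (Fin 2) :=
    (LinearMap.linearEquivOfInjective (f : E →ₗ[ℝ] _) hfinj hfdim).toContinuousLinearEquiv
  have hff' : (f' : E →L[ℝ] A × EuclideanSpace ℝ (Fin 2)) = f := by
    apply ContinuousLinearMap.ext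
    intro u
    rfl
  obtain ⟨ε, hε, hslice⟩ := exists_slice_radius hG hz hz0 hdim
  let N : Set E := U ∩ (fun x => m (F x)) ⁻¹' Metric.ball z ε
  have hN : IsOpen N :=
    (m.continuous.comp_continuousOn hF.smooth.continuousOn).isOpen_inter_preimage hF.isOpen
      Metric.isOpen_ball
  have hx₀N : x₀ ∈ N := by
    refine ⟨hx₀, ?_⟩
    rw [Set.mem_preimage, hm, hxc, inv_smul_smul₀ hc]
    exact Metric.mem_ball_self hε
  let κ : E → A × EuclideanSpace ℝ (Fin 2) := fun x => (l (F x), ρ x)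
  have hκ : ContDiffOn ℝ ∞ κ N :=
    (l.contDiff.comp_contDiffOn (hF.smooth.mono Set.inter_subset_left)).prodMk
      ρ.contDiff.contDiffOn
  have hκd : HasFDerivAt κ (f' : E →L[ℝ] A × EuclideanSpace ℝ (Fin 2)) x₀ := by
    rw [hff']
    exact (l.hasFDerivAt.comp x₀ (hF.differentiableAt hx₀).hasFDerivAt).prodMk ρ.hasFDerivAt
  obtain ⟨e, hxe, heN, heκ, hsymm, -⟩ := exists_openPartialHomeomorph hN hκ hx₀N f' hκd
  have he : ∀ x, e x = (l (F x), ρ x) := fun x => congrFun heκ x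
  -- The linear condition of being normal to the orbit of z agrees with lying over the line, by the
  -- local slice property. So the profile is a coordinate plane in the chart e.
  have hlzero : ∀ x ∈ e.source, l (F x) = 0 ↔ (F x).1 ∈ line z := by
    intro x hx
    have hxN := heN hx
    rw [← Submodule.coe_eq_zero, hl]
    constructor
    · intro h
      have h1 := hslice (c⁻¹ • (F x).1) (mem_ball_iff_norm.1 hxN.2)
        (smul_mem_zeroLevel (hFZ x hxN.1) _) (orbitProj_eq_zero_iff.1 h)
      have h2 := (line z).smul_mem c h1
      rwa [smul_inv_smul₀ hc] at h2
    · intro h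
      exact orbitProj_of_mem_line hz ((line z).smul_mem _ h)
  let i : EuclideanSpace ℝ (Fin 2) → A × EuclideanSpace ℝ (Fin 2) := fun y => (0, y)
  have hi : ContDiff ℝ ∞ i := contDiff_const.prodMk contDiff_id
  let U' : Set (EuclideanSpace ℝ (Fin 2)) := i ⁻¹' e.target
  have hU' : IsOpen U' := e.open_target.preimage hi.continuous
  let j : EuclideanSpace ℝ (Fin 2) → E := fun y => e.symm (i y)
  have hj : ContDiffOn ℝ ∞ j U' := hsymm.comp hi.contDiffOn (Set.mapsTo_preimage _ _)
  have hej : ∀ y ∈ U', (l (F (j y)), ρ (j y)) = i y := fun y hy => by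
    rw [← he]
    exact e.right_inv hy
  have hρj : ∀ y ∈ U', ρ (j y) = y := fun y hy => congrArg Prod.snd (hej y hy)
  refine ⟨e.source, e.open_source, hxe, fun x hx => (heN hx).1, U', j, ρ, ρ.continuous, ?_, ?_, hρj⟩
  · refine hF.comp hU' hj (fun y hy => (heN (e.map_target hy)).1) fun y hy => ?_
    refine injective_fderiv_of_leftInverse
      ((hj.contDiffAt (hU'.mem_nhds hy)).differentiableAt (by simp)) ρ.differentiableAt ?_
    filter_upwards [hU'.mem_nhds hy] with y' hy' using hρj y' hy'
  · ext x
    constructor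
    · rintro ⟨y, hy, rfl⟩
      exact ⟨e.map_target hy, (hlzero _ (e.map_target hy)).1 (congrArg Prod.fst (hej y hy))⟩
    · rintro ⟨hx, hxl⟩
      have h1 : e x = i (ρ x) := by
        rw [he, (hlzero x hx).2 hxl]
      refine ⟨ρ x, ?_, ?_⟩
      · change i (ρ x) ∈ e.target
        rw [← h1]
        exact e.map_source hx
      · change e.symm (i (ρ x)) = x
        rw [← h1, e.left_inv hx]

theorem mem_profile {L : Set (Cn n × ℂ)} {w : Cn n × ℂ} :
    w ∈ profile z L ↔ w ∈ L ∧ w.1 ∈ line z := by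
  simp [profile]

theorem isImmersedIsotropic_profile (hG : IsCompact (G : Set (SU n)))
    (hz : momentMap G z = 0) (hz0 : z ≠ 0)
    (hdim : Module.finrank ℝ (orbitTangent G z) + 1 = n) {L : Set (Cn n × ℂ)}
    (hLZ : ∀ w ∈ L, momentMap G w.1 = 0) (hL0 : ∀ w ∈ L, w.1 ≠ 0)
    (himm : IsImmersedIsotropic sympExt (n + 1) L) :
    IsImmersedIsotropic sympExt 2 (profile z L) := by
  obtain ⟨ι, _, U, F, hF, rfl⟩ := himm.exists_patches
  let N : ι → Set (EuclideanSpace ℝ (Fin (n + 1))) := fun i => {x ∈ U i | (F i x).1 ∈ line z}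
  have hmem : ∀ i, ∀ x ∈ U i, F i x ∈ ⋃ i, F i '' U i := fun i x hx =>
    Set.mem_iUnion.2 ⟨i, x, hx, rfl⟩
  choose O hO hxO hOU U' j r hr hpatch him hinv using fun (i : ι) (x : N i) =>
    (hF i).exists_profile_patch hG hz hz0 hdim finrank_euclideanSpace_fin
      (fun x hx => hLZ _ (hmem i x hx)) x.2.1 x.2.2 (hL0 _ (hmem i x x.2.1))
  -- The Lindelöf property keeps the number of profile patches countable.
  choose t ht hcov using fun i : ι => TopologicalSpace.countable_cover_nhds
    fun x : N i => (hO i x).preimage continuous_subtype_val |>.mem_nhds (hxO i x)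
  have : ∀ i, Countable (t i) := fun i => (ht i).to_subtype
  convert isImmersedIsotropic_iUnion two_pos (ι := Σ i, t i) (fun p => hpatch p.1 p.2) using 1
  ext w
  rw [mem_profile]
  constructor
  · rintro ⟨hw, hwz⟩
    obtain ⟨i, x, hx, rfl⟩ := Set.mem_iUnion.1 hw
    have hxc : (⟨x, hx, hwz⟩ : N i) ∈ ⋃ y ∈ t i, Subtype.val ⁻¹' O i y :=
      hcov i ▸ Set.mem_univ _
    obtain ⟨y, hy, hxy⟩ := Set.mem_iUnion₂.1 hxc
    refine Set.mem_iUnion.2 ⟨⟨i, y, hy⟩, ?_⟩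
    rw [Set.image_comp, him]
    exact ⟨x, ⟨hxy, hwz⟩, rfl⟩
  · intro hw
    obtain ⟨⟨i, y, hy⟩, hw⟩ := Set.mem_iUnion.1 hw
    rw [Set.image_comp, him] at hw
    obtain ⟨x, ⟨hx, hxz⟩, rfl⟩ := hw
    exact ⟨hmem i x (hOU i y hx), hxz⟩

theorem isEmbeddedIsotropic_profile (hG : IsCompact (G : Set (SU n)))
    (hz : momentMap G z = 0) (hz0 : z ≠ 0)
    (hdim : Module.finrank ℝ (orbitTangent G z) + 1 = n) {L : Set (Cn n × ℂ)}
    (hLZ : ∀ w ∈ L, momentMap G w.1 = 0) (hL0 : ∀ w ∈ L, w.1 ≠ 0)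
    (hemb : IsEmbeddedIsotropic sympExt (n + 1) L) :
    IsEmbeddedIsotropic sympExt 2 (profile z L) := by
  refine isEmbeddedIsotropic_of_hasEmbeddedPatch fun w hw => ?_
  obtain ⟨hwL, hwz⟩ := mem_profile.1 hw
  obtain ⟨W, U, F, ψ, hW, hwW, hF, him, hψ, hinv⟩ := hemb.hasEmbeddedPatch hwL
  have hFL : ∀ x ∈ U, F x ∈ L ∩ W := fun x hx => him ▸ Set.mem_image_of_mem F hx
  obtain ⟨x₀, hx₀, rfl⟩ : w ∈ F '' U := him ▸ ⟨hwL, hwW⟩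
  obtain ⟨O, hO, hxO, hOU, U', j, r, hr, hpatch, hj, hrj⟩ :=
    hF.exists_profile_patch hG hz hz0 hdim finrank_euclideanSpace_fin
      (fun x hx => hLZ _ (hFL x hx).1) hx₀ hwz (hL0 _ hwL)
  -- Continuity of ψ turns the open condition x ∈ O on parameters into an open condition on points
  -- of L.
  obtain ⟨W₂, hW₂, hW₂e⟩ := continuousOn_iff'.1 hψ O hO
  have hmemW₂ : ∀ x ∈ U, F x ∈ W₂ ↔ x ∈ O := fun x hx => by
    have h1 : F x ∈ ψ ⁻¹' O ∩ (L ∩ W) ↔ F x ∈ W₂ ∩ (L ∩ W) := by rw [hW₂e]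
    have h2 : F x ∈ ψ ⁻¹' O ↔ x ∈ O := by rw [Set.mem_preimage, hinv x hx]
    exact ⟨fun h => h2.1 (h1.2 ⟨h, hFL x hx⟩).1, fun h => (h1.1 ⟨h2.2 h, hFL x hx⟩).1⟩
  refine ⟨W ∩ W₂, U', F ∘ j, r ∘ ψ, hW.inter hW₂, ⟨hwW, (hmemW₂ x₀ hx₀).2 hxO⟩, hpatch, ?_,
    hr.comp_continuousOn (hψ.mono ?_), ?_⟩
  · rw [Set.image_comp, hj]
    ext v
    constructor
    · rintro ⟨x, ⟨hx, hxz⟩, rfl⟩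
      exact ⟨mem_profile.2 ⟨(hFL x (hOU hx)).1, hxz⟩, (hFL x (hOU hx)).2,
        (hmemW₂ x (hOU hx)).2 hx⟩
    · rintro ⟨hv, hvW, hvW₂⟩
      obtain ⟨hvL, hvz⟩ := mem_profile.1 hv
      obtain ⟨x, hx, rfl⟩ : v ∈ F '' U := him ▸ ⟨hvL, hvW⟩
      exact ⟨x, ⟨(hmemW₂ x hx).1 hvW₂, hvz⟩, rfl⟩
  · exact fun v hv => ⟨(mem_profile.1 hv.1).1, hv.2.1⟩
  · intro y hy
    have hjy : j y ∈ {x ∈ O | (F x).1 ∈ line z} := hj ▸ Set.mem_image_of_mem j hy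
    rw [Function.comp_apply, Function.comp_apply, hinv _ (hOU hjy.1), hrj y hy]

end Profile

/-! ### The correspondence -/

section Correspondence

variable {n : ℕ} {G : Subgroup (SU n)} {z : Cn n} {Z : Set (Cn n)}

theorem HasIsotropyType.exists_stabilizer_eq {V : Type} [MulAction (SU n) V] {H : Subgroup G}
    {w : V} (h : HasIsotropyType G H w) : ∃ g : G, MulAction.stabilizer G (g • w) = H := by
  obtain ⟨g, hg⟩ := h
  refine ⟨g⁻¹, ?_⟩
  rw [MulAction.stabilizer_smul_eq_stabilizer_map_conj, hg, Subgroup.map_map]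
  have : ((MulAut.conj g⁻¹).toMonoidHom).comp (MulAut.conj g).toMonoidHom = MonoidHom.id G := by
    ext1 h
    simp [mul_assoc]
  rw [this, Subgroup.map_id]

theorem orbitTangent_zero : orbitTangent G (0 : Cn n) = ⊥ := by
  rw [eq_bot_iff]
  intro a ha
  obtain ⟨X, -, rfl⟩ := mem_orbitTangent.1 ha
  simp

/-- A cohomogeneity-one Lagrangian in the zero level set forces all non-zero orbits in it to have
dimension `n - 1`. -/
theorem AdmitsCohomOneLagrangian.finrank_orbitTangent (hG : IsCompact (G : Set (SU n)))
    (hZ : Z = momentMap G ⁻¹' {0}) (h : AdmitsCohomOneLagrangian G Z)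
    (hz : momentMap G z = 0) (hz0 : z ≠ 0) :
    Module.finrank ℝ (orbitTangent G z) + 1 = n := by
  -- In ℂ¹, the equation ⟨z, Xz⟩ = 0 with z ≠ 0 already gives Xz = 0. This case is separate because
  -- the given Lagrangian might then consist of the origin's orbit type, so its points need not be
  -- usable as a non-zero base point.
  rcases eq_or_ne n 1 with rfl | hn
  · have h1 : orbitTangent G z = ⊥ := by
      rw [eq_bot_iff]
      intro a ha
      obtain ⟨X, hX, rfl⟩ := mem_orbitTangent.1 ha
      have h2 := momentMap_eq_zero_iff.1 hz X hX
      rw [PiLp.inner_apply, Fin.sum_univ_one, RCLike.inner_apply, mul_eq_zero, map_eq_zero] at h2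
      rw [Submodule.mem_bot]
      refine WithLp.ofLp_injective 2 (funext fun i => ?_)
      rw [Subsingleton.elim i 0]
      refine h2.resolve_right fun h3 => hz0 (WithLp.ofLp_injective 2 (funext fun i => ?_))
      rw [Subsingleton.elim i 0]
      exact h3
    rw [h1, finrank_bot]
  · obtain ⟨L, ⟨x, hx⟩, hLZ, -, hinv, H, hH, hdim⟩ := h
    obtain ⟨g, hg⟩ := (hH x hx).exists_stabilizer_eq
    have hy : momentMap G (g • x) = 0 := by
      have : g • x ∈ momentMap G ⁻¹' {0} := hZ ▸ hLZ (hinv g x hx)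
      exact this
    have h1 := finrank_orbitTangent_add hG (g • x)
    rw [hg] at h1
    have h2 : Module.finrank ℝ (orbitTangent G (g • x)) + 1 = n := by omega
    have hy0 : g • x ≠ 0 := by
      intro h3
      rw [h3, orbitTangent_zero, finrank_bot] at h2
      exact hn h2.symm
    -- Transitivity on lines transfers the orbit dimension from one point of the given Lagrangian to
    -- every non-zero point.
    obtain ⟨k, c, rfl⟩ := exists_smul_smul_eq hG hy hy0 h2 hz
    have hc : c ≠ 0 := by
      rintro rfl
      exact hz0 (zero_smul _ _)
    rw [orbitTangent_smul k c hc]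
    exact h2

/-- Cohomogeneity-two Lagrangians over the zero level set avoid the fixed points. -/
theorem IsInvariantCohomTwo.fst_ne_zero {L : Set (Cn n × ℂ)} (hL : IsInvariantCohomTwo G Z L)
    {w : Cn n × ℂ} (hw : w ∈ L) : w.1 ≠ 0 := by
  intro hw0
  obtain ⟨H, hH, hdim⟩ := hL.cohom
  obtain ⟨g, hg⟩ := (hH w hw).exists_stabilizer_eq
  have htop : H = ⊤ := by
    rw [← hg, eq_top_iff]
    intro k _
    rw [MulAction.mem_stabilizer_iff]
    refine Prod.ext ?_ rfl
    change k • g • w.1 = g • w.1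
    rw [hw0, smul_zero, smul_zero]
  have h1 : (⊤ : Subgroup G).map G.subtype = G := by
    rw [← MonoidHom.range_eq_map, Subgroup.range_subtype]
  rw [htop, h1] at hdim
  -- Full isotropy means dim G/H = 0, so cohomogeneity two forces n + 1 = 2, the case excluded by
  -- assumption.
  exact hL.avoids (by omega) w hw hw0

theorem IsInvariantCohomTwo.isInvariantProfile {L : Set (Cn n × ℂ)}
    (hL : IsInvariantCohomTwo G Z L) : IsInvariantProfile G z (profile z L) where
  subset w hw := ⟨(mem_profile.1 hw).2, hL.fst_ne_zero (mem_profile.1 hw).1⟩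
  invariant c v t hv := by
    induction c using QuotientGroup.induction_on with
    | H g => exact mem_profile.2 ⟨hL.invariant (g : G) _ (mem_profile.1 hv).1, (g • v).2⟩

theorem IsInvariantProfile.isInvariantCohomTwo (hG : IsCompact (G : Set (SU n)))
    (hZ : Z = momentMap G ⁻¹' {0}) (hz : momentMap G z = 0)
    (hdim : Module.finrank ℝ (orbitTangent G z) + 1 = n) {S : Set (Cn n × ℂ)}
    (hS : IsInvariantProfile G z S) : IsInvariantCohomTwo G Z (saturation G S) where
  subset := by
    rintro _ ⟨g, w, hw, rfl⟩
    obtain ⟨b, hb⟩ := mem_line.1 (hS.subset w hw).1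
    rw [hZ]
    change momentMap G (g • w.1) = 0
    rw [hb]
    exact group_smul_mem_zeroLevel (smul_mem_zeroLevel hz b) g
  invariant := isInvariant_saturation S
  cohom := by
    -- Points of the profile are non-zero multiples of z in the first factor, so they all have the
    -- isotropy group of z.
    refine ⟨MulAction.stabilizer G z, ?_, ?_⟩
    · rintro _ ⟨g, w, hw, rfl⟩
      obtain ⟨b, hb0, hb⟩ := exists_eq_smul_of_mem_line (hS.subset w hw).1 (hS.subset w hw).2
      refine ⟨g, ?_⟩
      have h1 : MulAction.stabilizer G w = MulAction.stabilizer G z := by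
        ext k
        rw [MulAction.mem_stabilizer_iff, MulAction.mem_stabilizer_iff, ext_smul, Prod.ext_iff, hb,
          smul_complex_smul]
        simp [smul_right_inj hb0]
      rw [MulAction.stabilizer_smul_eq_stabilizer_map_conj, h1]
    · have := finrank_orbitTangent_add hG z
      omega
  avoids := by
    rintro - _ ⟨g, w, hw, rfl⟩ h0
    exact (hS.subset w hw).2 ((smul_eq_zero_iff_eq g).1 h0)

/-- Each point of L can be moved by G onto the line through z, by transitivity on the complex lines
of the zero level. -/
theorem saturation_profile (hG : IsCompact (G : Set (SU n)))
    (hZ : Z = momentMap G ⁻¹' {0}) (hz : momentMap G z = 0) (hz0 : z ≠ 0)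
    (hdim : Module.finrank ℝ (orbitTangent G z) + 1 = n) {L : Set (Cn n × ℂ)}
    (hL : IsInvariantCohomTwo G Z L) : saturation G (profile z L) = L := by
  ext w
  constructor
  · rintro ⟨g, w, hw, rfl⟩
    exact hL.invariant g w (mem_profile.1 hw).1
  · intro hw
    have hwZ : momentMap G w.1 = 0 := by
      have : w.1 ∈ momentMap G ⁻¹' {0} := hZ ▸ hL.subset w hw
      exact this
    obtain ⟨g, c, hc⟩ := exists_smul_smul_eq hG hz hz0 hdim hwZ
    refine ⟨g, g⁻¹ • w, mem_profile.2 ⟨hL.invariant g⁻¹ w hw, mem_line.2 ⟨c, ?_⟩⟩,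
      (smul_inv_smul g w).symm⟩
    change g⁻¹ • w.1 = c • z
    rw [hc, smul_complex_smul, inv_smul_smul]

theorem IsInvariantProfile.profile_saturation {S : Set (Cn n × ℂ)}
    (hS : IsInvariantProfile G z S) : profile z (saturation G S) = S := by
  ext w
  rw [mem_profile]
  exact ⟨fun h => hS.mem_of_mem_saturation h.1 h.2,
    fun hw => ⟨⟨1, w, hw, (one_smul _ _).symm⟩, (hS.subset w hw).1⟩⟩

/-- Taking profiles and saturating are mutually inverse, for any two regularity conditions that
these operations exchange. -/
theorem correspondence (hG : IsCompact (G : Set (SU n)))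
    (hZ : Z = momentMap G ⁻¹' {0}) (hz : momentMap G z = 0) (hz0 : z ≠ 0)
    (hdim : Module.finrank ℝ (orbitTangent G z) + 1 = n) {p q : Set (Cn n × ℂ) → Prop}
    (hpq : ∀ L, IsInvariantCohomTwo G Z L → p L → q (profile z L))
    (hqp : ∀ S, IsInvariantProfile G z S → q S → p (saturation G S)) :
    Set.BijOn (profile z) {L | IsInvariantCohomTwo G Z L ∧ p L}
        {S | IsInvariantProfile G z S ∧ q S} ∧
      Set.BijOn (saturation G) {S | IsInvariantProfile G z S ∧ q S}
        {L | IsInvariantCohomTwo G Z L ∧ p L} ∧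
      Set.InvOn (saturation G) (profile z) {L | IsInvariantCohomTwo G Z L ∧ p L}
        {S | IsInvariantProfile G z S ∧ q S} := by
  have h1 : Set.MapsTo (profile z) {L | IsInvariantCohomTwo G Z L ∧ p L}
      {S | IsInvariantProfile G z S ∧ q S} := fun L hL =>
    ⟨hL.1.isInvariantProfile, hpq L hL.1 hL.2⟩
  have h2 : Set.MapsTo (saturation G) {S | IsInvariantProfile G z S ∧ q S}
      {L | IsInvariantCohomTwo G Z L ∧ p L} := fun S hS =>
    ⟨hS.1.isInvariantCohomTwo hG hZ hz hdim, hqp S hS.1 hS.2⟩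
  have h3 : Set.InvOn (saturation G) (profile z) {L | IsInvariantCohomTwo G Z L ∧ p L}
      {S | IsInvariantProfile G z S ∧ q S} :=
    ⟨fun L hL => saturation_profile hG hZ hz hz0 hdim hL.1, fun S hS => hS.1.profile_saturation⟩
  exact ⟨h3.bijOn h1 h2, h3.symm.bijOn h2 h1, h3⟩

end Correspondence

end CohomTwo
-- The correspondence for embedded and immersed Lagrangians
theorem mainTheorem9 (n : ℕ) (G : Subgroup (CohomTwo.SU n))
    (hGcompact : IsCompact (G : Set (CohomTwo.SU n)))
    (hGconn : IsConnected (G : Set (CohomTwo.SU n)))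
    (Z : Set (CohomTwo.Cn n)) (hZ : CohomTwo.IsZeroLevelComponent G Z)
    (hadm : CohomTwo.AdmitsCohomOneLagrangian G Z)
    (z : CohomTwo.Cn n) (hzZ : z ∈ Z) (hz0 : z ≠ 0) :
    -- the correspondence for embedded Lagrangians
    (Set.BijOn (CohomTwo.profile z)
        {L | CohomTwo.IsInvariantCohomTwo G Z L ∧
          CohomTwo.IsEmbeddedIsotropic CohomTwo.sympExt (n + 1) L}
        {S | CohomTwo.IsInvariantProfile G z S ∧
          CohomTwo.IsEmbeddedIsotropic CohomTwo.sympExt 2 S} ∧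
      Set.BijOn (CohomTwo.saturation G)
        {S | CohomTwo.IsInvariantProfile G z S ∧
          CohomTwo.IsEmbeddedIsotropic CohomTwo.sympExt 2 S}
        {L | CohomTwo.IsInvariantCohomTwo G Z L ∧
          CohomTwo.IsEmbeddedIsotropic CohomTwo.sympExt (n + 1) L} ∧
      Set.InvOn (CohomTwo.saturation G) (CohomTwo.profile z)
        {L | CohomTwo.IsInvariantCohomTwo G Z L ∧
          CohomTwo.IsEmbeddedIsotropic CohomTwo.sympExt (n + 1) L}
        {S | CohomTwo.IsInvariantProfile G z S ∧
          CohomTwo.IsEmbeddedIsotropic CohomTwo.sympExt 2 S}) ∧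
    -- the correspondence for immersed Lagrangians
    (Set.BijOn (CohomTwo.profile z)
        {L | CohomTwo.IsInvariantCohomTwo G Z L ∧
          CohomTwo.IsImmersedIsotropic CohomTwo.sympExt (n + 1) L}
        {S | CohomTwo.IsInvariantProfile G z S ∧
          CohomTwo.IsImmersedIsotropic CohomTwo.sympExt 2 S} ∧
      Set.BijOn (CohomTwo.saturation G)
        {S | CohomTwo.IsInvariantProfile G z S ∧
          CohomTwo.IsImmersedIsotropic CohomTwo.sympExt 2 S}
        {L | CohomTwo.IsInvariantCohomTwo G Z L ∧
          CohomTwo.IsImmersedIsotropic CohomTwo.sympExt (n + 1) L} ∧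
      Set.InvOn (CohomTwo.saturation G) (CohomTwo.profile z)
        {L | CohomTwo.IsInvariantCohomTwo G Z L ∧
          CohomTwo.IsImmersedIsotropic CohomTwo.sympExt (n + 1) L}
        {S | CohomTwo.IsInvariantProfile G z S ∧
          CohomTwo.IsImmersedIsotropic CohomTwo.sympExt 2 S}) := by
  have hZeq := CohomTwo.isZeroLevelComponent_eq hZ
  have hz : CohomTwo.momentMap G z = 0 := by
    have : z ∈ CohomTwo.momentMap G ⁻¹' {0} := hZeq ▸ hzZ
    exact this
  have hdim := hadm.finrank_orbitTangent hGcompact hZeq hz hz0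
  have hLZ : ∀ L, CohomTwo.IsInvariantCohomTwo G Z L →
      ∀ w ∈ L, CohomTwo.momentMap G w.1 = 0 := fun L hL w hw => by
    have : w.1 ∈ CohomTwo.momentMap G ⁻¹' {0} := hZeq ▸ hL.subset w hw
    exact this
  exact ⟨CohomTwo.correspondence hGcompact hZeq hz hz0 hdim
      (fun L hL hemb => CohomTwo.isEmbeddedIsotropic_profile hGcompact hz hz0 hdim (hLZ L hL)
        (fun _ hw => hL.fst_ne_zero hw) hemb)
      (fun S hS hemb => CohomTwo.isEmbeddedIsotropic_saturation hGcompact hz hz0 hdim hS hemb),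
    CohomTwo.correspondence hGcompact hZeq hz hz0 hdim
      (fun L hL himm => CohomTwo.isImmersedIsotropic_profile hGcompact hz hz0 hdim (hLZ L hL)
        (fun _ hw => hL.fst_ne_zero hw) himm)
      (fun S hS himm => CohomTwo.isImmersedIsotropic_saturation hGcompact hz hz0 hdim hS himm)⟩
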